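/- **Theorem.** Let $D\subset\mathbb R^2$ be open with coordinates $(x,y)$, and let $S$ be a surface in $\mathbb P^3$ given by a smooth lift $f:D\to\mathbb R^4$ satisfying the canonical system $$f_{xx}=b f_y+p f,\qquad f_{yy}=c f_x+q f$$ with smooth functions $b,c,p,q:D\to\mathbb R$ such that $bc\neq0$ everywhere on $D$. Let $F=(f,f_1,f_2,\eta)$ be its Wilczynski frame, with columns $f$, $f_1=f_x-\frac{c_x}{2c}f$, $f_2=f_y-\frac{b_y}{2b}f$ and $$\eta=f_{xy}-\frac{c_x}{2c}f_y-\frac{b_y}{2b}f_x+\Big(\frac{b_yc_x}{4bc}-\frac{bc}{2}\Big)f,$$ and assume that $F$ takes values in $\mathrm{SL}_4\mathbb R$. Put $$P=p+\frac{b_y}{2}-\frac{c_{xx}}{2c}+\frac{c_x^2}{4c^2},\qquad Q=q+\frac{c_x}{2}-\frac{b_{yy}}{2b}+\frac{b_y^2}{4b^2}.$$ Let $\mathcal Q$ be the space of real symmetric $4\times4$ matrices of determinant one and signature $(2,2)$ with the pseudo-Riemannian metric $\langle X,Y\rangle_p=\operatorname{Tr}(p^{-1}Xp^{-1}Y)$,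 and let $g_2=FJ_2F^t$ be the conformal Gauss map, where $J_2=\begin{pmatrix}0&0&0&1\\0&0&-1&0\\0&-1&0&0\\1&0&0&0\end{pmatrix}$. Let $\mathfrak{sl}_4\mathbb R=\mathfrak k_2\oplus\mathfrak p_2$ be the decomposition into the $(+1)$- and $(-1)$-eigenspaces of the involution $\tau_2(X)=-J_2X^tJ_2$. Write $F^{-1}dF=U\,dx+V\,dy$, and for $\lambda\in\mathbb R\setminus\{0\}$ let $$\alpha^\lambda=(U_{\mathfrak k_2}+\lambda^{-1}U_{\mathfrak p_2})\,dx+(V_{\mathfrak k_2}+\lambda V_{\mathfrak p_2})\,dy .$$ Then the following are equivalent: 1. $S$ is projective minimal, that is, a critical point of the projective area functional (the integral of the projective area element, which is $bc\,dx\,dy$ in asymptotic coordinates) with respect to all smooth variations of $f$ with compact support in $D$; 2. $bQ_y+2b_yQ=0$ and $cP_x+2c_xP=0$ on $D$; 3. $g_2$ is a conformal Lorentz harmonic map from $D$ into $\mathcal Q$, where $D$ carries the Lorentz conformal structure with null coordinates $(x,y)$: it is a smooth map into $\mathcal Q$, the pull-back of the metric is a nowhere vanishing multiple of $dx\,dy$,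 and the tension field $\nabla_{\partial_x}(g_2)_y$ vanishes (up to a nonzero factor, $\nabla$ being the pulled-back Levi-Civita connection); 4. the connection $d+\alpha^\lambda$ is flat on $D$ for every $\lambda\in\mathbb R\setminus\{0\}$. -/

import Mathlib

open Set
open scoped ContDiff

noncomputable section

/-- The partial derivative `∂h/∂x` (for `i = 0`) or `∂h/∂y` (for `i = 1`) of a function of
two real variables `(x, y)`. -/
def pd {E : Type*} [NormedAddCommGroup E] [NormedSpace ℝ E] (i : Fin 2) (h : ℝ × ℝ → E) :
    ℝ × ℝ → E :=
  fun z => fderiv ℝ h z ((![((1 : ℝ), (0 : ℝ)), ((0 : ℝ), (1 : ℝ))] : Fin 2 → ℝ × ℝ) i)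

/-- Entrywise partial derivative of a matrix-valued function of `(x, y)`. -/
def matPd {m n : Type*} (i : Fin 2) (A : ℝ × ℝ → Matrix m n ℝ) : ℝ × ℝ → Matrix m n ℝ :=
  fun z => Matrix.of fun a b => pd i (fun w => A w a b) z

/-- The determinant of four vectors of `ℝ⁴`. -/
def det4 (u v w r : Fin 4 → ℝ) : ℝ := (Matrix.of ![u, v, w, r]).det

/-! ### The projective area functional

A surface in `ℙ³` is given by a local lift `φ : ℝ² → ℝ⁴ ∖ {0}`, in arbitrary coordinates.  Its second
fundamental form `h` and its cubic form `C` (Darboux, Fubini) are the tensors below, which are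
well defined up to a common factor when the lift is rescaled; `½ |C|²_h dA_h` is the
projective area element.  In asymptotic coordinates it equals `b c dx dy`, see
`projectiveAreaDensity_of_asymptotic`. -/

/-- The second fundamental form `h_ij = det (φ, φ_x, φ_y, φ_ij)` of a lift. -/
def secondForm (φ : ℝ × ℝ → Fin 4 → ℝ) (z : ℝ × ℝ) : Matrix (Fin 2) (Fin 2) ℝ :=
  Matrix.of fun i j => det4 (φ z) (pd 0 φ z) (pd 1 φ z) (pd i (pd j φ) z)

/-- `T_ijk = det (φ, φ_x, φ_y, φ_ijk) - ½ (∂_i h_jk + ∂_j h_ki + ∂_k h_ij)`; modulo multiples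
`h_ij v_k + h_jk v_i + h_ki v_j` of `h` it is a symmetric cubic tensor. -/
def preCubicForm (φ : ℝ × ℝ → Fin 4 → ℝ) (z : ℝ × ℝ) (i j k : Fin 2) : ℝ :=
  det4 (φ z) (pd 0 φ z) (pd 1 φ z) (pd i (pd j (pd k φ)) z)
    - (pd i (fun w => secondForm φ w j k) z + pd j (fun w => secondForm φ w k i) z
      + pd k (fun w => secondForm φ w i j) z) / 2

/-- The trace `v_k = h^ij T_ijk`. -/
def preCubicTrace (φ : ℝ × ℝ → Fin 4 → ℝ) (z : ℝ × ℝ) (k : Fin 2) : ℝ :=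
  ∑ i, ∑ j, (secondForm φ z)⁻¹ i j * preCubicForm φ z i j k

/-- The (apolar) cubic form of the surface: the `h`-trace-free part of `T_ijk`.  In asymptotic
coordinates it is a multiple of `b dx³ + c dy³`. -/
def cubicForm (φ : ℝ × ℝ → Fin 4 → ℝ) (z : ℝ × ℝ) (i j k : Fin 2) : ℝ :=
  preCubicForm φ z i j k
    - (secondForm φ z i j * preCubicTrace φ z k + secondForm φ z j k * preCubicTrace φ z i
      + secondForm φ z k i * preCubicTrace φ z j) / 4

/-- The density with respect to `dx dy` of the projective area element `½ |C|²_h dA_h`. -/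
def projectiveAreaDensity (φ : ℝ × ℝ → Fin 4 → ℝ) (z : ℝ × ℝ) : ℝ :=
  (1 / 2) * Real.sqrt |(secondForm φ z).det| *
    ∑ i, ∑ j, ∑ k, ∑ i', ∑ j', ∑ k',
      (secondForm φ z)⁻¹ i i' * (secondForm φ z)⁻¹ j j' * (secondForm φ z)⁻¹ k k' *
        cubicForm φ z i j k * cubicForm φ z i' j' k'

/-- The surface with lift `f : D → ℝ⁴` is projective minimal: it is a critical point of the
projective area functional for all smooth variations supported in a compact subset of `D`. -/
def IsProjectiveMinimal (D : Set (ℝ × ℝ)) (f : ℝ × ℝ → Fin 4 → ℝ) : Prop :=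
  ∀ (Φ : ℝ → ℝ × ℝ → Fin 4 → ℝ) (K : Set (ℝ × ℝ)), IsCompact K → K ⊆ D →
    ContDiffOn ℝ ∞ (fun w : ℝ × (ℝ × ℝ) => Φ w.1 w.2) (univ ×ˢ D) →
    (∀ z ∈ D, Φ 0 z = f z) →
    (∀ t, ∀ z ∈ D \ K, Φ t z = f z) →
    HasDerivAt (fun t => ∫ z in K, projectiveAreaDensity (Φ t) z) 0 0

/-! ### The canonical system and the Wilczynski frame -/

/-- The Wilczynski frame `F = (f, f₁, f₂, η)`, with these vectors as columns. -/
def wilczynskiFrame (f : ℝ × ℝ → Fin 4 → ℝ) (b c : ℝ × ℝ → ℝ) (z : ℝ × ℝ) :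
    Matrix (Fin 4) (Fin 4) ℝ :=
  (Matrix.of ![
    f z,
    pd 0 f z - (pd 0 c z / (2 * c z)) • f z,
    pd 1 f z - (pd 1 b z / (2 * b z)) • f z,
    pd 0 (pd 1 f) z - (pd 0 c z / (2 * c z)) • pd 1 f z - (pd 1 b z / (2 * b z)) • pd 0 f z
      + (pd 1 b z * pd 0 c z / (4 * b z * c z) - b z * c z / 2) • f z]).transpose

/-- `f` is a lift to `ℝ⁴` of a surface in `ℙ³`, in asymptotic coordinates `(x, y) ∈ D`, that
satisfies the canonical system `f_xx = b f_y + p f`, `f_yy = c f_x + q f`, has nowhere zero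
Fubini-Pick invariant `8 b c`, and whose Wilczynski frame takes values in `SL₄ ℝ`. -/
structure IsCanonicalLift (D : Set (ℝ × ℝ)) (f : ℝ × ℝ → Fin 4 → ℝ)
    (b c p q : ℝ × ℝ → ℝ) : Prop where
  isOpen : IsOpen D
  contDiffOn_f : ContDiffOn ℝ ∞ f D
  contDiffOn_b : ContDiffOn ℝ ∞ b D
  contDiffOn_c : ContDiffOn ℝ ∞ c D
  contDiffOn_p : ContDiffOn ℝ ∞ p D
  contDiffOn_q : ContDiffOn ℝ ∞ q D
  f_xx : ∀ z ∈ D, pd 0 (pd 0 f) z = b z • pd 1 f z + p z • f z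
  f_yy : ∀ z ∈ D, pd 1 (pd 1 f) z = c z • pd 0 f z + q z • f z
  fubiniPick_ne_zero : ∀ z ∈ D, b z * c z ≠ 0
  frame_det : ∀ z ∈ D, (wilczynskiFrame f b c z).det = 1

/-- `P = p + b_y / 2 - c_xx / (2 c) + c_x² / (4 c²)`. -/
def projP (b c p : ℝ × ℝ → ℝ) (z : ℝ × ℝ) : ℝ :=
  p z + pd 1 b z / 2 - pd 0 (pd 0 c) z / (2 * c z) + pd 0 c z ^ 2 / (4 * c z ^ 2)

/-- `Q = q + c_x / 2 - b_yy / (2 b) + b_y² / (4 b²)`. -/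
def projQ (b c q : ℝ × ℝ → ℝ) (z : ℝ × ℝ) : ℝ :=
  q z + pd 0 c z / 2 - pd 1 (pd 1 b) z / (2 * b z) + pd 1 b z ^ 2 / (4 * b z ^ 2)

/-- Thomsen's differential equations `b Q_y + 2 b_y Q = 0`, `c P_x + 2 c_x P = 0`. -/
def SatisfiesThomsen (D : Set (ℝ × ℝ)) (b c p q : ℝ × ℝ → ℝ) : Prop :=
  ∀ z ∈ D,
    b z * pd 1 (projQ b c q) z + 2 * pd 1 b z * projQ b c q z = 0 ∧
    c z * pd 0 (projP b c p) z + 2 * pd 0 c z * projP b c p z = 0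

/-! ### Maps into the space of quadrics -/

/-- `J₂ = offdiag (1, -1, -1, 1)`. -/
def matJ2 : Matrix (Fin 4) (Fin 4) ℝ :=
  !![0, 0, 0, 1; 0, 0, -1, 0; 0, -1, 0, 0; 1, 0, 0, 0]

/-- The conformal Gauss map `g₂ = F J₂ Fᵗ`. -/
def conformalGaussMap (f : ℝ × ℝ → Fin 4 → ℝ) (b c : ℝ × ℝ → ℝ) (z : ℝ × ℝ) :
    Matrix (Fin 4) (Fin 4) ℝ :=
  wilczynskiFrame f b c z * matJ2 * (wilczynskiFrame f b c z).transpose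

/-- The space of symmetric matrices of determinant one and signature `(2, 2)`. -/
def quadricSpace : Set (Matrix (Fin 4) (Fin 4) ℝ) :=
  {p | p.IsSymm ∧ p.det = 1 ∧ sigPos p.toQuadraticForm' = 2 ∧ sigNeg p.toQuadraticForm' = 2}

/-- The invariant pseudo-Riemannian metric `⟨X, Y⟩_p = Tr (p⁻¹ X p⁻¹ Y)` on `quadricSpace`. -/
def quadricMetric (p X Y : Matrix (Fin 4) (Fin 4) ℝ) : ℝ := (p⁻¹ * X * p⁻¹ * Y).trace

/-- The Christoffel bilinear map `Γ_p (X, Y) = -½ (X p⁻¹ Y + Y p⁻¹ X)` of the Levi-Civita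
connection of `quadricMetric`: it is symmetric and metric, see
`quadricChristoffel_symm` and `hasDerivAt_quadricMetric`. -/
def quadricChristoffel (p X Y : Matrix (Fin 4) (Fin 4) ℝ) : Matrix (Fin 4) (Fin 4) ℝ :=
  -((1 / 2 : ℝ) • (X * p⁻¹ * Y + Y * p⁻¹ * X))

/-- The covariant derivative `∇_i W` of a vector field `W` along a map `g` into
`quadricSpace`. -/
def covDerivAlong (i : Fin 2) (g W : ℝ × ℝ → Matrix (Fin 4) (Fin 4) ℝ) (z : ℝ × ℝ) :
    Matrix (Fin 4) (Fin 4) ℝ :=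
  matPd i W z + quadricChristoffel (g z) (matPd i g z) (W z)

/-- `g` is a smooth map from `D` into `quadricSpace`. -/
def IsSmoothIntoQuadrics (D : Set (ℝ × ℝ)) (g : ℝ × ℝ → Matrix (Fin 4) (Fin 4) ℝ) : Prop :=
  (∀ i j, ContDiffOn ℝ ∞ (fun z => g z i j) D) ∧ ∀ z ∈ D, g z ∈ quadricSpace

/-- `g` is conformal for the Lorentz structure with null coordinates `(x, y)`: the pull-back of
the metric is a nowhere zero multiple of `dx dy`. -/
def IsLorentzConformal (D : Set (ℝ × ℝ)) (g : ℝ × ℝ → Matrix (Fin 4) (Fin 4) ℝ) : Prop :=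
  ∀ z ∈ D,
    quadricMetric (g z) (matPd 0 g z) (matPd 0 g z) = 0 ∧
    quadricMetric (g z) (matPd 1 g z) (matPd 1 g z) = 0 ∧
    quadricMetric (g z) (matPd 0 g z) (matPd 1 g z) ≠ 0

/-- `g` is Lorentz harmonic: its tension field vanishes.  For a Lorentz metric `2 ρ dx dy` in null
coordinates, the Christoffel symbols with lower indices `x y` are zero, so the tension field
is `(2 / ρ) ∇_x g_y`. -/
def IsLorentzHarmonic (D : Set (ℝ × ℝ)) (g : ℝ × ℝ → Matrix (Fin 4) (Fin 4) ℝ) : Prop :=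
  ∀ z ∈ D, covDerivAlong 0 g (matPd 1 g) z = 0

/-! ### The associated family of connections -/

/-- The differential `τ₂ X = - J₂ Xᵗ J₂` of the involution. -/
def involTau2 (X : Matrix (Fin 4) (Fin 4) ℝ) : Matrix (Fin 4) (Fin 4) ℝ :=
  -(matJ2 * X.transpose * matJ2)

/-- The component of `X` in the fixed space `𝔨₂` of `τ₂`. -/
def partK2 (X : Matrix (Fin 4) (Fin 4) ℝ) : Matrix (Fin 4) (Fin 4) ℝ :=
  (1 / 2 : ℝ) • (X + involTau2 X)

/-- The component of `X` in the `(-1)`-eigenspace `𝔭₂` of `τ₂`. -/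
def partP2 (X : Matrix (Fin 4) (Fin 4) ℝ) : Matrix (Fin 4) (Fin 4) ℝ :=
  (1 / 2 : ℝ) • (X - involTau2 X)

/-- The coefficient `F⁻¹ F_x` (`i = 0`) or `F⁻¹ F_y` (`i = 1`) of `α = F⁻¹ dF`. -/
def maurerCartan (i : Fin 2) (F : ℝ × ℝ → Matrix (Fin 4) (Fin 4) ℝ) (z : ℝ × ℝ) :
    Matrix (Fin 4) (Fin 4) ℝ :=
  (F z)⁻¹ * matPd i F z

/-- `U^l = U_𝔨 + l⁻¹ U_𝔭`, the `dx`-coefficient of `α^l`. -/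
def familyU (F : ℝ × ℝ → Matrix (Fin 4) (Fin 4) ℝ) (l : ℝ) (z : ℝ × ℝ) :
    Matrix (Fin 4) (Fin 4) ℝ :=
  partK2 (maurerCartan 0 F z) + l⁻¹ • partP2 (maurerCartan 0 F z)

/-- `V^l = V_𝔨 + l V_𝔭`, the `dy`-coefficient of `α^l`. -/
def familyV (F : ℝ × ℝ → Matrix (Fin 4) (Fin 4) ℝ) (l : ℝ) (z : ℝ × ℝ) :
    Matrix (Fin 4) (Fin 4) ℝ :=
  partK2 (maurerCartan 1 F z) + l • partP2 (maurerCartan 1 F z)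

/-- The connection `d + A dx + B dy` is flat on `D`: its curvature
`(B_x - A_y + [A, B]) dx ∧ dy` vanishes. -/
def IsFlatConnection (D : Set (ℝ × ℝ)) (A B : ℝ × ℝ → Matrix (Fin 4) (Fin 4) ℝ) : Prop :=
  ∀ z ∈ D, matPd 0 B z - matPd 1 A z + (A z * B z - B z * A z) = 0

/-! ### Checks of the definitions -/

theorem quadricChristoffel_symm (p X Y : Matrix (Fin 4) (Fin 4) ℝ) :
    quadricChristoffel p X Y = quadricChristoffel p Y X := by
  simp only [quadricChristoffel, add_comm]

open scoped Matrix.Norms.Operator in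
/-- The derivative of the metric in the direction `Z` is
`⟨Γ (Z, X), Y⟩ + ⟨X, Γ (Z, Y)⟩`. -/
theorem hasDerivAt_quadricMetric (p X Y Z : Matrix (Fin 4) (Fin 4) ℝ) (hp : IsUnit p) :
    HasDerivAt (fun t : ℝ => quadricMetric (p + t • Z) X Y)
      (quadricMetric p (quadricChristoffel p Z X) Y +
        quadricMetric p X (quadricChristoffel p Z Y)) 0 := by
  obtain ⟨u, rfl⟩ := hp
  have h1 : HasDerivAt (fun t : ℝ => (u : Matrix (Fin 4) (Fin 4) ℝ) + t • Z) Z 0 := by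
    have h0 := ((hasDerivAt_id (0 : ℝ)).smul_const Z).const_add (u : Matrix (Fin 4) (Fin 4) ℝ)
    rw [one_smul] at h0
    exact h0
  have h2 : HasDerivAt (fun t : ℝ => ((u : Matrix (Fin 4) (Fin 4) ℝ) + t • Z)⁻¹)
      (-((u : Matrix (Fin 4) (Fin 4) ℝ)⁻¹ * Z * (u : Matrix (Fin 4) (Fin 4) ℝ)⁻¹)) 0 := by
    have h3 := hasFDerivAt_ringInverse (𝕜 := ℝ) u
    have h4 : HasDerivAt (fun t : ℝ => Ring.inverse ((u : Matrix (Fin 4) (Fin 4) ℝ) + t • Z)) _ 0 :=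
      HasFDerivAt.comp_hasDerivAt_of_eq (0 : ℝ) h3 h1 (by simp)
    have h5 : (↑u⁻¹ : Matrix (Fin 4) (Fin 4) ℝ) = (u : Matrix (Fin 4) (Fin 4) ℝ)⁻¹ := by simp
    simp only [h5] at h4
    simp only [Matrix.nonsing_inv_eq_ringInverse] at h4 ⊢
    exact h4
  have h5 := (((h2.mul_const X).mul h2).mul_const Y)
  have h6 := (Matrix.traceLinearMap (Fin 4) ℝ ℝ).toContinuousLinearMap.hasFDerivAt.comp_hasDerivAt
    (0 : ℝ) h5
  convert! h6 using 1
  simp only [quadricMetric, quadricChristoffel, zero_smul, add_zero]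
  set v := ((u : Matrix (Fin 4) (Fin 4) ℝ))⁻¹
  have e1 : (v * (X * (v * (Y * (v * Z))))).trace = (v * (Z * (v * (X * (v * Y))))).trace := by
    have := Matrix.trace_mul_comm (v * X * v * Y) (v * Z)
    simpa only [mul_assoc] using this
  have e2 : ∀ M : Matrix (Fin 4) (Fin 4) ℝ,
      (Matrix.traceLinearMap (Fin 4) ℝ ℝ).toContinuousLinearMap M = M.trace := fun M => rfl
  refine Eq.trans ?_ (e2 _).symm
  simp only [mul_assoc, add_mul,
    mul_add, neg_mul, mul_neg, smul_mul_assoc, mul_smul_comm, Matrix.trace_add, Matrix.trace_neg,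
    Matrix.trace_smul, smul_eq_mul, smul_add, e1]
  ring

/-- In asymptotic coordinates, for an arbitrary lift with `φ_xx = a φ_x + b φ_y + p φ` and
`φ_yy = a' φ_y + c φ_x + q φ`, the projective area element is `b c dx dy`. -/
theorem projectiveAreaDensity_of_asymptotic {D : Set (ℝ × ℝ)} (hD : IsOpen D)
    {φ : ℝ × ℝ → Fin 4 → ℝ} (hφ : ContDiffOn ℝ ∞ φ D) {a b p a' c q : ℝ × ℝ → ℝ}
    (ha : DifferentiableOn ℝ a D) (hb : DifferentiableOn ℝ b D) (hp : DifferentiableOn ℝ p D)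
    (ha' : DifferentiableOn ℝ a' D) (hc : DifferentiableOn ℝ c D) (hq : DifferentiableOn ℝ q D)
    (hxx : ∀ z ∈ D, pd 0 (pd 0 φ) z = a z • pd 0 φ z + b z • pd 1 φ z + p z • φ z)
    (hyy : ∀ z ∈ D, pd 1 (pd 1 φ) z = a' z • pd 1 φ z + c z • pd 0 φ z + q z • φ z)
    (hpos : ∀ z ∈ D, 0 < det4 (φ z) (pd 0 φ z) (pd 1 φ z) (pd 0 (pd 1 φ) z))
    {z : ℝ × ℝ} (hz : z ∈ D) :
    projectiveAreaDensity φ z = b z * c z := by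
  have hnhds : D ∈ nhds z := hD.mem_nhds hz
  have hsm : ∀ (i : Fin 2) {g : ℝ × ℝ → Fin 4 → ℝ}, ContDiffOn ℝ ∞ g D →
      ContDiffOn ℝ ∞ (pd i g) D := fun i g hg =>
    (hg.fderiv_of_isOpen hD (by simp)).clm_apply contDiffOn_const
  have hdi : ∀ {g : ℝ × ℝ → Fin 4 → ℝ}, ContDiffOn ℝ ∞ g D → DifferentiableAt ℝ g z :=
    fun hg => (hg.differentiableOn (by simp)).differentiableAt hnhds
  -- symmetry of second derivatives
  have hcomm' : ∀ {φ : ℝ × ℝ → Fin 4 → ℝ}, ContDiffOn ℝ ∞ φ D →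
      ∀ w ∈ D, pd 1 (pd 0 φ) w = pd 0 (pd 1 φ) w := by
    intro φ hφ w hw
    have hcd : ContDiffAt ℝ ∞ φ w := hφ.contDiffAt (hD.mem_nhds hw)
    have hs := hcd.isSymmSndFDerivAt (by simpa using WithTop.coe_le_coe.2 (le_top : (2 : ℕ∞) ≤ ⊤))
    have hd : DifferentiableAt ℝ (fderiv ℝ φ) w :=
      (hcd.fderiv_right (m := ∞) (by simp)).differentiableAt (by simp)
    have key : ∀ i j : Fin 2, pd i (pd j φ) w = fderiv ℝ (fderiv ℝ φ) w
        ((![((1 : ℝ), (0 : ℝ)), ((0 : ℝ), (1 : ℝ))] : Fin 2 → ℝ × ℝ) i)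
        ((![((1 : ℝ), (0 : ℝ)), ((0 : ℝ), (1 : ℝ))] : Fin 2 → ℝ × ℝ) j) := by
      intro i j
      unfold pd
      rw [fderiv_clm_apply hd (by fun_prop)]
      simp
    rw [key, key]
    exact hs _ _
  have hcomm := hcomm' hφ
  have pd_congr : ∀ {E : Type} [NormedAddCommGroup E] [NormedSpace ℝ E] (i : Fin 2)
      {g g' : ℝ × ℝ → E}, (∀ w ∈ D, g w = g' w) → pd i g z = pd i g' z := by
    intro E _ _ i g g' h
    unfold pd
    rw [Filter.EventuallyEq.fderiv_eq (Filter.eventually_of_mem hnhds h)]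
  have hmul : ∀ (i : Fin 2) {s : ℝ × ℝ → ℝ} {g : ℝ × ℝ → Fin 4 → ℝ}, DifferentiableOn ℝ s D →
      ContDiffOn ℝ ∞ g D →
      pd i (fun w => s w • g w) z = s z • pd i g z + pd i s z • g z := by
    intro i s g hs hg
    unfold pd
    rw [fderiv_fun_smul (hs.differentiableAt hnhds) (hdi hg)]
    simp
  have hdsm : ∀ {s : ℝ × ℝ → ℝ} {g : ℝ × ℝ → Fin 4 → ℝ}, DifferentiableOn ℝ s D →
      ContDiffOn ℝ ∞ g D → DifferentiableAt ℝ (fun w => s w • g w) z :=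
    fun hs hg => (hs.differentiableAt hnhds).smul (hdi hg)
  have hadd : ∀ (i : Fin 2) {g g' : ℝ × ℝ → Fin 4 → ℝ}, DifferentiableAt ℝ g z →
      DifferentiableAt ℝ g' z → pd i (fun w => g w + g' w) z = pd i g z + pd i g' z := by
    intro i g g' hg hg'
    unfold pd
    rw [fderiv_fun_add hg hg']
    simp
  have hx := hsm 0 hφ
  have hy := hsm 1 hφ
  have hxxx : pd 0 (pd 0 (pd 0 φ)) z = (a z • pd 0 (pd 0 φ) z + pd 0 a z • pd 0 φ z) +
      (b z • pd 0 (pd 1 φ) z + pd 0 b z • pd 1 φ z) + (p z • pd 0 φ z + pd 0 p z • φ z) := by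
    rw [pd_congr 0 hxx]
    erw [hadd 0 ((hdsm ha hx).add (hdsm hb hy)) (hdsm hp hφ),
      hadd 0 (hdsm ha hx) (hdsm hb hy), hmul 0 ha hx, hmul 0 hb hy, hmul 0 hp hφ]
  have hyyy : pd 1 (pd 1 (pd 1 φ)) z = (a' z • pd 1 (pd 1 φ) z + pd 1 a' z • pd 1 φ z) +
      (c z • pd 0 (pd 1 φ) z + pd 1 c z • pd 0 φ z) + (q z • pd 1 φ z + pd 1 q z • φ z) := by
    rw [pd_congr 1 hyy]
    erw [hadd 1 ((hdsm ha' hy).add (hdsm hc hx)) (hdsm hq hφ),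
      hadd 1 (hdsm ha' hy) (hdsm hc hx), hmul 1 ha' hy, hmul 1 hc hx, hmul 1 hq hφ,
      hcomm z hz]
  set W := det4 (φ z) (pd 0 φ z) (pd 1 φ z) (pd 0 (pd 1 φ) z) with hW
  have hWpos : 0 < W := hpos z hz
  have lin : ∀ (u v w r s : Fin 4 → ℝ) (k : ℝ), det4 u v w (r + s) = det4 u v w r + det4 u v w s ∧
      det4 u v w (k • r) = k * det4 u v w r ∧ det4 u v w u = 0 ∧ det4 u v w v = 0 ∧
      det4 u v w w = 0 := by
    intro u v w r s k
    refine ⟨?_, ?_, ?_, ?_, ?_⟩ <;>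
    · simp [det4, Matrix.det_succ_row_zero, Fin.sum_univ_succ, Fin.succAbove]
      ring
  have l1 : ∀ u v w r s, det4 u v w (r + s) = det4 u v w r + det4 u v w s :=
    fun u v w r s => (lin u v w r s 0).1
  have l2 : ∀ u v w r (k : ℝ), det4 u v w (k • r) = k * det4 u v w r :=
    fun u v w r k => (lin u v w r 0 k).2.1
  have l3 : ∀ u v w, det4 u v w u = 0 := fun u v w => (lin u v w 0 0 0).2.2.1
  have l4 : ∀ u v w, det4 u v w v = 0 := fun u v w => (lin u v w 0 0 0).2.2.2.1
  have l5 : ∀ u v w, det4 u v w w = 0 := fun u v w => (lin u v w 0 0 0).2.2.2.2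
  have h00 : ∀ w ∈ D, secondForm φ w 0 0 = 0 := by
    intro w hw
    simp [secondForm, hxx w hw, l1, l2, l3, l4, l5]
  have h11 : ∀ w ∈ D, secondForm φ w 1 1 = 0 := by
    intro w hw
    simp [secondForm, hyy w hw, l1, l2, l3, l4, l5]
  have h01 : secondForm φ z 0 1 = W := by simp [secondForm, hW]
  have h10 : secondForm φ z 1 0 = W := by simp [secondForm, hW, hcomm z hz]
  have hsymm : ∀ w ∈ D, secondForm φ w 1 0 = secondForm φ w 0 1 := by
    intro w hw
    simp [secondForm, hcomm w hw]
  have d00 : ∀ i, pd i (fun w => secondForm φ w 0 0) z = 0 := by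
    intro i
    rw [pd_congr i (g' := fun _ => (0 : ℝ)) h00]
    simp [pd]
  have d11 : ∀ i, pd i (fun w => secondForm φ w 1 1) z = 0 := by
    intro i
    rw [pd_congr i (g' := fun _ => (0 : ℝ)) h11]
    simp [pd]
  have d10 : ∀ i, pd i (fun w => secondForm φ w 1 0) z = pd i (fun w => secondForm φ w 0 1) z :=
    fun i => pd_congr i hsymm
  have T0 : preCubicForm φ z 0 0 0 = b z * W := by
    simp [preCubicForm, d00, hxxx, hxx z hz, l1, l2, l3, l4, l5, hW]
  have T1 : preCubicForm φ z 1 1 1 = c z * W := by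
    simp [preCubicForm, d11, hyyy, hyy z hz, l1, l2, l3, l4, l5, hW]
  have hmat : secondForm φ z = !![0, W; W, 0] := by
    ext i j
    fin_cases i <;> fin_cases j <;> simp [h00 z hz, h01, h10, h11 z hz]
  have hdet : (secondForm φ z).det = -(W * W) := by simp [hmat, Matrix.det_fin_two]
  have hinv : (secondForm φ z)⁻¹ = !![0, W⁻¹; W⁻¹, 0] := by
    rw [hmat]
    apply Matrix.inv_eq_right_inv
    ext i j
    fin_cases i <;> fin_cases j <;> simp [Matrix.mul_apply, hWpos.ne']
  have t1 : pd 0 (pd 1 (pd 0 φ)) z = pd 0 (pd 0 (pd 1 φ)) z := pd_congr 0 hcomm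
  have t2 : pd 1 (pd 0 (pd 0 φ)) z = pd 0 (pd 0 (pd 1 φ)) z := (hcomm' hx z hz).trans t1
  have t3 : pd 1 (pd 0 (pd 1 φ)) z = pd 0 (pd 1 (pd 1 φ)) z := hcomm' hy z hz
  have t4 : pd 1 (pd 1 (pd 0 φ)) z = pd 0 (pd 1 (pd 1 φ)) z := (pd_congr 1 hcomm).trans t3
  have T010 : preCubicForm φ z 0 1 0 = preCubicForm φ z 0 0 1 := by
    simp only [preCubicForm, t1, d10]; ring
  have T100 : preCubicForm φ z 1 0 0 = preCubicForm φ z 0 0 1 := by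
    simp only [preCubicForm, t2, d10]; ring
  have T101 : preCubicForm φ z 1 0 1 = preCubicForm φ z 0 1 1 := by
    simp only [preCubicForm, t3, d10]; ring
  have T110 : preCubicForm φ z 1 1 0 = preCubicForm φ z 0 1 1 := by
    simp only [preCubicForm, t4, d10]; ring
  have i00 : (secondForm φ z)⁻¹ 0 0 = 0 := by rw [hinv]; rfl
  have i01 : (secondForm φ z)⁻¹ 0 1 = W⁻¹ := by rw [hinv]; rfl
  have i10 : (secondForm φ z)⁻¹ 1 0 = W⁻¹ := by rw [hinv]; rfl
  have i11 : (secondForm φ z)⁻¹ 1 1 = 0 := by rw [hinv]; rfl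
  have v0 : preCubicTrace φ z 0 = 2 * W⁻¹ * preCubicForm φ z 0 0 1 := by
    simp only [preCubicTrace, Fin.sum_univ_two, i00, i01, i10, i11, T010, T100]; ring
  have v1 : preCubicTrace φ z 1 = 2 * W⁻¹ * preCubicForm φ z 0 1 1 := by
    simp only [preCubicTrace, Fin.sum_univ_two, i00, i01, i10, i11, T101]; ring
  have hW0 := hWpos.ne'
  have C000 : cubicForm φ z 0 0 0 = b z * W := by
    simp only [cubicForm, T0, h00 z hz]; ring
  have C111 : cubicForm φ z 1 1 1 = c z * W := by
    simp only [cubicForm, T1, h11 z hz]; ring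
  have C001 : cubicForm φ z 0 0 1 = 0 := by
    simp only [cubicForm, v0, h00 z hz, h01, h10]; field_simp; ring
  have C010 : cubicForm φ z 0 1 0 = 0 := by
    simp only [cubicForm, v0, h00 z hz, h01, h10, T010]; field_simp; ring
  have C100 : cubicForm φ z 1 0 0 = 0 := by
    simp only [cubicForm, v0, h00 z hz, h01, h10, T100]; field_simp; ring
  have C011 : cubicForm φ z 0 1 1 = 0 := by
    simp only [cubicForm, v1, h11 z hz, h01, h10]; field_simp; ring
  have C101 : cubicForm φ z 1 0 1 = 0 := by
    simp only [cubicForm, v1, h11 z hz, h01, h10, T101]; field_simp; ring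
  have C110 : cubicForm φ z 1 1 0 = 0 := by
    simp only [cubicForm, v1, h11 z hz, h01, h10, T110]; field_simp; ring
  have hs : Real.sqrt |(secondForm φ z).det| = W := by
    rw [hdet, abs_neg, abs_of_pos (mul_pos hWpos hWpos), Real.sqrt_mul_self hWpos.le]
  rw [projectiveAreaDensity, hs]
  simp only [Fin.sum_univ_two, i00, i01, i10, i11, C000, C111, C001, C010, C100, C011, C101, C110,
    zero_mul, mul_zero, add_zero, zero_add]
  field_simp
  ring

end

noncomputable section

/-! All four conditions reduce to the single scalar equation θ = 0, where θ = c P_x + 2 c_x P.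
Comparing the two ways of computing f_xxyy gives the integrability conditions, and these imply b Q_y
+ 2 b_y Q = θ (`thomsenQ_eq_thomsenP`), so Thomsen's two equations are one.

Geometry: write F_x = F U and F_y = F V (`frame_x`, `frame_y`). The 𝔭₂-parts of U and V have only
the entries b, bQ and c, cP. The 𝔨₂-part leaves J₂ fixed to first order, so g_i = 2 F (A_i)_𝔭 J₂ Fᵗ
for the i-th derivative g_i of g₂, with A_0 = U and A_1 = V. Congruence by F carries every
computation back to J₂. There ⟨g_x, g_x⟩ and ⟨g_y, g_y⟩ are zero, ⟨g_x, g_y⟩ = 4bc, and ∇_x g_y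
corresponds to ∂_x V_𝔭 + [U_𝔨, V_𝔭], which is θ times an elementary matrix
(`harmonicity_obstruction`). By the Maurer-Cartan equation the curvature of the associated family is
(λ - λ⁻¹) times the same matrix (`curvature_associatedFamily`). This settles the conformal Gauss map
and the flat family.

Variation: at a canonical lift the second form is dx dy and the cubic form is b dx³ + c dy³, so the
linearized area density is short. It is expressed through the tangent covector L = det(f, f_x, f_y,
·), which solves the dual canonical system, applied to the linearized equations v_xx - b v_y - p v
and v_yy - c v_x - q v. Integration by parts in pointwise form (`firstVariation_eq_divergence`)
turns it into -2 θ L(v) plus a divergence. The divergence integrates to zero over the support of the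
variation. Variations along ψ f_xy, for which L(v) = ψ, then give θ = 0 by the fundamental lemma of
the calculus of variations. -/

/-- The coordinate vector `∂_i` of `ℝ²`. -/
abbrev coordVec (i : Fin 2) : ℝ × ℝ := (![((1 : ℝ), (0 : ℝ)), ((0 : ℝ), (1 : ℝ))] : Fin 2 → ℝ × ℝ) i

/-! ### Calculus of partial derivatives on an open set. -/

section PartialDerivatives

variable {E : Type*} [NormedAddCommGroup E] [NormedSpace ℝ E] {D : Set (ℝ × ℝ)} {z : ℝ × ℝ}

theorem pd_congr {i : Fin 2} {g g' : ℝ × ℝ → E} (hD : IsOpen D) (h : ∀ w ∈ D, g w = g' w)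
    (hz : z ∈ D) : pd i g z = pd i g' z := by
  unfold pd
  rw [Filter.EventuallyEq.fderiv_eq (Filter.eventually_of_mem (hD.mem_nhds hz) h)]

theorem ContDiffOn.pd {g : ℝ × ℝ → E} (hD : IsOpen D) (hg : ContDiffOn ℝ ∞ g D) (i : Fin 2) :
    ContDiffOn ℝ ∞ (pd i g) D :=
  (hg.fderiv_of_isOpen hD (by simp)).clm_apply contDiffOn_const

theorem ContDiffOn.differentiableAt_of_isOpen {F : Type*} [NormedAddCommGroup F] [NormedSpace ℝ F]
    {D : Set F} {z : F} {g : F → E} (hD : IsOpen D) (hg : ContDiffOn ℝ ∞ g D)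
    (hz : z ∈ D) : DifferentiableAt ℝ g z :=
  (hg.differentiableOn (by simp)).differentiableAt (hD.mem_nhds hz)

/-- Directional derivatives of a smooth function commute. -/
theorem fderiv_fderiv_apply_comm {F : Type*} [NormedAddCommGroup F] [NormedSpace ℝ F]
    {D : Set F} {z : F} (hD : IsOpen D) {g : F → E}
    (hg : ContDiffOn ℝ ∞ g D) (hz : z ∈ D) (u v : F) :
    fderiv ℝ (fun w => fderiv ℝ g w v) z u = fderiv ℝ (fun w => fderiv ℝ g w u) z v := by
  have hcd : ContDiffAt ℝ ∞ g z := hg.contDiffAt (hD.mem_nhds hz)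
  have hs := hcd.isSymmSndFDerivAt (by simpa using WithTop.coe_le_coe.2 (le_top : (2 : ℕ∞) ≤ ⊤))
  have hd : DifferentiableAt ℝ (fderiv ℝ g) z :=
    (hcd.fderiv_right (m := ∞) (by simp)).differentiableAt (by simp)
  rw [fderiv_clm_apply hd (by fun_prop), fderiv_clm_apply hd (by fun_prop)]
  simpa using hs u v

theorem pd_comm {g : ℝ × ℝ → E} (hD : IsOpen D) (hg : ContDiffOn ℝ ∞ g D) (hz : z ∈ D)
    (i j : Fin 2) : pd i (pd j g) z = pd j (pd i g) z :=
  fderiv_fderiv_apply_comm hD hg hz _ _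

theorem pd_const (i : Fin 2) (k : E) : pd i (fun _ => k) z = 0 := by simp [pd]

theorem pd_add {i : Fin 2} {g h : ℝ × ℝ → E} (hg : DifferentiableAt ℝ g z)
    (hh : DifferentiableAt ℝ h z) : pd i (fun w => g w + h w) z = pd i g z + pd i h z := by
  unfold pd
  rw [fderiv_fun_add hg hh]
  simp

theorem pd_sub {i : Fin 2} {g h : ℝ × ℝ → E} (hg : DifferentiableAt ℝ g z)
    (hh : DifferentiableAt ℝ h z) : pd i (fun w => g w - h w) z = pd i g z - pd i h z := by
  unfold pd
  rw [fderiv_fun_sub hg hh]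
  simp

theorem pd_neg {i : Fin 2} {g : ℝ × ℝ → E} : pd i (fun w => -g w) z = -pd i g z := by
  unfold pd
  rw [fderiv_fun_neg]
  simp

theorem pd_smul {i : Fin 2} {s : ℝ × ℝ → ℝ} {g : ℝ × ℝ → E} (hs : DifferentiableAt ℝ s z)
    (hg : DifferentiableAt ℝ g z) :
    pd i (fun w => s w • g w) z = s z • pd i g z + pd i s z • g z := by
  unfold pd
  rw [fderiv_fun_smul hs hg]
  simp

theorem pd_mul {i : Fin 2} {g h : ℝ × ℝ → ℝ} (hg : DifferentiableAt ℝ g z)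
    (hh : DifferentiableAt ℝ h z) :
    pd i (fun w => g w * h w) z = pd i g z * h z + g z * pd i h z := by
  unfold pd
  rw [fderiv_fun_mul hg hh]
  simp
  ring

theorem pd_div {i : Fin 2} {g h : ℝ × ℝ → ℝ} (hg : DifferentiableAt ℝ g z)
    (hh : DifferentiableAt ℝ h z) (h0 : h z ≠ 0) :
    pd i (fun w => g w / h w) z = (pd i g z * h z - g z * pd i h z) / h z ^ 2 := by
  -- The quotient rule is solved from the product rule for (g / h) · h, which equals g near `z`
  -- because h stays nonzero there.
  have e : pd i g z = pd i (fun w => g w / h w * h w) z := by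
    unfold pd
    congr 1
    apply Filter.EventuallyEq.fderiv_eq
    filter_upwards [hh.continuousAt.eventually_ne h0] with w hw
    field_simp
  have hd : DifferentiableAt ℝ (fun w => g w / h w) z := by fun_prop (disch := exact h0)
  rw [e, pd_mul hd hh]
  field_simp
  ring

theorem pd_pow_two {i : Fin 2} {g : ℝ × ℝ → ℝ} (hg : DifferentiableAt ℝ g z) :
    pd i (fun w => g w ^ 2) z = 2 * g z * pd i g z := by
  simp only [pow_two]
  rw [pd_mul hg hg]
  ring

theorem pd_sum {i : Fin 2} {ι : Type*} {s : Finset ι} {g : ι → ℝ × ℝ → E}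
    (hg : ∀ j ∈ s, DifferentiableAt ℝ (g j) z) :
    pd i (fun w => ∑ j ∈ s, g j w) z = ∑ j ∈ s, pd i (g j) z := by
  unfold pd
  rw [fderiv_fun_sum hg]
  simp

theorem pd_apply {ι : Type*} [Fintype ι] {i : Fin 2} {g : ℝ × ℝ → ι → ℝ}
    (hg : DifferentiableAt ℝ g z) (j : ι) : pd i (fun w => g w j) z = pd i g z j := by
  unfold pd
  rw [(hasFDerivAt_pi'.1 hg.hasFDerivAt j).fderiv]
  rfl

end PartialDerivatives

/-! ### The determinant of four vectors and its derivatives. -/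

section Det4

/-- Laplace expansion by complementary 2 × 2 minors. In this polynomial form every identity of
multilinearity or alternation can be left to `ring`. -/
theorem det4_eq (u v w r : Fin 4 → ℝ) : det4 u v w r =
    (u 0 * v 1 - u 1 * v 0) * (w 2 * r 3 - w 3 * r 2)
    - (u 0 * v 2 - u 2 * v 0) * (w 1 * r 3 - w 3 * r 1)
    + (u 0 * v 3 - u 3 * v 0) * (w 1 * r 2 - w 2 * r 1)
    + (u 1 * v 2 - u 2 * v 1) * (w 0 * r 3 - w 3 * r 0)
    - (u 1 * v 3 - u 3 * v 1) * (w 0 * r 2 - w 2 * r 0)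
    + (u 2 * v 3 - u 3 * v 2) * (w 0 * r 1 - w 1 * r 0) := by
  simp [det4, Matrix.det_succ_row_zero, Fin.sum_univ_succ, Fin.succAbove]
  ring

/-- The derivative is stated existentially because only its values on vectors are needed, not the
long expression that the product rule produces. -/
theorem hasFDerivAt_det4 {E : Type*} [NormedAddCommGroup E] [NormedSpace ℝ E]
    {u v w r : E → Fin 4 → ℝ} {u' v' w' r' : E →L[ℝ] (Fin 4 → ℝ)} {x : E}
    (hu : HasFDerivAt u u' x) (hv : HasFDerivAt v v' x) (hw : HasFDerivAt w w' x)
    (hr : HasFDerivAt r r' x) :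
    ∃ d : E →L[ℝ] ℝ, HasFDerivAt (fun y => det4 (u y) (v y) (w y) (r y)) d x ∧
      ∀ e, d e = det4 (u' e) (v x) (w x) (r x) + det4 (u x) (v' e) (w x) (r x) +
        det4 (u x) (v x) (w' e) (r x) + det4 (u x) (v x) (w x) (r' e) := by
  have hu' := hasFDerivAt_pi'.1 hu
  have hv' := hasFDerivAt_pi'.1 hv
  have hw' := hasFDerivAt_pi'.1 hw
  have hr' := hasFDerivAt_pi'.1 hr
  have minor : ∀ {u v : E → Fin 4 → ℝ} {u' v' : E →L[ℝ] (Fin 4 → ℝ)},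
      (∀ i, HasFDerivAt (fun y => u y i) ((ContinuousLinearMap.proj i).comp u') x) →
      (∀ i, HasFDerivAt (fun y => v y i) ((ContinuousLinearMap.proj i).comp v') x) →
      ∀ i j, HasFDerivAt (fun y => u y i * v y j - u y j * v y i) _ x :=
    fun hu hv i j => ((hu i).mul (hv j)).sub ((hu j).mul (hv i))
  have huv := minor hu' hv'
  have hwr := minor hw' hr'
  have key := (((((((huv 0 1).mul (hwr 2 3)).sub ((huv 0 2).mul (hwr 1 3))).add
    ((huv 0 3).mul (hwr 1 2))).add ((huv 1 2).mul (hwr 0 3))).sub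
    ((huv 1 3).mul (hwr 0 2))).add ((huv 2 3).mul (hwr 0 1)))
  refine ⟨_, key.congr_of_eventuallyEq (f₁ := fun y => det4 (u y) (v y) (w y) (r y))
    (Filter.Eventually.of_forall fun y => det4_eq _ _ _ _), fun e => ?_⟩
  simp [det4_eq]
  ring

theorem ContDiffOn.det4 {E : Type*} [NormedAddCommGroup E] [NormedSpace ℝ E] {n : WithTop ℕ∞}
    {u v w r : E → Fin 4 → ℝ} {s : Set E}
    (hu : ContDiffOn ℝ n u s) (hv : ContDiffOn ℝ n v s) (hw : ContDiffOn ℝ n w s)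
    (hr : ContDiffOn ℝ n r s) : ContDiffOn ℝ n (fun y => det4 (u y) (v y) (w y) (r y)) s := by
  have hu' := contDiffOn_pi.1 hu
  have hv' := contDiffOn_pi.1 hv
  have hw' := contDiffOn_pi.1 hw
  have hr' := contDiffOn_pi.1 hr
  simp only [det4_eq]
  fun_prop

theorem HasDerivAt.det4 {u v w r : ℝ → Fin 4 → ℝ} {u' v' w' r' : Fin 4 → ℝ} {t : ℝ}
    (hu : HasDerivAt u u' t) (hv : HasDerivAt v v' t) (hw : HasDerivAt w w' t)
    (hr : HasDerivAt r r' t) :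
    HasDerivAt (fun y => det4 (u y) (v y) (w y) (r y))
      (det4 u' (v t) (w t) (r t) + det4 (u t) v' (w t) (r t) +
        det4 (u t) (v t) w' (r t) + det4 (u t) (v t) (w t) r') t := by
  obtain ⟨d, hd, h⟩ := hasFDerivAt_det4 hu.hasFDerivAt hv.hasFDerivAt hw.hasFDerivAt hr.hasFDerivAt
  have := hd.hasDerivAt
  rw [h] at this
  simpa using this

theorem pd_det4 {i : Fin 2} {z : ℝ × ℝ} {u v w r : ℝ × ℝ → Fin 4 → ℝ}
    (hu : DifferentiableAt ℝ u z) (hv : DifferentiableAt ℝ v z) (hw : DifferentiableAt ℝ w z)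
    (hr : DifferentiableAt ℝ r z) :
    pd i (fun y => det4 (u y) (v y) (w y) (r y)) z =
      det4 (pd i u z) (v z) (w z) (r z) + det4 (u z) (pd i v z) (w z) (r z) +
        det4 (u z) (v z) (pd i w z) (r z) + det4 (u z) (v z) (w z) (pd i r z) := by
  obtain ⟨d, hd, h⟩ := hasFDerivAt_det4 hu.hasFDerivAt hv.hasFDerivAt hw.hasFDerivAt hr.hasFDerivAt
  unfold pd
  rw [hd.fderiv, h]

/-- Four vectors with nonzero determinant are linearly independent. -/
theorem eq_zero_of_det4_ne_zero {u v w r : Fin 4 → ℝ} (h : det4 u v w r ≠ 0) {x y s t : ℝ}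
    (e : x • u + y • v + s • w + t • r = 0) : x = 0 ∧ y = 0 ∧ s = 0 ∧ t = 0 := by
  -- Cramer's rule: putting the combination in place of one vector isolates its coefficient.
  have hx : det4 (x • u + y • v + s • w + t • r) v w r = x * det4 u v w r := by
    simp [det4_eq]; ring
  have hy : det4 u (x • u + y • v + s • w + t • r) w r = y * det4 u v w r := by
    simp [det4_eq]; ring
  have hs : det4 u v (x • u + y • v + s • w + t • r) r = s * det4 u v w r := by
    simp [det4_eq]; ring
  have ht : det4 u v w (x • u + y • v + s • w + t • r) = t * det4 u v w r := by
    simp [det4_eq]; ring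
  rw [e] at hx hy hs ht
  have z1 : det4 0 v w r = 0 := by simp [det4_eq]
  have z2 : det4 u 0 w r = 0 := by simp [det4_eq]
  have z3 : det4 u v 0 r = 0 := by simp [det4_eq]
  have z4 : det4 u v w 0 = 0 := by simp [det4_eq]
  rw [z1] at hx
  rw [z2] at hy
  rw [z3] at hs
  rw [z4] at ht
  refine ⟨?_, ?_, ?_, ?_⟩
  · exact (mul_eq_zero.1 hx.symm).resolve_right h
  · exact (mul_eq_zero.1 hy.symm).resolve_right h
  · exact (mul_eq_zero.1 hs.symm).resolve_right h
  · exact (mul_eq_zero.1 ht.symm).resolve_right h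

end Det4

/-! ### Integrability conditions and Thomsen's expressions. -/

namespace IsCanonicalLift

variable {D : Set (ℝ × ℝ)} {f : ℝ × ℝ → Fin 4 → ℝ} {b c p q : ℝ × ℝ → ℝ} {z : ℝ × ℝ}

theorem b_ne_zero (hf : IsCanonicalLift D f b c p q) (hz : z ∈ D) : b z ≠ 0 :=
  left_ne_zero_of_mul (hf.fubiniPick_ne_zero z hz)

theorem c_ne_zero (hf : IsCanonicalLift D f b c p q) (hz : z ∈ D) : c z ≠ 0 :=
  right_ne_zero_of_mul (hf.fubiniPick_ne_zero z hz)

/-- The Wilczynski frame arises from (f, f_x, f_y, f_xy) by unitriangular column operations, which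
preserve the determinant. -/
theorem det4_eq_one (hf : IsCanonicalLift D f b c p q) (hz : z ∈ D) :
    det4 (f z) (pd 0 f z) (pd 1 f z) (pd 0 (pd 1 f) z) = 1 := by
  have h := hf.frame_det z hz
  rw [wilczynskiFrame, Matrix.det_transpose] at h
  change det4 _ _ _ _ = 1 at h
  rw [det4_eq] at h ⊢
  simp only [Pi.add_apply, Pi.sub_apply, Pi.smul_apply, smul_eq_mul] at h
  linear_combination h

theorem f_yx (hf : IsCanonicalLift D f b c p q) (hz : z ∈ D) :
    pd 1 (pd 0 f) z = pd 0 (pd 1 f) z :=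
  pd_comm hf.isOpen hf.contDiffOn_f hz 1 0

/-- This and the next three lemmas close the system: third derivatives lie in the span of f, f_x,
f_y, f_xy. Only the pure ones have an f_xy-component, namely b and c, and these are the coefficients
of the cubic form. -/
theorem f_xxx (hf : IsCanonicalLift D f b c p q) (hz : z ∈ D) :
    pd 0 (pd 0 (pd 0 f)) z =
      b z • pd 0 (pd 1 f) z + pd 0 b z • pd 1 f z + p z • pd 0 f z + pd 0 p z • f z := by
  have hD := hf.isOpen
  have hb := hf.contDiffOn_b.differentiableAt_of_isOpen hD hz
  have hp := hf.contDiffOn_p.differentiableAt_of_isOpen hD hz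
  have hff := hf.contDiffOn_f.differentiableAt_of_isOpen hD hz
  have hy := (hf.contDiffOn_f.pd hD 1).differentiableAt_of_isOpen hD hz
  rw [pd_congr hD hf.f_xx hz, pd_add (by fun_prop) (by fun_prop), pd_smul hb hy, pd_smul hp hff]
  module

theorem f_xxy (hf : IsCanonicalLift D f b c p q) (hz : z ∈ D) :
    pd 1 (pd 0 (pd 0 f)) z =
      (pd 1 b z + p z) • pd 1 f z + (b z * c z) • pd 0 f z + (b z * q z + pd 1 p z) • f z := by
  have hD := hf.isOpen
  have hb := hf.contDiffOn_b.differentiableAt_of_isOpen hD hz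
  have hp := hf.contDiffOn_p.differentiableAt_of_isOpen hD hz
  have hff := hf.contDiffOn_f.differentiableAt_of_isOpen hD hz
  have hy := (hf.contDiffOn_f.pd hD 1).differentiableAt_of_isOpen hD hz
  rw [pd_congr hD hf.f_xx hz, pd_add (by fun_prop) (by fun_prop), pd_smul hb hy, pd_smul hp hff,
    hf.f_yy z hz]
  module

theorem f_yyx (hf : IsCanonicalLift D f b c p q) (hz : z ∈ D) :
    pd 0 (pd 1 (pd 1 f)) z =
      (pd 0 c z + q z) • pd 0 f z + (b z * c z) • pd 1 f z + (c z * p z + pd 0 q z) • f z := by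
  have hD := hf.isOpen
  have hc := hf.contDiffOn_c.differentiableAt_of_isOpen hD hz
  have hq := hf.contDiffOn_q.differentiableAt_of_isOpen hD hz
  have hff := hf.contDiffOn_f.differentiableAt_of_isOpen hD hz
  have hx := (hf.contDiffOn_f.pd hD 0).differentiableAt_of_isOpen hD hz
  rw [pd_congr hD hf.f_yy hz, pd_add (by fun_prop) (by fun_prop), pd_smul hc hx, pd_smul hq hff,
    hf.f_xx z hz]
  module

theorem f_yyy (hf : IsCanonicalLift D f b c p q) (hz : z ∈ D) :
    pd 1 (pd 1 (pd 1 f)) z =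
      c z • pd 0 (pd 1 f) z + pd 1 c z • pd 0 f z + q z • pd 1 f z + pd 1 q z • f z := by
  have hD := hf.isOpen
  have hc := hf.contDiffOn_c.differentiableAt_of_isOpen hD hz
  have hq := hf.contDiffOn_q.differentiableAt_of_isOpen hD hz
  have hff := hf.contDiffOn_f.differentiableAt_of_isOpen hD hz
  have hx := (hf.contDiffOn_f.pd hD 0).differentiableAt_of_isOpen hD hz
  rw [pd_congr hD hf.f_yy hz, pd_add (by fun_prop) (by fun_prop), pd_smul hc hx, pd_smul hq hff,
    hf.f_yx hz]
  module

/-- The integrability conditions of the canonical system. -/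
theorem integrability (hf : IsCanonicalLift D f b c p q) (hz : z ∈ D) :
    2 * pd 0 q z = b z * pd 1 c z + 2 * pd 1 b z * c z - pd 0 (pd 0 c) z ∧
    2 * pd 1 p z = c z * pd 0 b z + 2 * pd 0 c z * b z - pd 1 (pd 1 b) z ∧
    b z * pd 1 q z + 2 * pd 1 b z * q z + pd 1 (pd 1 p) z =
      c z * pd 0 p z + 2 * pd 0 c z * p z + pd 0 (pd 0 q) z := by
  have hD := hf.isOpen
  have hb := hf.contDiffOn_b.differentiableAt_of_isOpen hD hz
  have hp := hf.contDiffOn_p.differentiableAt_of_isOpen hD hz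
  have hc := hf.contDiffOn_c.differentiableAt_of_isOpen hD hz
  have hq := hf.contDiffOn_q.differentiableAt_of_isOpen hD hz
  have hff := hf.contDiffOn_f.differentiableAt_of_isOpen hD hz
  have hx := (hf.contDiffOn_f.pd hD 0).differentiableAt_of_isOpen hD hz
  have hy := (hf.contDiffOn_f.pd hD 1).differentiableAt_of_isOpen hD hz
  have hby := (hf.contDiffOn_b.pd hD 1).differentiableAt_of_isOpen hD hz
  have hpy := (hf.contDiffOn_p.pd hD 1).differentiableAt_of_isOpen hD hz
  have hcx := (hf.contDiffOn_c.pd hD 0).differentiableAt_of_isOpen hD hz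
  have hqx := (hf.contDiffOn_q.pd hD 0).differentiableAt_of_isOpen hD hz
  have e1 : pd 1 (pd 1 (pd 0 (pd 0 f))) z = _ := pd_congr hD (fun w hw => hf.f_xxy hw) hz
  have e2 : pd 0 (pd 0 (pd 1 (pd 1 f))) z = _ := pd_congr hD (fun w hw => hf.f_yyx hw) hz
  have hfx := hf.contDiffOn_f.pd hD 0
  have hfy := hf.contDiffOn_f.pd hD 1
  -- Both sides are f_xxyy, one computed from the equation for f_xx and the other from the equation
  -- for f_yy.
  have e3 : pd 1 (pd 1 (pd 0 (pd 0 f))) z = pd 0 (pd 0 (pd 1 (pd 1 f))) z := by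
    have s1 : ∀ w ∈ D, pd 1 (pd 0 (pd 0 f)) w = pd 0 (pd 0 (pd 1 f)) w := fun w hw =>
      (pd_comm hD hfx hw 1 0).trans (pd_congr hD (fun w hw => hf.f_yx hw) hw)
    have s2 : ∀ w ∈ D, pd 1 (pd 0 (pd 1 f)) w = pd 0 (pd 1 (pd 1 f)) w := fun w hw =>
      pd_comm hD hfy hw 1 0
    rw [pd_congr hD s1 hz, pd_comm hD (hfy.pd hD 0) hz 1 0, pd_congr hD s2 hz]
  rw [e1, e2, pd_add (by fun_prop) (by fun_prop), pd_add (by fun_prop) (by fun_prop),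
    pd_add (by fun_prop) (by fun_prop), pd_add (by fun_prop) (by fun_prop),
    pd_smul (by fun_prop) (by fun_prop), pd_smul (by fun_prop) (by fun_prop),
    pd_smul (by fun_prop) (by fun_prop), pd_smul (by fun_prop) (by fun_prop),
    pd_smul (by fun_prop) (by fun_prop), pd_smul (by fun_prop) (by fun_prop),
    pd_add (by fun_prop) (by fun_prop), pd_add (by fun_prop) (by fun_prop),
    pd_add (by fun_prop) (by fun_prop), pd_add (by fun_prop) (by fun_prop),
    pd_mul (by fun_prop) (by fun_prop), pd_mul (by fun_prop) (by fun_prop),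
    pd_mul (by fun_prop) (by fun_prop), pd_mul (by fun_prop) (by fun_prop),
    hf.f_xx z hz, hf.f_yy z hz, hf.f_yx hz] at e3
  -- Coefficients are compared in the basis f, f_x, f_y, f_xy. The f_xy-coefficient is bc on both
  -- sides, hence `t := 0`.
  have h := eq_zero_of_det4_ne_zero (x := b z * pd 1 q z + 2 * pd 1 b z * q z + pd 1 (pd 1 p) z -
      (c z * pd 0 p z + 2 * pd 0 c z * p z + pd 0 (pd 0 q) z))
    (y := b z * pd 1 c z + 2 * pd 1 b z * c z - pd 0 (pd 0 c) z - 2 * pd 0 q z)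
    (s := 2 * pd 1 p z - (c z * pd 0 b z + 2 * pd 0 c z * b z - pd 1 (pd 1 b) z)) (t := 0)
    (by rw [hf.det4_eq_one hz]; exact one_ne_zero)
    (show _ • f z + _ • pd 0 f z + _ • pd 1 f z + _ • pd 0 (pd 1 f) z = 0 by
      rw [← sub_eq_zero] at e3
      rw [← e3]
      module)
  obtain ⟨h1, h2, h3, -⟩ := h
  exact ⟨by linarith, by linarith, by linarith⟩

/-- Thomsen's expression `b Q_y + 2 b_y Q` in terms of the coefficients. -/
theorem thomsenQ_eq (hf : IsCanonicalLift D f b c p q) (hz : z ∈ D) :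
    b z * pd 1 (projQ b c q) z + 2 * pd 1 b z * projQ b c q z =
      b z * pd 1 q z + 2 * pd 1 b z * q z + b z * pd 0 (pd 1 c) z / 2 + pd 1 b z * pd 0 c z
        - pd 1 (pd 1 (pd 1 b)) z / 2 := by
  have hD := hf.isOpen
  have hb := hf.contDiffOn_b.differentiableAt_of_isOpen hD hz
  have hq := hf.contDiffOn_q.differentiableAt_of_isOpen hD hz
  have hby := (hf.contDiffOn_b.pd hD 1).differentiableAt_of_isOpen hD hz
  have hbyy := ((hf.contDiffOn_b.pd hD 1).pd hD 1).differentiableAt_of_isOpen hD hz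
  have hcx := (hf.contDiffOn_c.pd hD 0).differentiableAt_of_isOpen hD hz
  have b0 := hf.b_ne_zero hz
  have b1 : 2 * b z ≠ 0 := by simpa using b0
  have b2 : 4 * b z ^ 2 ≠ 0 := by simpa using b0
  unfold projQ
  simp only [div_eq_mul_inv _ (2 : ℝ)]
  rw [pd_add (by fun_prop (disch := assumption)) (by fun_prop (disch := assumption)),
    pd_sub (by fun_prop (disch := assumption)) (by fun_prop (disch := assumption)),
    pd_add (by fun_prop) (by fun_prop), pd_mul (by fun_prop) (by fun_prop), pd_const,
    pd_div (by fun_prop) (by fun_prop) b1, pd_div (by fun_prop) (by fun_prop) b2,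
    pd_pow_two hby, pd_mul (by fun_prop) (by fun_prop), pd_mul (by fun_prop) (by fun_prop),
    pd_pow_two hb, pd_const, pd_const, pd_comm hD hf.contDiffOn_c hz 1 0]
  -- All denominators cancel: the left side is (b² Q)_y / b, and b² Q is polynomial in the
  -- derivatives of b, c and q.
  field_simp
  ring

/-- Thomsen's expression `c P_x + 2 c_x P` in terms of the coefficients. -/
theorem thomsenP_eq (hf : IsCanonicalLift D f b c p q) (hz : z ∈ D) :
    c z * pd 0 (projP b c p) z + 2 * pd 0 c z * projP b c p z =
      c z * pd 0 p z + 2 * pd 0 c z * p z + c z * pd 0 (pd 1 b) z / 2 + pd 0 c z * pd 1 b z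
        - pd 0 (pd 0 (pd 0 c)) z / 2 := by
  have hD := hf.isOpen
  have hc := hf.contDiffOn_c.differentiableAt_of_isOpen hD hz
  have hp := hf.contDiffOn_p.differentiableAt_of_isOpen hD hz
  have hcx := (hf.contDiffOn_c.pd hD 0).differentiableAt_of_isOpen hD hz
  have hcxx := ((hf.contDiffOn_c.pd hD 0).pd hD 0).differentiableAt_of_isOpen hD hz
  have hby := (hf.contDiffOn_b.pd hD 1).differentiableAt_of_isOpen hD hz
  have c0 := hf.c_ne_zero hz
  have c1 : 2 * c z ≠ 0 := by simpa using c0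
  have c2 : 4 * c z ^ 2 ≠ 0 := by simpa using c0
  unfold projP
  simp only [div_eq_mul_inv _ (2 : ℝ)]
  rw [pd_add (by fun_prop (disch := assumption)) (by fun_prop (disch := assumption)),
    pd_sub (by fun_prop (disch := assumption)) (by fun_prop (disch := assumption)),
    pd_add (by fun_prop) (by fun_prop), pd_mul (by fun_prop) (by fun_prop), pd_const,
    pd_div (by fun_prop) (by fun_prop) c1, pd_div (by fun_prop) (by fun_prop) c2,
    pd_pow_two hcx, pd_mul (by fun_prop) (by fun_prop), pd_mul (by fun_prop) (by fun_prop),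
    pd_pow_two hc, pd_const, pd_const]
  field_simp
  ring

/-- By the integrability conditions the two Thomsen equations are equivalent. -/
theorem thomsenQ_eq_thomsenP (hf : IsCanonicalLift D f b c p q) (hz : z ∈ D) :
    b z * pd 1 (projQ b c q) z + 2 * pd 1 b z * projQ b c q z =
      c z * pd 0 (projP b c p) z + 2 * pd 0 c z * projP b c p z := by
  rw [hf.thomsenQ_eq hz, hf.thomsenP_eq hz]
  have hD := hf.isOpen
  have hb := hf.contDiffOn_b.differentiableAt_of_isOpen hD hz
  have hp := hf.contDiffOn_p.differentiableAt_of_isOpen hD hz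
  have hc := hf.contDiffOn_c.differentiableAt_of_isOpen hD hz
  have hq := hf.contDiffOn_q.differentiableAt_of_isOpen hD hz
  have hbx := (hf.contDiffOn_b.pd hD 0).differentiableAt_of_isOpen hD hz
  have hby := (hf.contDiffOn_b.pd hD 1).differentiableAt_of_isOpen hD hz
  have hbyy := ((hf.contDiffOn_b.pd hD 1).pd hD 1).differentiableAt_of_isOpen hD hz
  have hcx := (hf.contDiffOn_c.pd hD 0).differentiableAt_of_isOpen hD hz
  have hcy := (hf.contDiffOn_c.pd hD 1).differentiableAt_of_isOpen hD hz
  have hcxx := ((hf.contDiffOn_c.pd hD 0).pd hD 0).differentiableAt_of_isOpen hD hz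
  have hpy := (hf.contDiffOn_p.pd hD 1).differentiableAt_of_isOpen hD hz
  have hqx := (hf.contDiffOn_q.pd hD 0).differentiableAt_of_isOpen hD hz
  -- The third integrability condition contains q_xx and p_yy. The x-derivative of the first
  -- condition and the y-derivative of the second express them through b and c.
  have h1 := pd_congr (i := 0) hD (fun w hw => (hf.integrability hw).1) hz
  have h2 := pd_congr (i := 1) hD (fun w hw => (hf.integrability hw).2.1) hz
  have h3 := (hf.integrability hz).2.2
  rw [pd_sub (by fun_prop) (by fun_prop), pd_add (by fun_prop) (by fun_prop),
    pd_mul (by fun_prop) (by fun_prop), pd_mul (by fun_prop) (by fun_prop),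
    pd_mul (by fun_prop) (by fun_prop), pd_mul (by fun_prop) (by fun_prop), pd_const] at h1 h2
  rw [pd_comm hD hf.contDiffOn_b hz 1 0, pd_comm hD hf.contDiffOn_c hz 1 0] at h2
  linear_combination h3 + h1 / 2 - h2 / 2

end IsCanonicalLift

/-! ### Structure equations of the Wilczynski frame. -/

/-- The matrix `U` of the Wilczynski frame, `F_x = F U`. -/
def wilczynskiU (b c p q : ℝ × ℝ → ℝ) (z : ℝ × ℝ) : Matrix (Fin 4) (Fin 4) ℝ :=
  !![pd 0 c z / (2 * c z), projP b c p z,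
      b z * c z / 2 - pd 0 (fun w => pd 1 b w / (2 * b w)) z, b z * projQ b c q z;
    1, -(pd 0 c z / (2 * c z)), 0, b z * c z / 2 - pd 0 (fun w => pd 1 b w / (2 * b w)) z;
    0, b z, pd 0 c z / (2 * c z), projP b c p z;
    0, 0, 1, -(pd 0 c z / (2 * c z))]

/-- The matrix `V` of the Wilczynski frame, `F_y = F V`. -/
def wilczynskiV (b c p q : ℝ × ℝ → ℝ) (z : ℝ × ℝ) : Matrix (Fin 4) (Fin 4) ℝ :=
  !![pd 1 b z / (2 * b z), b z * c z / 2 - pd 1 (fun w => pd 0 c w / (2 * c w)) z,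
      projQ b c q z, c z * projP b c p z;
    0, pd 1 b z / (2 * b z), c z, projQ b c q z;
    1, 0, -(pd 1 b z / (2 * b z)), b z * c z / 2 - pd 1 (fun w => pd 0 c w / (2 * c w)) z;
    0, 1, 0, -(pd 1 b z / (2 * b z))]

section MatPd

variable {l m n : Type*} {z : ℝ × ℝ} {D : Set (ℝ × ℝ)}

theorem matPd_congr {i : Fin 2} {A B : ℝ × ℝ → Matrix m n ℝ} (hD : IsOpen D)
    (h : ∀ w ∈ D, A w = B w) (hz : z ∈ D) : matPd i A z = matPd i B z := by
  ext a j
  exact pd_congr hD (fun w hw => by rw [h w hw]) hz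

theorem matPd_mul [Fintype m] {i : Fin 2} {A : ℝ × ℝ → Matrix l m ℝ} {B : ℝ × ℝ → Matrix m n ℝ}
    (hA : ∀ a j, DifferentiableAt ℝ (fun w => A w a j) z)
    (hB : ∀ a j, DifferentiableAt ℝ (fun w => B w a j) z) :
    matPd i (fun w => A w * B w) z = matPd i A z * B z + A z * matPd i B z := by
  ext a j
  simp only [matPd, Matrix.of_apply, Matrix.add_apply, Matrix.mul_apply]
  rw [pd_sum (fun k _ => (hA a k).fun_mul (hB k j)), ← Finset.sum_add_distrib]
  exact Finset.sum_congr rfl fun k _ => pd_mul (hA a k) (hB k j)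

theorem matPd_add {i : Fin 2} {A B : ℝ × ℝ → Matrix m n ℝ}
    (hA : ∀ a j, DifferentiableAt ℝ (fun w => A w a j) z)
    (hB : ∀ a j, DifferentiableAt ℝ (fun w => B w a j) z) :
    matPd i (fun w => A w + B w) z = matPd i A z + matPd i B z := by
  ext a j
  exact pd_add (hA a j) (hB a j)

theorem matPd_const (i : Fin 2) (A : Matrix m n ℝ) : matPd i (fun _ => A) z = 0 := by
  ext a j
  exact pd_const i (A a j)

theorem matPd_smul {i : Fin 2} {A : ℝ × ℝ → Matrix m n ℝ}
    (hA : ∀ a j, DifferentiableAt ℝ (fun w => A w a j) z) (r : ℝ) :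
    matPd i (fun w => r • A w) z = r • matPd i A z := by
  ext a j
  simp only [matPd, Matrix.of_apply, Matrix.smul_apply, smul_eq_mul]
  rw [pd_mul (by fun_prop) (hA a j), pd_const]
  ring

theorem matPd_transpose {i : Fin 2} {A : ℝ × ℝ → Matrix m n ℝ} :
    matPd i (fun w => (A w).transpose) z = (matPd i A z).transpose := rfl

/-- The columns of a product with a matrix given by its columns. -/
theorem transpose_of_mul (u v w r : Fin 4 → ℝ) (A : Matrix (Fin 4) (Fin 4) ℝ) :
    (Matrix.of ![u, v, w, r]).transpose * A = (Matrix.of fun j =>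
      A 0 j • u + A 1 j • v + A 2 j • w + A 3 j • r).transpose := by
  ext a j
  simp [Matrix.mul_apply, Fin.sum_univ_four]
  ring

end MatPd

namespace IsCanonicalLift

variable {D : Set (ℝ × ℝ)} {f : ℝ × ℝ → Fin 4 → ℝ} {b c p q : ℝ × ℝ → ℝ} {z : ℝ × ℝ}

/-- The derivatives of c_x / (2c) and b_y / (2b) stay unexpanded, so that one formula serves both
directions. -/
theorem matPd_frame {i : Fin 2} (hf : IsCanonicalLift D f b c p q) (hz : z ∈ D) :
    matPd i (wilczynskiFrame f b c) z = (Matrix.of ![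
      pd i f z,
      pd i (pd 0 f) z - ((pd 0 c z / (2 * c z)) • pd i f z
        + pd i (fun w => pd 0 c w / (2 * c w)) z • f z),
      pd i (pd 1 f) z - ((pd 1 b z / (2 * b z)) • pd i f z
        + pd i (fun w => pd 1 b w / (2 * b w)) z • f z),
      pd i (pd 0 (pd 1 f)) z
        - ((pd 0 c z / (2 * c z)) • pd i (pd 1 f) z
          + pd i (fun w => pd 0 c w / (2 * c w)) z • pd 1 f z)
        - ((pd 1 b z / (2 * b z)) • pd i (pd 0 f) z
          + pd i (fun w => pd 1 b w / (2 * b w)) z • pd 0 f z)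
        + ((pd 1 b z * pd 0 c z / (4 * b z * c z) - b z * c z / 2) • pd i f z
          + (pd i (fun w => pd 1 b w / (2 * b w)) z * (pd 0 c z / (2 * c z))
            + pd 1 b z / (2 * b z) * pd i (fun w => pd 0 c w / (2 * c w)) z
            - (pd i b z * c z + b z * pd i c z) / 2) • f z)]).transpose := by
  have hD := hf.isOpen
  have hb := hf.contDiffOn_b.differentiableAt_of_isOpen hD hz
  have hc := hf.contDiffOn_c.differentiableAt_of_isOpen hD hz
  have hff := hf.contDiffOn_f.differentiableAt_of_isOpen hD hz
  have hx := (hf.contDiffOn_f.pd hD 0).differentiableAt_of_isOpen hD hz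
  have hy := (hf.contDiffOn_f.pd hD 1).differentiableAt_of_isOpen hD hz
  have hxy := ((hf.contDiffOn_f.pd hD 1).pd hD 0).differentiableAt_of_isOpen hD hz
  have hby := (hf.contDiffOn_b.pd hD 1).differentiableAt_of_isOpen hD hz
  have hcx := (hf.contDiffOn_c.pd hD 0).differentiableAt_of_isOpen hD hz
  have b1 : 2 * b z ≠ 0 := by simpa using hf.b_ne_zero hz
  have c1 : 2 * c z ≠ 0 := by simpa using hf.c_ne_zero hz
  have bc1 : 4 * b z * c z ≠ 0 := by simpa [mul_assoc] using hf.fubiniPick_ne_zero z hz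
  have ha : DifferentiableAt ℝ (fun w => pd 0 c w / (2 * c w)) z := by
    fun_prop (disch := assumption)
  have hβ : DifferentiableAt ℝ (fun w => pd 1 b w / (2 * b w)) z := by
    fun_prop (disch := assumption)
  have hr : DifferentiableAt ℝ
      (fun w => pd 1 b w * pd 0 c w / (4 * b w * c w) - b w * c w / 2) z := by
    fun_prop (disch := assumption)
  have e4 : pd i (fun w => pd 1 b w * pd 0 c w / (4 * b w * c w) - b w * c w / 2) z =
      pd i (fun w => pd 1 b w / (2 * b w)) z * (pd 0 c z / (2 * c z))
            + pd 1 b z / (2 * b z) * pd i (fun w => pd 0 c w / (2 * c w)) z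
            - (pd i b z * c z + b z * pd i c z) / 2 := by
    -- The f-coefficient of η is the product of the two logarithmic coefficients minus bc / 2, so no
    -- new quotient has to be differentiated.
    have : (fun w => pd 1 b w * pd 0 c w / (4 * b w * c w) - b w * c w / 2) =
        fun w => pd 1 b w / (2 * b w) * (pd 0 c w / (2 * c w)) - b w * c w * 2⁻¹ := by
      funext w
      ring
    rw [this, pd_sub (by fun_prop) (by fun_prop), pd_mul hβ ha, pd_mul (by fun_prop) (by fun_prop),
      pd_mul hb hc, pd_const]
    ring
  have col : ∀ {g : ℝ × ℝ → Fin 4 → ℝ}, DifferentiableAt ℝ g z → ∀ a, pd i (fun w => g w a) z =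
    pd i g z a := fun hg a => pd_apply hg a
  ext a j
  fin_cases j
  · exact col hff a
  · refine (col (g := fun w => pd 0 f w - (pd 0 c w / (2 * c w)) • f w) (by fun_prop) a).trans ?_
    rw [pd_sub (by fun_prop) (by fun_prop), pd_smul ha hff]
    rfl
  · refine (col (g := fun w => pd 1 f w - (pd 1 b w / (2 * b w)) • f w) (by fun_prop) a).trans ?_
    rw [pd_sub (by fun_prop) (by fun_prop), pd_smul hβ hff]
    rfl
  · refine (col (g := fun w => pd 0 (pd 1 f) w - (pd 0 c w / (2 * c w)) • pd 1 f w
      - (pd 1 b w / (2 * b w)) • pd 0 f w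
      + (pd 1 b w * pd 0 c w / (4 * b w * c w) - b w * c w / 2) • f w) (by fun_prop) a).trans ?_
    rw [pd_add (by fun_prop) (by fun_prop), pd_sub (by fun_prop) (by fun_prop),
      pd_sub (by fun_prop) (by fun_prop), pd_smul ha hy, pd_smul hβ hx, pd_smul hr hff, e4]
    rfl

theorem pd_logDeriv_c {i : Fin 2} (hf : IsCanonicalLift D f b c p q) (hz : z ∈ D) :
    pd i (fun w => pd 0 c w / (2 * c w)) z =
      pd i (pd 0 c) z / (2 * c z) - pd 0 c z * pd i c z / (2 * c z ^ 2) := by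
  have hD := hf.isOpen
  have hc := hf.contDiffOn_c.differentiableAt_of_isOpen hD hz
  have hcx := (hf.contDiffOn_c.pd hD 0).differentiableAt_of_isOpen hD hz
  have c0 := hf.c_ne_zero hz
  have c1 : 2 * c z ≠ 0 := by simpa using c0
  rw [pd_div hcx (by fun_prop) c1, pd_mul (by fun_prop) hc, pd_const]
  field_simp
  ring

theorem pd_logDeriv_b {i : Fin 2} (hf : IsCanonicalLift D f b c p q) (hz : z ∈ D) :
    pd i (fun w => pd 1 b w / (2 * b w)) z =
      pd i (pd 1 b) z / (2 * b z) - pd 1 b z * pd i b z / (2 * b z ^ 2) := by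
  have hD := hf.isOpen
  have hb := hf.contDiffOn_b.differentiableAt_of_isOpen hD hz
  have hby := (hf.contDiffOn_b.pd hD 1).differentiableAt_of_isOpen hD hz
  have b0 := hf.b_ne_zero hz
  have b1 : 2 * b z ≠ 0 := by simpa using b0
  rw [pd_div hby (by fun_prop) b1, pd_mul (by fun_prop) hb, pd_const]
  field_simp
  ring

theorem frame_x (hf : IsCanonicalLift D f b c p q) (hz : z ∈ D) :
    matPd 0 (wilczynskiFrame f b c) z = wilczynskiFrame f b c z * wilczynskiU b c p q z := by
  have hD := hf.isOpen
  have b0 := hf.b_ne_zero hz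
  have c0 := hf.c_ne_zero hz
  -- f_xxy brings p_y into η_x. Eliminating it by the second integrability condition is what
  -- produces the entry bQ.
  have hpy : pd 1 p z = (c z * pd 0 b z + 2 * pd 0 c z * b z - pd 1 (pd 1 b) z) / 2 := by
    linarith [(hf.integrability hz).2.1]
  have hxxy : pd 0 (pd 0 (pd 1 f)) z = _ :=
    ((pd_congr hD (fun w hw => (hf.f_yx hw).symm) hz).trans
      (pd_comm hD (hf.contDiffOn_f.pd hD 0) hz 0 1)).trans (hf.f_xxy hz)
  rw [hf.matPd_frame hz, hf.pd_logDeriv_c hz, hf.pd_logDeriv_b hz, hf.f_xx z hz, hxxy, hpy,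
    wilczynskiFrame, transpose_of_mul]
  congr 2
  ext j a
  fin_cases j
  · simp [wilczynskiU]
  · simp [wilczynskiU, projP]
    field_simp
    ring
  · simp [wilczynskiU, hf.pd_logDeriv_b hz]
    field_simp
    ring
  · simp [wilczynskiU, hf.pd_logDeriv_b hz, projP, projQ]
    field_simp
    ring

theorem frame_y (hf : IsCanonicalLift D f b c p q) (hz : z ∈ D) :
    matPd 1 (wilczynskiFrame f b c) z = wilczynskiFrame f b c z * wilczynskiV b c p q z := by
  have hD := hf.isOpen
  have b0 := hf.b_ne_zero hz
  have c0 := hf.c_ne_zero hz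
  have hqx : pd 0 q z = (b z * pd 1 c z + 2 * pd 1 b z * c z - pd 0 (pd 0 c) z) / 2 := by
    linarith [(hf.integrability hz).1]
  have hxyy : pd 1 (pd 0 (pd 1 f)) z = _ :=
    (pd_comm hD (hf.contDiffOn_f.pd hD 1) hz 1 0).trans (hf.f_yyx hz)
  rw [hf.matPd_frame hz, hf.pd_logDeriv_c hz, hf.pd_logDeriv_b hz, hf.f_yy z hz, hxyy, hqx,
    hf.f_yx hz, wilczynskiFrame, transpose_of_mul]
  congr 2
  ext j a
  fin_cases j
  · simp [wilczynskiV]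
  · simp [wilczynskiV, hf.pd_logDeriv_c hz]
    field_simp
    ring
  · simp [wilczynskiV, projQ]
    field_simp
    ring
  · simp [wilczynskiV, hf.pd_logDeriv_c hz, projP, projQ]
    field_simp
    ring

theorem isUnit_frame (hf : IsCanonicalLift D f b c p q) (hz : z ∈ D) :
    IsUnit (wilczynskiFrame f b c z).det := by
  rw [hf.frame_det z hz]
  exact isUnit_one

theorem maurerCartan_x (hf : IsCanonicalLift D f b c p q) (hz : z ∈ D) :
    maurerCartan 0 (wilczynskiFrame f b c) z = wilczynskiU b c p q z := by
  rw [maurerCartan, hf.frame_x hz, Matrix.nonsing_inv_mul_cancel_left _ _ (hf.isUnit_frame hz)]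

theorem maurerCartan_y (hf : IsCanonicalLift D f b c p q) (hz : z ∈ D) :
    maurerCartan 1 (wilczynskiFrame f b c) z = wilczynskiV b c p q z := by
  rw [maurerCartan, hf.frame_y hz, Matrix.nonsing_inv_mul_cancel_left _ _ (hf.isUnit_frame hz)]

theorem contDiffOn_frame (hf : IsCanonicalLift D f b c p q) (a j : Fin 4) :
    ContDiffOn ℝ ∞ (fun w => wilczynskiFrame f b c w a j) D := by
  have hD := hf.isOpen
  have hb := hf.contDiffOn_b
  have hc := hf.contDiffOn_c
  have hff := contDiffOn_pi.1 hf.contDiffOn_f a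
  have hx := contDiffOn_pi.1 (hf.contDiffOn_f.pd hD 0) a
  have hy := contDiffOn_pi.1 (hf.contDiffOn_f.pd hD 1) a
  have hxy := contDiffOn_pi.1 ((hf.contDiffOn_f.pd hD 1).pd hD 0) a
  have hby := hf.contDiffOn_b.pd hD 1
  have hcx := hf.contDiffOn_c.pd hD 0
  have b1 : ∀ w ∈ D, 2 * b w ≠ 0 := fun w hw => by simpa using hf.b_ne_zero hw
  have c1 : ∀ w ∈ D, 2 * c w ≠ 0 := fun w hw => by simpa using hf.c_ne_zero hw
  have bc1 : ∀ w ∈ D, 4 * b w * c w ≠ 0 := fun w hw => by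
    simpa [mul_assoc] using hf.fubiniPick_ne_zero w hw
  have hα : ContDiffOn ℝ ∞ (fun w => pd 0 c w / (2 * c w)) D :=
    hcx.div (by fun_prop) c1
  have hβ : ContDiffOn ℝ ∞ (fun w => pd 1 b w / (2 * b w)) D :=
    hby.div (by fun_prop) b1
  have hγ : ContDiffOn ℝ ∞ (fun w => pd 1 b w * pd 0 c w / (4 * b w * c w)) D :=
    (hby.mul hcx).div (by fun_prop) bc1
  fin_cases j
  · exact hff
  · exact hx.sub (hα.mul hff)
  · exact hy.sub (hβ.mul hff)
  · exact ((hxy.sub (hα.mul hy)).sub (hβ.mul hx)).add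
      ((hγ.sub ((hb.mul hc).div_const 2)).mul hff)

/-- Since det F = 1, the inverse is the adjugate, whose entries are polynomials in those of F. -/
theorem contDiffOn_maurerCartan {i : Fin 2} (hf : IsCanonicalLift D f b c p q) (a j : Fin 4) :
    ContDiffOn ℝ ∞ (fun w => maurerCartan i (wilczynskiFrame f b c) w a j) D := by
  have hinv : ∀ w ∈ D, (wilczynskiFrame f b c w)⁻¹ = (wilczynskiFrame f b c w).adjugate := by
    intro w hw
    rw [Matrix.inv_def, hf.frame_det w hw]
    simp
  have hadj : ∀ a j, ContDiffOn ℝ ∞ (fun w => (wilczynskiFrame f b c w).adjugate a j) D := by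
    intro a j
    have key : ∀ w, (wilczynskiFrame f b c w).adjugate a j = ∑ σ : Equiv.Perm (Fin 4),
        (Equiv.Perm.sign σ : ℝ) * ∏ k, if σ k = j then (Pi.single a (1 : ℝ) : Fin 4 → ℝ) k else
          wilczynskiFrame f b c w (σ k) k := by
      intro w
      rw [Matrix.adjugate_apply, Matrix.det_apply']
      refine Finset.sum_congr rfl fun σ _ => ?_
      congr 1
      refine Finset.prod_congr rfl fun k _ => ?_
      simp only [Matrix.updateRow_apply]
    simp only [key]
    refine ContDiffOn.sum fun σ _ => contDiffOn_const.mul (contDiffOn_prod fun k _ => ?_)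
    split_ifs
    · exact contDiffOn_const
    · exact hf.contDiffOn_frame _ _
  have : ∀ w ∈ D, maurerCartan i (wilczynskiFrame f b c) w a j =
      ∑ k, (wilczynskiFrame f b c w).adjugate a k * matPd i (wilczynskiFrame f b c) w k j := by
    intro w hw
    rw [maurerCartan, hinv w hw, Matrix.mul_apply]
  refine ContDiffOn.congr (ContDiffOn.sum fun k _ => (hadj a k).mul ?_) this
  exact (hf.contDiffOn_frame k j).pd hf.isOpen i

/-- The Maurer-Cartan equation of the Wilczynski frame. -/
theorem maurerCartan_eq (hf : IsCanonicalLift D f b c p q) (hz : z ∈ D) :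
    matPd 0 (maurerCartan 1 (wilczynskiFrame f b c)) z
      - matPd 1 (maurerCartan 0 (wilczynskiFrame f b c)) z
      + (maurerCartan 0 (wilczynskiFrame f b c) z * maurerCartan 1 (wilczynskiFrame f b c) z
        - maurerCartan 1 (wilczynskiFrame f b c) z * maurerCartan 0 (wilczynskiFrame f b c) z)
      = 0 := by
  have hD := hf.isOpen
  set F := wilczynskiFrame f b c with hF
  have hmc : ∀ i, ∀ w ∈ D, matPd i F w = F w * maurerCartan i F w := fun i w hw => by
    rw [maurerCartan, Matrix.mul_nonsing_inv_cancel_left _ _ (hf.isUnit_frame hw)]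
  have hFd : ∀ a j, DifferentiableAt ℝ (fun w => F w a j) z := fun a j =>
    (hf.contDiffOn_frame a j).differentiableAt_of_isOpen hD hz
  have hd : ∀ i a j, DifferentiableAt ℝ (fun w => maurerCartan i F w a j) z := fun i a j =>
    (hf.contDiffOn_maurerCartan a j).differentiableAt_of_isOpen hD hz
  -- Expanding F_yx = F_xy by means of F_i = F A_i gives F times the curvature; invertibility of F
  -- then removes the factor.
  have e : matPd 0 (matPd 1 F) z = matPd 1 (matPd 0 F) z := by
    ext a j
    exact pd_comm hD (hf.contDiffOn_frame a j) hz 0 1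
  rw [matPd_congr hD (hmc 1) hz, matPd_congr hD (hmc 0) hz, matPd_mul hFd (hd 1),
    matPd_mul hFd (hd 0), hmc 0 z hz, hmc 1 z hz] at e
  have key : F z * (matPd 0 (maurerCartan 1 F) z - matPd 1 (maurerCartan 0 F) z
      + (maurerCartan 0 F z * maurerCartan 1 F z - maurerCartan 1 F z * maurerCartan 0 F z)) = 0 := by
    rw [← sub_eq_zero] at e
    rw [← e]
    noncomm_ring
  rw [← Matrix.nonsing_inv_mul_cancel_left _ (_ + _) (hf.isUnit_frame hz), key, mul_zero]

end IsCanonicalLift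

/-! ### The involution τ₂ and the curvature of the associated family. -/

section Involution

theorem matJ2_mul_matJ2 : matJ2 * matJ2 = 1 := by
  ext i j
  fin_cases i <;> fin_cases j <;> simp [matJ2, Matrix.mul_apply, Fin.sum_univ_four]

theorem matJ2_transpose : matJ2.transpose = matJ2 := by
  ext i j
  fin_cases i <;> fin_cases j <;> simp [matJ2]

theorem involTau2_add (A B : Matrix (Fin 4) (Fin 4) ℝ) :
    involTau2 (A + B) = involTau2 A + involTau2 B := by
  simp only [involTau2, Matrix.transpose_add, mul_add, add_mul]
  abel

theorem involTau2_sub (A B : Matrix (Fin 4) (Fin 4) ℝ) :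
    involTau2 (A - B) = involTau2 A - involTau2 B := by
  simp only [involTau2, Matrix.transpose_sub, mul_sub, sub_mul]
  abel

/-- Because J₂² = 1, the map -τ₂ is an anti-automorphism of the matrix algebra. Hence τ₂ preserves
commutators. -/
theorem involTau2_mul (A B : Matrix (Fin 4) (Fin 4) ℝ) :
    involTau2 (A * B) = -(involTau2 B * involTau2 A) := by
  have h : matJ2 * B.transpose * matJ2 * (matJ2 * A.transpose * matJ2) =
      matJ2 * B.transpose * (matJ2 * matJ2) * A.transpose * matJ2 := by noncomm_ring
  simp only [involTau2, Matrix.transpose_mul, neg_mul_neg, h, matJ2_mul_matJ2]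
  noncomm_ring

/-- The curvature of the associated family of a flat connection. -/
theorem curvature_associatedFamily {U V Uy Vx : Matrix (Fin 4) (Fin 4) ℝ}
    (h : Vx - Uy + (U * V - V * U) = 0) {l : ℝ} (hl : l ≠ 0) :
    (partK2 Vx + l • partP2 Vx) - (partK2 Uy + l⁻¹ • partP2 Uy)
      + ((partK2 U + l⁻¹ • partP2 U) * (partK2 V + l • partP2 V)
        - (partK2 V + l • partP2 V) * (partK2 U + l⁻¹ • partP2 U)) =
    (l - l⁻¹) • (partP2 Vx + (partK2 U * partP2 V - partP2 V * partK2 U)) := by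
  -- Together with its image under τ₂ the zero curvature equation splits into 𝔨₂- and 𝔭₂-parts. The
  -- first kills the λ⁰-term of the curvature; the second makes the coefficients of λ and λ⁻¹
  -- opposite.
  have h' := congrArg involTau2 h
  have h0 : involTau2 0 = 0 := by simp [involTau2]
  simp only [involTau2_add, involTau2_sub, involTau2_mul, h0] at h'
  have e1 : Uy = Vx + (U * V - V * U) := by
    rw [← sub_eq_zero, ← neg_eq_zero, ← h]
    abel
  have e2 : involTau2 Uy = involTau2 Vx + (involTau2 U * involTau2 V - involTau2 V * involTau2 U) := by
    rw [← sub_eq_zero, ← neg_eq_zero, ← h']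
    abel
  simp only [partK2, partP2, e2]
  rw [e1]
  simp only [smul_add, smul_sub, mul_add, add_mul, mul_sub, sub_mul, smul_mul_assoc, mul_smul_comm,
    smul_smul]
  match_scalars <;> field_simp <;> ring

end Involution

/-! ### Congruence by F: reduction of the geometry of quadrics to the base point J₂. -/

section Congruence

variable {F : Matrix (Fin 4) (Fin 4) ℝ}

/-- The right side is the infinitesimal action of A on J₂ by congruence; 𝔨₂ is the stabilizer
algebra of J₂ and contributes nothing. -/
theorem two_smul_partP2_mul_matJ2 (A : Matrix (Fin 4) (Fin 4) ℝ) :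
    (2 : ℝ) • (partP2 A * matJ2) = A * matJ2 + matJ2 * A.transpose := by
  have h : matJ2 * A.transpose * matJ2 * matJ2 = matJ2 * A.transpose := by
    rw [mul_assoc, matJ2_mul_matJ2, mul_one]
  simp only [partP2, involTau2, sub_neg_eq_add, smul_mul_assoc, add_mul, h, smul_smul]
  norm_num

theorem inv_congruence (hF : IsUnit F.det) :
    (F * matJ2 * F.transpose)⁻¹ = (F.transpose)⁻¹ * matJ2 * F⁻¹ := by
  have hF' : IsUnit F.transpose.det := by rwa [Matrix.det_transpose]
  apply Matrix.inv_eq_right_inv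
  calc F * matJ2 * F.transpose * (F.transpose⁻¹ * matJ2 * F⁻¹)
      = F * matJ2 * (F.transpose * F.transpose⁻¹) * matJ2 * F⁻¹ := by noncomm_ring
    _ = F * (matJ2 * matJ2) * F⁻¹ := by rw [Matrix.mul_nonsing_inv _ hF']; noncomm_ring
    _ = 1 := by rw [matJ2_mul_matJ2, mul_one, Matrix.mul_nonsing_inv _ hF]

/-- Congruence is an isometry, so the metric is evaluated at J₂, where J₂² = 1 and cyclicity of the
trace leave only AB. -/
theorem quadricMetric_congruence (hF : IsUnit F.det) (A B : Matrix (Fin 4) (Fin 4) ℝ) :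
    quadricMetric (F * matJ2 * F.transpose) (F * ((2 : ℝ) • (A * matJ2)) * F.transpose)
      (F * ((2 : ℝ) • (B * matJ2)) * F.transpose) = 4 * (A * B).trace := by
  have hF' : IsUnit F.transpose.det := by rwa [Matrix.det_transpose]
  have h : F.transpose⁻¹ * matJ2 * F⁻¹ * (F * ((2 : ℝ) • (A * matJ2)) * F.transpose)
      * (F.transpose⁻¹ * matJ2 * F⁻¹) * (F * ((2 : ℝ) • (B * matJ2)) * F.transpose) =
      F.transpose⁻¹ * ((4 : ℝ) • (matJ2 * A * (matJ2 * matJ2) * B * matJ2 * F.transpose)) := by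
    calc _ = (4 : ℝ) • (F.transpose⁻¹ * matJ2 * (F⁻¹ * F) * A * matJ2 *
          (F.transpose * F.transpose⁻¹) * matJ2 * (F⁻¹ * F) * B * matJ2 * F.transpose) := by
          simp only [mul_smul_comm, smul_mul_assoc, smul_smul, mul_assoc]
          norm_num
      _ = _ := by
          rw [Matrix.mul_nonsing_inv _ hF', Matrix.nonsing_inv_mul _ hF]
          simp only [mul_one, mul_smul_comm, mul_assoc]
  rw [quadricMetric, inv_congruence hF, h, Matrix.trace_mul_comm, matJ2_mul_matJ2]
  have h2 : ((4 : ℝ) • (matJ2 * A * 1 * B * matJ2 * F.transpose)) * F.transpose⁻¹ =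
      (4 : ℝ) • (matJ2 * (A * B * matJ2)) := by
    rw [smul_mul_assoc, Matrix.mul_nonsing_inv_cancel_right _ _ hF']
    simp only [mul_one, mul_assoc]
  rw [h2, Matrix.trace_smul, Matrix.trace_mul_comm, mul_assoc, matJ2_mul_matJ2, mul_one, smul_eq_mul]

theorem quadricChristoffel_congruence (hF : IsUnit F.det) (R S : Matrix (Fin 4) (Fin 4) ℝ) :
    quadricChristoffel (F * matJ2 * F.transpose) (F * R * F.transpose) (F * S * F.transpose) =
      F * (-((1 / 2 : ℝ) • (R * matJ2 * S + S * matJ2 * R))) * F.transpose := by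
  have hF' : IsUnit F.transpose.det := by rwa [Matrix.det_transpose]
  have h : ∀ R S : Matrix (Fin 4) (Fin 4) ℝ, F * R * F.transpose *
      (F.transpose⁻¹ * matJ2 * F⁻¹) * (F * S * F.transpose) =
      F * (R * matJ2 * S) * F.transpose := by
    intro R S
    calc _ = F * R * (F.transpose * F.transpose⁻¹) * matJ2 * (F⁻¹ * F) * S * F.transpose := by
          simp only [mul_assoc]
      _ = _ := by
          rw [Matrix.mul_nonsing_inv _ hF', Matrix.nonsing_inv_mul _ hF]
          simp only [mul_one, mul_assoc]
  rw [quadricChristoffel, inv_congruence hF, h, h]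
  simp only [mul_neg, neg_mul, mul_smul_comm, smul_mul_assoc, mul_add, add_mul]

theorem congruence_eq_zero_iff (hF : IsUnit F.det) (X : Matrix (Fin 4) (Fin 4) ℝ) :
    F * X * F.transpose = 0 ↔ X = 0 := by
  have hF' : IsUnit F.transpose.det := by rwa [Matrix.det_transpose]
  refine ⟨fun h => ?_, fun h => by simp [h]⟩
  rw [← Matrix.nonsing_inv_mul_cancel_left F X hF,
    ← Matrix.mul_nonsing_inv_cancel_right _ (F * X) hF', h]
  simp

theorem mem_quadricSpace_of_det_eq_one (hF : F.det = 1) :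
    F * matJ2 * F.transpose ∈ quadricSpace := by
  have hJ : matJ2.det = 1 := by
    simp [matJ2, Matrix.det_succ_row_zero, Fin.sum_univ_succ, Fin.succAbove]
    norm_num
  -- The rows of T are the linear forms in 2x₀x₃ - 2x₁x₂ = (x₀/2 + x₃)² + (x₁/2 - x₂)² - (x₀/2 -
  -- x₃)² - (x₁/2 + x₂)², which exhibits the signature (2, 2).
  let T : Matrix (Fin 4) (Fin 4) ℝ :=
    !![1 / 2, 0, 0, 1; 0, 1 / 2, -1, 0; 1 / 2, 0, 0, -1; 0, 1 / 2, 1, 0]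
  have hT : IsUnit (T * F.transpose).det := by
    rw [Matrix.det_mul, Matrix.det_transpose, hF]
    simp [T, Matrix.det_succ_row_zero, Fin.sum_univ_succ, Fin.succAbove]
    norm_num
  let w : Fin 4 → ℝ := ![1, 1, -1, -1]
  have hTJ : matJ2 = T.transpose * Matrix.diagonal w * T := by
    ext i j
    fin_cases i <;> fin_cases j <;>
      simp [matJ2, T, w, Matrix.mul_apply, Fin.sum_univ_four, Matrix.diagonal_apply] <;> norm_num
  let G := T * F.transpose
  have hG : F * matJ2 * F.transpose = G.transpose * Matrix.diagonal w * G := by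
    simp only [G, Matrix.transpose_mul, Matrix.transpose_transpose, hTJ, mul_assoc]
  have hQ : (F * matJ2 * F.transpose).toQuadraticForm'.Equivalent
      (QuadraticMap.weightedSumSquares ℝ w) := by
    refine ⟨⟨Matrix.toLin'OfInv (M := G⁻¹) (M' := G) (Matrix.nonsing_inv_mul _ hT)
      (Matrix.mul_nonsing_inv _ hT), fun x => ?_⟩⟩
    have e : (F * matJ2 * F.transpose).toQuadraticForm' x =
        dotProduct x (Matrix.mulVec (F * matJ2 * F.transpose) x) := by
      simp [Matrix.toQuadraticForm', Matrix.toLinearMap₂'_apply']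
    change _ = (F * matJ2 * F.transpose).toQuadraticForm' x
    rw [e, hG, ← Matrix.mulVec_mulVec, ← Matrix.mulVec_mulVec, Matrix.dotProduct_mulVec,
      Matrix.vecMul_transpose]
    change QuadraticMap.weightedSumSquares ℝ w (Matrix.mulVec G x) = _
    simp only [QuadraticMap.weightedSumSquares_apply, dotProduct, Matrix.mulVec_diagonal,
      smul_eq_mul]
    exact Finset.sum_congr rfl fun i _ => by ring
  refine ⟨?_, ?_, ?_, ?_⟩
  · rw [Matrix.IsSymm]
    simp only [Matrix.transpose_mul, Matrix.transpose_transpose, matJ2_transpose, mul_assoc]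
  · rw [Matrix.det_mul, Matrix.det_mul, Matrix.det_transpose, hF, hJ]
    norm_num
  · have h : {i | 0 < w i} = ({0, 1} : Set (Fin 4)) := by
      ext i
      fin_cases i <;> simp [w]
    rw [QuadraticForm.sigPos_of_equiv_weightedSumSquares hQ, h, Set.ncard_pair (by decide)]
  · have h : {i | w i < 0} = ({2, 3} : Set (Fin 4)) := by
      ext i
      fin_cases i <;> simp [w]
    rw [QuadraticForm.sigNeg_of_equiv_weightedSumSquares hQ, h, Set.ncard_pair (by decide)]

end Congruence

/-! ### Derivatives of the 𝔨₂- and 𝔭₂-parts. -/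

section MatPd

variable {z : ℝ × ℝ} {i : Fin 2} {A B : ℝ × ℝ → Matrix (Fin 4) (Fin 4) ℝ}

theorem differentiableAt_mul_entry (hA : ∀ a j, DifferentiableAt ℝ (fun w => A w a j) z)
    (hB : ∀ a j, DifferentiableAt ℝ (fun w => B w a j) z) (a j : Fin 4) :
    DifferentiableAt ℝ (fun w => (A w * B w) a j) z := by
  simp only [Matrix.mul_apply]
  exact DifferentiableAt.fun_sum fun k _ => (hA a k).fun_mul (hB k j)

theorem differentiableAt_smul_entry (hA : ∀ a j, DifferentiableAt ℝ (fun w => A w a j) z) (r : ℝ)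
    (a j : Fin 4) : DifferentiableAt ℝ (fun w => (r • A w) a j) z :=
  (hA a j).const_mul r

theorem differentiableAt_transpose_entry (hA : ∀ a j, DifferentiableAt ℝ (fun w => A w a j) z)
    (a j : Fin 4) : DifferentiableAt ℝ (fun w => (A w).transpose a j) z :=
  hA j a

/-- J₂ is a signed reversal permutation, so τ₂ is, up to signs, reflection in the antidiagonal.
Entrywise it is multiplication by constants, which commutes with differentiation. -/
theorem involTau2_apply (X : Matrix (Fin 4) (Fin 4) ℝ) (a j : Fin 4) :
    involTau2 X a j = -(![1, -1, -1, 1] a * ![1, -1, -1, 1] j * X j.rev a.rev) := by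
  simp only [involTau2, Matrix.neg_apply, Matrix.mul_apply, Fin.sum_univ_four,
    Matrix.transpose_apply]
  fin_cases a <;> fin_cases j <;> simp [matJ2, Fin.rev]

theorem differentiableAt_involTau2 (hA : ∀ a j, DifferentiableAt ℝ (fun w => A w a j) z)
    (a j : Fin 4) : DifferentiableAt ℝ (fun w => involTau2 (A w) a j) z := by
  simp only [involTau2_apply]
  have := hA j.rev a.rev
  fun_prop

theorem matPd_involTau2 (hA : ∀ a j, DifferentiableAt ℝ (fun w => A w a j) z) :
    matPd i (fun w => involTau2 (A w)) z = involTau2 (matPd i A z) := by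
  ext a j
  have h := hA j.rev a.rev
  rw [involTau2_apply]
  simp only [matPd, Matrix.of_apply, involTau2_apply]
  rw [pd_neg, pd_mul (by fun_prop) h, pd_const]
  ring

theorem matPd_partK2 (hA : ∀ a j, DifferentiableAt ℝ (fun w => A w a j) z) :
    matPd i (fun w => partK2 (A w)) z = partK2 (matPd i A z) := by
  have h := differentiableAt_involTau2 hA
  have hs : ∀ a j, DifferentiableAt ℝ (fun w => (A w + involTau2 (A w)) a j) z :=
    fun a j => (hA a j).fun_add (h a j)
  unfold partK2
  rw [matPd_smul hs, matPd_add hA h, matPd_involTau2 hA]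

theorem matPd_partP2 (hA : ∀ a j, DifferentiableAt ℝ (fun w => A w a j) z) :
    matPd i (fun w => partP2 (A w)) z = partP2 (matPd i A z) := by
  have h := differentiableAt_involTau2 hA
  have hs : ∀ a j, DifferentiableAt ℝ (fun w => (A w - involTau2 (A w)) a j) z :=
    fun a j => (hA a j).fun_sub (h a j)
  have hsub : matPd i (fun w => A w - involTau2 (A w)) z =
      matPd i A z - matPd i (fun w => involTau2 (A w)) z := by
    ext a j
    exact pd_sub (hA a j) (h a j)
  unfold partP2
  rw [matPd_smul hs, hsub, matPd_involTau2 hA]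

theorem differentiableAt_partK2 (hA : ∀ a j, DifferentiableAt ℝ (fun w => A w a j) z)
    (a j : Fin 4) : DifferentiableAt ℝ (fun w => partK2 (A w) a j) z :=
  ((hA a j).fun_add (differentiableAt_involTau2 hA a j)).const_mul (1 / 2 : ℝ)

theorem differentiableAt_partP2 (hA : ∀ a j, DifferentiableAt ℝ (fun w => A w a j) z)
    (a j : Fin 4) : DifferentiableAt ℝ (fun w => partP2 (A w) a j) z :=
  ((hA a j).fun_sub (differentiableAt_involTau2 hA a j)).const_mul (1 / 2 : ℝ)

end MatPd

/-! ### The harmonicity obstruction, flatness of the family, and the conformal Gauss map. -/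

namespace IsCanonicalLift

variable {D : Set (ℝ × ℝ)} {f : ℝ × ℝ → Fin 4 → ℝ} {b c p q : ℝ × ℝ → ℝ} {z : ℝ × ℝ}

/-- The antidiagonal always lies in 𝔭₂, and the remaining entries of U already have the symmetry of
𝔨₂. The same holds for V. -/
theorem partP2_wilczynskiU (b c p q : ℝ × ℝ → ℝ) (z : ℝ × ℝ) :
    partP2 (wilczynskiU b c p q z) =
      !![0, 0, 0, b z * projQ b c q z; 0, 0, 0, 0; 0, b z, 0, 0; 0, 0, 0, 0] := by
  ext a j
  rw [partP2]
  simp only [Matrix.smul_apply, Matrix.sub_apply, involTau2_apply]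
  fin_cases a <;> fin_cases j <;> simp [wilczynskiU, Fin.rev] <;> ring

theorem partP2_wilczynskiV (b c p q : ℝ × ℝ → ℝ) (z : ℝ × ℝ) :
    partP2 (wilczynskiV b c p q z) =
      !![0, 0, 0, c z * projP b c p z; 0, 0, c z, 0; 0, 0, 0, 0; 0, 0, 0, 0] := by
  ext a j
  rw [partP2]
  simp only [Matrix.smul_apply, Matrix.sub_apply, involTau2_apply]
  fin_cases a <;> fin_cases j <;> simp [wilczynskiV, Fin.rev] <;> ring

theorem partK2_wilczynskiU (b c p q : ℝ × ℝ → ℝ) (z : ℝ × ℝ) :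
    partK2 (wilczynskiU b c p q z) =
      !![pd 0 c z / (2 * c z), projP b c p z,
          b z * c z / 2 - pd 0 (fun w => pd 1 b w / (2 * b w)) z, 0;
        1, -(pd 0 c z / (2 * c z)), 0, b z * c z / 2 - pd 0 (fun w => pd 1 b w / (2 * b w)) z;
        0, 0, pd 0 c z / (2 * c z), projP b c p z;
        0, 0, 1, -(pd 0 c z / (2 * c z))] := by
  ext a j
  rw [partK2]
  simp only [Matrix.smul_apply, Matrix.add_apply, involTau2_apply]
  fin_cases a <;> fin_cases j <;> simp [wilczynskiU, Fin.rev] <;> ring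

theorem differentiableAt_projP (hf : IsCanonicalLift D f b c p q) (hz : z ∈ D) :
    DifferentiableAt ℝ (projP b c p) z := by
  have hD := hf.isOpen
  have hc := hf.contDiffOn_c.differentiableAt_of_isOpen hD hz
  have hp := hf.contDiffOn_p.differentiableAt_of_isOpen hD hz
  have hcx := (hf.contDiffOn_c.pd hD 0).differentiableAt_of_isOpen hD hz
  have hcxx := ((hf.contDiffOn_c.pd hD 0).pd hD 0).differentiableAt_of_isOpen hD hz
  have hby := (hf.contDiffOn_b.pd hD 1).differentiableAt_of_isOpen hD hz
  have c1 : 2 * c z ≠ 0 := by simpa using hf.c_ne_zero hz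
  have c2 : 4 * c z ^ 2 ≠ 0 := by simpa using hf.c_ne_zero hz
  unfold projP
  fun_prop (disch := assumption)

theorem differentiableAt_maurerCartan {i : Fin 2} (hf : IsCanonicalLift D f b c p q) (hz : z ∈ D)
    (a j : Fin 4) :
    DifferentiableAt ℝ (fun w => maurerCartan i (wilczynskiFrame f b c) w a j) z :=
  (hf.contDiffOn_maurerCartan a j).differentiableAt_of_isOpen hf.isOpen hz

/-- The obstruction to harmonicity of the conformal Gauss map. -/
theorem harmonicity_obstruction (hf : IsCanonicalLift D f b c p q) (hz : z ∈ D) :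
    partP2 (matPd 0 (maurerCartan 1 (wilczynskiFrame f b c)) z)
      + (partK2 (maurerCartan 0 (wilczynskiFrame f b c) z)
          * partP2 (maurerCartan 1 (wilczynskiFrame f b c) z)
        - partP2 (maurerCartan 1 (wilczynskiFrame f b c) z)
          * partK2 (maurerCartan 0 (wilczynskiFrame f b c) z)) =
      Matrix.single 0 3 (c z * pd 0 (projP b c p) z + 2 * pd 0 c z * projP b c p z) := by
  have hD := hf.isOpen
  have c0 := hf.c_ne_zero hz
  have hc := hf.contDiffOn_c.differentiableAt_of_isOpen hD hz
  have hP := hf.differentiableAt_projP hz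
  rw [← matPd_partP2 (hf.differentiableAt_maurerCartan hz), hf.maurerCartan_x hz,
    hf.maurerCartan_y hz, matPd_congr hD (fun w hw => by rw [hf.maurerCartan_y hw,
      partP2_wilczynskiV]) hz, partP2_wilczynskiV, partK2_wilczynskiU]
  -- In the commutator the entries (0,2) and (1,3) cancel in pairs. Entry (1,2) is -c_x and cancels
  -- the derivative of c, while entry (0,3) adds c_x P to (cP)_x.
  ext a j
  fin_cases a <;> fin_cases j <;>
    simp [matPd, pd_const, pd_mul hc hP] <;> field_simp <;> ring

theorem harmonicity_obstruction_eq_zero_iff (hf : IsCanonicalLift D f b c p q) (hz : z ∈ D) :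
    partP2 (matPd 0 (maurerCartan 1 (wilczynskiFrame f b c)) z)
      + (partK2 (maurerCartan 0 (wilczynskiFrame f b c) z)
          * partP2 (maurerCartan 1 (wilczynskiFrame f b c) z)
        - partP2 (maurerCartan 1 (wilczynskiFrame f b c) z)
          * partK2 (maurerCartan 0 (wilczynskiFrame f b c) z)) = 0 ↔
      c z * pd 0 (projP b c p) z + 2 * pd 0 c z * projP b c p z = 0 := by
  rw [hf.harmonicity_obstruction hz]
  refine ⟨fun h => ?_, fun h => by rw [h, Matrix.single_zero]⟩
  simpa using congrFun (congrFun h 0) 3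

theorem satisfiesThomsen_iff (hf : IsCanonicalLift D f b c p q) :
    SatisfiesThomsen D b c p q ↔
      ∀ z ∈ D, c z * pd 0 (projP b c p) z + 2 * pd 0 c z * projP b c p z = 0 :=
  ⟨fun h z hz => (h z hz).2, fun h z hz => ⟨(hf.thomsenQ_eq_thomsenP hz).trans (h z hz), h z hz⟩⟩

/-- The curvature is λ - λ⁻¹ times the obstruction. The values λ = ±1 carry no information, and any
single other value suffices. -/
theorem satisfiesThomsen_iff_flat (hf : IsCanonicalLift D f b c p q) :
    SatisfiesThomsen D b c p q ↔ ∀ l : ℝ, l ≠ 0 →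
      IsFlatConnection D (familyU (wilczynskiFrame f b c) l)
        (familyV (wilczynskiFrame f b c) l) := by
  have key : ∀ l : ℝ, l ≠ 0 → ∀ z ∈ D,
      matPd 0 (familyV (wilczynskiFrame f b c) l) z - matPd 1 (familyU (wilczynskiFrame f b c) l) z
        + (familyU (wilczynskiFrame f b c) l z * familyV (wilczynskiFrame f b c) l z
          - familyV (wilczynskiFrame f b c) l z * familyU (wilczynskiFrame f b c) l z) =
      (l - l⁻¹) • (partP2 (matPd 0 (maurerCartan 1 (wilczynskiFrame f b c)) z)
      + (partK2 (maurerCartan 0 (wilczynskiFrame f b c) z)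
          * partP2 (maurerCartan 1 (wilczynskiFrame f b c) z)
        - partP2 (maurerCartan 1 (wilczynskiFrame f b c) z)
          * partK2 (maurerCartan 0 (wilczynskiFrame f b c) z))) := by
    intro l hl z hz
    rw [← curvature_associatedFamily (hf.maurerCartan_eq hz) hl]
    have hd : ∀ i a j, DifferentiableAt ℝ
        (fun w => maurerCartan i (wilczynskiFrame f b c) w a j) z :=
      fun i => hf.differentiableAt_maurerCartan hz
    have comb : ∀ (i j : Fin 2) (r : ℝ),
        matPd i (fun w => partK2 (maurerCartan j (wilczynskiFrame f b c) w)
          + r • partP2 (maurerCartan j (wilczynskiFrame f b c) w)) z =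
        partK2 (matPd i (maurerCartan j (wilczynskiFrame f b c)) z)
          + r • partP2 (matPd i (maurerCartan j (wilczynskiFrame f b c)) z) := by
      intro i j r
      rw [matPd_add (differentiableAt_partK2 (hd j))
        (differentiableAt_smul_entry (differentiableAt_partP2 (hd j)) r),
        matPd_smul (differentiableAt_partP2 (hd j)), matPd_partK2 (hd j), matPd_partP2 (hd j)]
    unfold familyU familyV
    rw [comb, comb]
  rw [hf.satisfiesThomsen_iff]
  constructor
  · intro h l hl z hz
    rw [key l hl z hz, (hf.harmonicity_obstruction_eq_zero_iff hz).2 (h z hz), smul_zero]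
  · intro h z hz
    -- λ = 2 is an arbitrary choice with λ ≠ λ⁻¹.
    have h2 := h 2 two_ne_zero z hz
    rw [key 2 two_ne_zero z hz] at h2
    exact (hf.harmonicity_obstruction_eq_zero_iff hz).1
      ((smul_eq_zero.1 h2).resolve_left (by norm_num))

theorem matPd_conformalGaussMap {i : Fin 2} (hf : IsCanonicalLift D f b c p q) (hz : z ∈ D) :
    matPd i (conformalGaussMap f b c) z = wilczynskiFrame f b c z
      * ((2 : ℝ) • (partP2 (maurerCartan i (wilczynskiFrame f b c) z) * matJ2))
      * (wilczynskiFrame f b c z).transpose := by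
  have hF : ∀ a j, DifferentiableAt ℝ (fun w => wilczynskiFrame f b c w a j) z := fun a j =>
    (hf.contDiffOn_frame a j).differentiableAt_of_isOpen hf.isOpen hz
  have hFJ := differentiableAt_mul_entry (B := fun _ => matJ2) hF (by simp)
  have hmc : matPd i (wilczynskiFrame f b c) z =
      wilczynskiFrame f b c z * maurerCartan i (wilczynskiFrame f b c) z := by
    rw [maurerCartan, Matrix.mul_nonsing_inv_cancel_left _ _ (hf.isUnit_frame hz)]
  unfold conformalGaussMap
  rw [matPd_mul hFJ (differentiableAt_transpose_entry hF), matPd_mul hF (by simp), matPd_const, matPd_transpose, hmc,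
    two_smul_partP2_mul_matJ2, Matrix.transpose_mul]
  noncomm_ring

theorem isSmoothIntoQuadrics (hf : IsCanonicalLift D f b c p q) :
    IsSmoothIntoQuadrics D (conformalGaussMap f b c) := by
  refine ⟨fun i j => ?_, fun z hz => mem_quadricSpace_of_det_eq_one (hf.frame_det z hz)⟩
  simp only [conformalGaussMap, Matrix.mul_apply, Matrix.transpose_apply]
  exact ContDiffOn.sum fun k _ => (ContDiffOn.sum fun m _ =>
    (hf.contDiffOn_frame i m).mul contDiffOn_const).mul (hf.contDiffOn_frame j k)

/-- U_𝔭² and V_𝔭² have trace zero, while tr(U_𝔭 V_𝔭) = bc ≠ 0; neither Thomsen equation enters. -/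
theorem isLorentzConformal (hf : IsCanonicalLift D f b c p q) :
    IsLorentzConformal D (conformalGaussMap f b c) := by
  intro z hz
  rw [hf.matPd_conformalGaussMap hz, hf.matPd_conformalGaussMap hz, hf.maurerCartan_x hz,
    hf.maurerCartan_y hz, conformalGaussMap, quadricMetric_congruence (hf.isUnit_frame hz),
    quadricMetric_congruence (hf.isUnit_frame hz), quadricMetric_congruence (hf.isUnit_frame hz),
    partP2_wilczynskiU, partP2_wilczynskiV]
  refine ⟨?_, ?_, ?_⟩
  · simp [Matrix.trace, Fin.sum_univ_four]
  · simp [Matrix.trace, Fin.sum_univ_four]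
  · simp [Matrix.trace, Fin.sum_univ_four, hf.b_ne_zero hz, hf.c_ne_zero hz]

/-- Differentiating F V_𝔭 J₂ Fᵗ yields ∂_x V_𝔭 + [U_𝔨, V_𝔭] together with the anticommutator of U_𝔭
and V_𝔭. The Christoffel term cancels exactly the latter. -/
theorem covDerivAlong_conformalGaussMap (hf : IsCanonicalLift D f b c p q) (hz : z ∈ D) :
    covDerivAlong 0 (conformalGaussMap f b c) (matPd 1 (conformalGaussMap f b c)) z =
      wilczynskiFrame f b c z * ((2 : ℝ) •
        ((partP2 (matPd 0 (maurerCartan 1 (wilczynskiFrame f b c)) z)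
      + (partK2 (maurerCartan 0 (wilczynskiFrame f b c) z)
          * partP2 (maurerCartan 1 (wilczynskiFrame f b c) z)
        - partP2 (maurerCartan 1 (wilczynskiFrame f b c) z)
          * partK2 (maurerCartan 0 (wilczynskiFrame f b c) z))) * matJ2))
        * (wilczynskiFrame f b c z).transpose := by
  have hF : ∀ a j, DifferentiableAt ℝ (fun w => wilczynskiFrame f b c w a j) z := fun a j =>
    (hf.contDiffOn_frame a j).differentiableAt_of_isOpen hf.isOpen hz
  have hp := differentiableAt_partP2 (hf.differentiableAt_maurerCartan (i := 1) hz)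
  have hpJ := differentiableAt_mul_entry (B := fun _ => matJ2) hp (by simp)
  have hFS := differentiableAt_mul_entry hF (differentiableAt_smul_entry hpJ 2)
  have hmc : matPd 0 (wilczynskiFrame f b c) z =
      wilczynskiFrame f b c z * maurerCartan 0 (wilczynskiFrame f b c) z := by
    rw [maurerCartan, Matrix.mul_nonsing_inv_cancel_left _ _ (hf.isUnit_frame hz)]
  have hgy := hf.matPd_conformalGaussMap (i := 1) hz
  rw [covDerivAlong, hgy, hf.matPd_conformalGaussMap (i := 0) hz,
    matPd_congr hf.isOpen (fun w hw => hf.matPd_conformalGaussMap (i := 1) hw) hz,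
    matPd_mul hFS (differentiableAt_transpose_entry hF),
    matPd_mul hF (differentiableAt_smul_entry hpJ 2), matPd_smul hpJ,
    matPd_mul hp (by simp), matPd_const, matPd_transpose, hmc,
    matPd_partP2 (hf.differentiableAt_maurerCartan hz), conformalGaussMap,
    quadricChristoffel_congruence (hf.isUnit_frame hz)]
  set F := wilczynskiFrame f b c z
  set U := maurerCartan 0 (wilczynskiFrame f b c) z
  set Vp := partP2 (maurerCartan 1 (wilczynskiFrame f b c) z)
  set X := partP2 (matPd 0 (maurerCartan 1 (wilczynskiFrame f b c)) z)
  have hJ := matJ2_mul_matJ2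
  have hJ' : ∀ A : Matrix (Fin 4) (Fin 4) ℝ, matJ2 * (matJ2 * A) = A := fun A => by
    rw [← mul_assoc, hJ, one_mul]
  simp only [partP2, partK2, involTau2, Matrix.transpose_mul, mul_zero, add_zero, mul_assoc, hJ, add_mul, mul_add, sub_mul, mul_sub, smul_mul_assoc,
    mul_smul_comm, neg_mul, mul_neg, mul_one]
  module

theorem satisfiesThomsen_iff_harmonic (hf : IsCanonicalLift D f b c p q) :
    SatisfiesThomsen D b c p q ↔ IsLorentzHarmonic D (conformalGaussMap f b c) := by
  rw [hf.satisfiesThomsen_iff]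
  refine forall₂_congr fun z hz => ?_
  rw [hf.covDerivAlong_conformalGaussMap hz, congruence_eq_zero_iff (hf.isUnit_frame hz),
    ← hf.harmonicity_obstruction_eq_zero_iff hz, smul_eq_zero, or_iff_right two_ne_zero]
  refine ⟨fun h => by rw [h, zero_mul], fun h => ?_⟩
  rw [← mul_one (_ + _), ← matJ2_mul_matJ2, ← mul_assoc, h, zero_mul]

end IsCanonicalLift

/-! ### Smooth one-parameter families of maps. -/

section Families

variable {E : Type*} [NormedAddCommGroup E] [NormedSpace ℝ E] {D : Set (ℝ × ℝ)} {z : ℝ × ℝ}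
  {Φ : ℝ → ℝ × ℝ → E}

/-- `∂Φ/∂t` at `t = 0`. -/
def variationField (Φ : ℝ → ℝ × ℝ → E) (z : ℝ × ℝ) : E := deriv (fun t => Φ t z) 0

theorem hasDerivAt_family (hD : IsOpen D)
    (hΦ : ContDiffOn ℝ ∞ (fun w : ℝ × (ℝ × ℝ) => Φ w.1 w.2) (univ ×ˢ D)) (t : ℝ) (hz : z ∈ D) :
    HasDerivAt (fun s => Φ s z)
      (fderiv ℝ (fun w : ℝ × (ℝ × ℝ) => Φ w.1 w.2) (t, z) ((1 : ℝ), (0 : ℝ × ℝ))) t := by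
  have hd := (hΦ.differentiableAt_of_isOpen (isOpen_univ.prod hD)
    (show (t, z) ∈ univ ×ˢ D from ⟨trivial, hz⟩)).hasFDerivAt
  exact hd.comp_hasDerivAt t ((hasDerivAt_id t).prodMk (hasDerivAt_const t z))

theorem pd_family (hD : IsOpen D)
    (hΦ : ContDiffOn ℝ ∞ (fun w : ℝ × (ℝ × ℝ) => Φ w.1 w.2) (univ ×ˢ D)) (t : ℝ) (hz : z ∈ D)
    (i : Fin 2) :
    pd i (Φ t) z =
      fderiv ℝ (fun w : ℝ × (ℝ × ℝ) => Φ w.1 w.2) (t, z) ((0 : ℝ), coordVec i) := by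
  have hd := (hΦ.differentiableAt_of_isOpen (isOpen_univ.prod hD)
    (show (t, z) ∈ univ ×ˢ D from ⟨trivial, hz⟩)).hasFDerivAt
  have h : HasFDerivAt (Φ t) _ z := hd.comp z (hasFDerivAt_prodMk_right t z)
  rw [pd, h.fderiv]
  rfl

theorem contDiffOn_pd_family (hD : IsOpen D)
    (hΦ : ContDiffOn ℝ ∞ (fun w : ℝ × (ℝ × ℝ) => Φ w.1 w.2) (univ ×ˢ D)) (i : Fin 2) :
    ContDiffOn ℝ ∞ (fun w : ℝ × (ℝ × ℝ) => pd i (Φ w.1) w.2) (univ ×ˢ D) := by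
  refine ContDiffOn.congr (f := fun w : ℝ × (ℝ × ℝ) =>
    fderiv ℝ (fun w : ℝ × (ℝ × ℝ) => Φ w.1 w.2) w ((0 : ℝ), coordVec i)) ?_
    fun w hw => pd_family hD hΦ w.1 hw.2 i
  exact (hΦ.fderiv_of_isOpen (isOpen_univ.prod hD) (by simp)).clm_apply contDiffOn_const

theorem variationField_eq (hD : IsOpen D)
    (hΦ : ContDiffOn ℝ ∞ (fun w : ℝ × (ℝ × ℝ) => Φ w.1 w.2) (univ ×ˢ D)) (hz : z ∈ D) :
    variationField Φ z =
      fderiv ℝ (fun w : ℝ × (ℝ × ℝ) => Φ w.1 w.2) (0, z) ((1 : ℝ), (0 : ℝ × ℝ)) :=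
  (hasDerivAt_family hD hΦ 0 hz).deriv

theorem hasDerivAt_variationField (hD : IsOpen D)
    (hΦ : ContDiffOn ℝ ∞ (fun w : ℝ × (ℝ × ℝ) => Φ w.1 w.2) (univ ×ˢ D)) (hz : z ∈ D) :
    HasDerivAt (fun t => Φ t z) (variationField Φ z) 0 := by
  rw [variationField_eq hD hΦ hz]
  exact hasDerivAt_family hD hΦ 0 hz

theorem contDiffOn_variationField (hD : IsOpen D)
    (hΦ : ContDiffOn ℝ ∞ (fun w : ℝ × (ℝ × ℝ) => Φ w.1 w.2) (univ ×ˢ D)) :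
    ContDiffOn ℝ ∞ (variationField Φ) D := by
  refine ContDiffOn.congr (f := fun z => fderiv ℝ (fun w : ℝ × (ℝ × ℝ) => Φ w.1 w.2) (0, z)
    ((1 : ℝ), (0 : ℝ × ℝ))) ?_ fun z hz => variationField_eq hD hΦ hz
  have h := (hΦ.fderiv_of_isOpen (m := ∞) (isOpen_univ.prod hD) (by simp)).clm_apply
    (contDiffOn_const (c := ((1 : ℝ), (0 : ℝ × ℝ))))
  exact h.comp (contDiffOn_const.prodMk contDiffOn_id) fun z hz => ⟨trivial, hz⟩

/-- ∂_t and ∂_i are directional derivatives of one smooth function on ℝ × D, so they commute. -/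
theorem variationField_pd (hD : IsOpen D)
    (hΦ : ContDiffOn ℝ ∞ (fun w : ℝ × (ℝ × ℝ) => Φ w.1 w.2) (univ ×ˢ D)) (hz : z ∈ D)
    (i : Fin 2) :
    variationField (fun t => pd i (Φ t)) z = pd i (variationField Φ) z := by
  have ho := isOpen_univ.prod hD (X := ℝ)
  have hm : ((0 : ℝ), z) ∈ univ ×ˢ D := ⟨trivial, hz⟩
  rw [variationField_eq hD (contDiffOn_pd_family hD hΦ i) hz]
  have e1 : fderiv ℝ (fun w : ℝ × (ℝ × ℝ) => pd i (Φ w.1) w.2) (0, z) =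
      fderiv ℝ (fun w => fderiv ℝ (fun w : ℝ × (ℝ × ℝ) => Φ w.1 w.2) w ((0 : ℝ), coordVec i))
        (0, z) :=
    Filter.EventuallyEq.fderiv_eq (Filter.eventually_of_mem (ho.mem_nhds hm)
      fun w hw => pd_family hD hΦ w.1 hw.2 i)
  rw [e1, fderiv_fderiv_apply_comm ho hΦ hm]
  have h := (((hΦ.fderiv_of_isOpen (m := ∞) ho (by simp)).clm_apply
    (contDiffOn_const (c := ((1 : ℝ), (0 : ℝ × ℝ))))).differentiableAt_of_isOpen ho hm).hasFDerivAt
  have h2 : HasFDerivAt (fun z => fderiv ℝ (fun w : ℝ × (ℝ × ℝ) => Φ w.1 w.2) (0, z)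
    ((1 : ℝ), (0 : ℝ × ℝ))) _ z := h.comp z (hasFDerivAt_prodMk_right (0 : ℝ) z)
  rw [pd_congr hD (fun w hw => variationField_eq hD hΦ hw) hz, pd, h2.fderiv]
  rfl

theorem hasDerivAt_pd_family (hD : IsOpen D)
    (hΦ : ContDiffOn ℝ ∞ (fun w : ℝ × (ℝ × ℝ) => Φ w.1 w.2) (univ ×ˢ D)) (hz : z ∈ D)
    (i : Fin 2) :
    HasDerivAt (fun t => pd i (Φ t) z) (pd i (variationField Φ) z) 0 := by
  rw [← variationField_pd hD hΦ hz]
  exact hasDerivAt_variationField hD (contDiffOn_pd_family hD hΦ i) hz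

theorem hasDerivAt_pd_pd_family (hD : IsOpen D)
    (hΦ : ContDiffOn ℝ ∞ (fun w : ℝ × (ℝ × ℝ) => Φ w.1 w.2) (univ ×ˢ D)) (hz : z ∈ D)
    (i j : Fin 2) :
    HasDerivAt (fun t => pd i (pd j (Φ t)) z) (pd i (pd j (variationField Φ)) z) 0 := by
  rw [← pd_congr hD (fun w hw => variationField_pd hD hΦ hw j) hz]
  exact hasDerivAt_pd_family hD (contDiffOn_pd_family hD hΦ j) hz i

theorem hasDerivAt_pd_pd_pd_family (hD : IsOpen D)
    (hΦ : ContDiffOn ℝ ∞ (fun w : ℝ × (ℝ × ℝ) => Φ w.1 w.2) (univ ×ˢ D)) (hz : z ∈ D)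
    (i j k : Fin 2) :
    HasDerivAt (fun t => pd i (pd j (pd k (Φ t))) z)
      (pd i (pd j (pd k (variationField Φ))) z) 0 := by
  rw [← pd_congr hD (fun w hw => pd_congr hD (fun w hw => variationField_pd hD hΦ hw k) hw) hz]
  exact hasDerivAt_pd_pd_family hD (contDiffOn_pd_family hD hΦ k) hz i j

end Families

/-! ### Linearization of the second form, the cubic form and the area density. -/

section AreaVariation

/-- The linearization of `secondForm` at `φ` in the direction `v`. -/
def secondFormVariation (φ v : ℝ × ℝ → Fin 4 → ℝ) (z : ℝ × ℝ) (i j : Fin 2) : ℝ :=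
  det4 (v z) (pd 0 φ z) (pd 1 φ z) (pd i (pd j φ) z)
    + det4 (φ z) (pd 0 v z) (pd 1 φ z) (pd i (pd j φ) z)
    + det4 (φ z) (pd 0 φ z) (pd 1 v z) (pd i (pd j φ) z)
    + det4 (φ z) (pd 0 φ z) (pd 1 φ z) (pd i (pd j v) z)

/-- The linearization of `preCubicForm` at `φ` in the direction `v`. -/
def preCubicFormVariation (φ v : ℝ × ℝ → Fin 4 → ℝ) (z : ℝ × ℝ) (i j k : Fin 2) : ℝ :=
  det4 (v z) (pd 0 φ z) (pd 1 φ z) (pd i (pd j (pd k φ)) z)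
    + det4 (φ z) (pd 0 v z) (pd 1 φ z) (pd i (pd j (pd k φ)) z)
    + det4 (φ z) (pd 0 φ z) (pd 1 v z) (pd i (pd j (pd k φ)) z)
    + det4 (φ z) (pd 0 φ z) (pd 1 φ z) (pd i (pd j (pd k v)) z)
    - (pd i (fun w => secondFormVariation φ v w j k) z
      + pd j (fun w => secondFormVariation φ v w k i) z
      + pd k (fun w => secondFormVariation φ v w i j) z) / 2

variable {D : Set (ℝ × ℝ)} {z : ℝ × ℝ} {Φ : ℝ → ℝ × ℝ → Fin 4 → ℝ}

theorem contDiffOn_secondForm_family (hD : IsOpen D)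
    (hΦ : ContDiffOn ℝ ∞ (fun w : ℝ × (ℝ × ℝ) => Φ w.1 w.2) (univ ×ˢ D)) (i j : Fin 2) :
    ContDiffOn ℝ ∞ (fun w : ℝ × (ℝ × ℝ) => secondForm (Φ w.1) w.2 i j) (univ ×ˢ D) :=
  ContDiffOn.det4 hΦ (contDiffOn_pd_family hD hΦ 0) (contDiffOn_pd_family hD hΦ 1)
    (contDiffOn_pd_family (Φ := fun t => pd j (Φ t)) hD (contDiffOn_pd_family hD hΦ j) i)

theorem hasDerivAt_secondForm (hD : IsOpen D)
    (hΦ : ContDiffOn ℝ ∞ (fun w : ℝ × (ℝ × ℝ) => Φ w.1 w.2) (univ ×ˢ D)) (hz : z ∈ D)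
    (i j : Fin 2) :
    HasDerivAt (fun t => secondForm (Φ t) z i j)
      (secondFormVariation (Φ 0) (variationField Φ) z i j) 0 :=
  (hasDerivAt_variationField hD hΦ hz).det4 (hasDerivAt_pd_family hD hΦ hz 0)
    (hasDerivAt_pd_family hD hΦ hz 1) (hasDerivAt_pd_pd_family hD hΦ hz i j)

theorem hasDerivAt_preCubicForm (hD : IsOpen D)
    (hΦ : ContDiffOn ℝ ∞ (fun w : ℝ × (ℝ × ℝ) => Φ w.1 w.2) (univ ×ˢ D)) (hz : z ∈ D)
    (i j k : Fin 2) :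
    HasDerivAt (fun t => preCubicForm (Φ t) z i j k)
      (preCubicFormVariation (Φ 0) (variationField Φ) z i j k) 0 := by
  have h : ∀ i j k : Fin 2, HasDerivAt (fun t => pd i (fun w => secondForm (Φ t) w j k) z)
      (pd i (fun w => secondFormVariation (Φ 0) (variationField Φ) w j k) z) 0 := by
    intro i j k
    -- The entries of the second form are themselves a smooth family, so their spatial derivatives
    -- may be linearized in the same way.
    have h1 := hasDerivAt_pd_family (Φ := fun t w => secondForm (Φ t) w j k) hD
      (contDiffOn_secondForm_family hD hΦ j k) hz i
    have e : ∀ w ∈ D, variationField (fun t w => secondForm (Φ t) w j k) w =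
        secondFormVariation (Φ 0) (variationField Φ) w j k :=
      fun w hw => (hasDerivAt_secondForm hD hΦ hw j k).deriv
    rwa [pd_congr hD e hz] at h1
  exact ((hasDerivAt_variationField hD hΦ hz).det4 (hasDerivAt_pd_family hD hΦ hz 0)
    (hasDerivAt_pd_family hD hΦ hz 1) (hasDerivAt_pd_pd_pd_family hD hΦ hz i j k)).sub
    ((((h i j k).add (h j k i)).add (h k i j)).div_const 2)

/-- The first variation of the area density, where the second fundamental form is
`dx dy` and the cubic form is `b dx³ + c dy³`. -/
theorem hasDerivAt_projectiveAreaDensity {H' : Fin 2 → Fin 2 → ℝ} {T' : Fin 2 → Fin 2 → Fin 2 → ℝ}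
    (hH' : ∀ i j, HasDerivAt (fun t => secondForm (Φ t) z i j) (H' i j) 0)
    (hT' : ∀ i j k, HasDerivAt (fun t => preCubicForm (Φ t) z i j k) (T' i j k) 0) {β γ : ℝ}
    (hH : secondForm (Φ 0) z = !![0, 1; 1, 0])
    (hT : preCubicForm (Φ 0) z = ![![![β, 0], ![0, 0]], ![![0, 0], ![0, γ]]]) :
    HasDerivAt (fun t => projectiveAreaDensity (Φ t) z)
      (γ * T' 0 0 0 + β * T' 1 1 1 - β * γ * (H' 0 1 + H' 1 0)) 0 := by
  have hdet : HasDerivAt (fun t => (secondForm (Φ t) z).det) (-(H' 0 1 + H' 1 0)) 0 := by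
    have h := ((hH' 0 0).mul (hH' 1 1)).sub ((hH' 0 1).mul (hH' 1 0))
    simp only [hH] at h
    have e : (fun t => (secondForm (Φ t) z).det) = _ := funext fun t => Matrix.det_fin_two _
    rw [e]
    convert! h using 1
    simp
  have hdet0 : (secondForm (Φ 0) z).det = -1 := by
    rw [hH]
    simp [Matrix.det_fin_two]
  have hinv0 : (secondForm (Φ 0) z)⁻¹ = !![0, 1; 1, 0] := by
    rw [hH]
    apply Matrix.inv_eq_right_inv
    ext i j
    fin_cases i <;> fin_cases j <;> simp
  have hinv : ∀ i j, HasDerivAt (fun t => (secondForm (Φ t) z)⁻¹ i j)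
      (-(!![H' 1 1, H' 1 0; H' 0 1, H' 0 0] i j)) 0 := by
    have hd := hdet.inv (by rw [hdet0]; norm_num)
    have e : ∀ t, (secondForm (Φ t) z)⁻¹ = (secondForm (Φ t) z).det⁻¹ •
        !![secondForm (Φ t) z 1 1, -secondForm (Φ t) z 0 1;
          -secondForm (Φ t) z 1 0, secondForm (Φ t) z 0 0] := fun t => by
      rw [Matrix.inv_def, Matrix.adjugate_fin_two, Ring.inverse_eq_inv']
    simp only [e]
    intro i j
    fin_cases i <;> fin_cases j
    · convert! hd.mul (hH' 1 1) using 1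
      simp [hH]
    · convert! hd.mul (hH' 0 1).neg using 1
      simp [hH]
    · convert! hd.mul (hH' 1 0).neg using 1
      simp [hH]
    · convert! hd.mul (hH' 0 0) using 1
      simp [hH]
  have hsqrt : HasDerivAt (fun t => Real.sqrt |(secondForm (Φ t) z).det|)
      ((H' 0 1 + H' 1 0) / 2) 0 := by
    -- The determinant is -1 at t = 0 and stays negative nearby, so the absolute value is smooth
    -- there.
    have h1 : (fun t => |(secondForm (Φ t) z).det|) =ᶠ[nhds 0]
        fun t => -(secondForm (Φ t) z).det := by
      have : ∀ᶠ t in nhds 0, (secondForm (Φ t) z).det < 0 :=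
        hdet.continuousAt.eventually_lt_const (hdet0.trans_lt (by norm_num))
      filter_upwards [this] with t ht
      exact abs_of_neg ht
    have h2 := (hdet.neg.congr_of_eventuallyEq h1).sqrt (by rw [hdet0]; norm_num)
    convert! h2 using 1
    simp [hdet0]
  -- Only existence of this derivative matters: it enters the cubic form multiplied by h, and
  -- contracting with the apolar cubic form annihilates it.
  have htr : ∀ k, ∃ d, HasDerivAt (fun t => preCubicTrace (Φ t) z k) d 0 := fun k =>
    ⟨_, HasDerivAt.fun_sum fun i _ => HasDerivAt.fun_sum fun j _ => (hinv i j).mul (hT' i j k)⟩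
  choose v' hv' using htr
  have htr0 : ∀ k, preCubicTrace (Φ 0) z k = 0 := by
    intro k
    fin_cases k <;> simp [preCubicTrace, hinv0, hT]
  have hC0 : cubicForm (Φ 0) z = ![![![β, 0], ![0, 0]], ![![0, 0], ![0, γ]]] := by
    funext i j k
    simp [cubicForm, htr0, hT]
  have hC : ∀ i j k, HasDerivAt (fun t => cubicForm (Φ t) z i j k)
      (T' i j k - (!![0, 1; 1, 0] i j * v' k + !![0, 1; 1, 0] j k * v' i
        + !![0, 1; 1, 0] k i * v' j) / 4) 0 := by
    intro i j k
    have h := (hT' i j k).sub (((((hH' i j).mul (hv' k)).add ((hH' j k).mul (hv' i))).add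
      ((hH' k i).mul (hv' j))).div_const 4)
    convert! h using 1
    simp [htr0, hH]
  have hsum := HasDerivAt.fun_sum (u := Finset.univ) fun (i : Fin 2) _ =>
    HasDerivAt.fun_sum (u := Finset.univ) fun (j : Fin 2) _ =>
    HasDerivAt.fun_sum (u := Finset.univ) fun (k : Fin 2) _ =>
    HasDerivAt.fun_sum (u := Finset.univ) fun (i' : Fin 2) _ =>
    HasDerivAt.fun_sum (u := Finset.univ) fun (j' : Fin 2) _ =>
    HasDerivAt.fun_sum (u := Finset.univ) fun (k' : Fin 2) _ =>
    (((((hinv i i').mul (hinv j j')).mul (hinv k k')).mul (hC i j k)).mul (hC i' j' k'))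
  have key := (hsqrt.const_mul (1 / 2)).mul hsum
  convert! key using 1
  -- The three inverse metrics contribute -3/2 and the root of the determinant +1/2 to the
  -- coefficient of βγ (H'₀₁ + H'₁₀), which is therefore -1.
  simp [hdet0, hinv0, hC0, Fin.sum_univ_two]
  ring

end AreaVariation

/-! ### Integration by parts in pointwise form. -/

section Divergence

/-- The `x`-component of the flux in the first variation of the projective area, where `L` solves
the dual canonical system. -/
def variationFluxX (b c p L v : ℝ × ℝ → ℝ) (z : ℝ × ℝ) : ℝ :=
  -(c z * (L z * (pd 0 (pd 0 v) z - b z * pd 1 v z - p z * v z)) * 2⁻¹)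
    + (pd 0 c z * L z * 2⁻¹ - c z * pd 0 L z) * pd 0 v z
    - (pd 0 (pd 0 c) z * L z * 2⁻¹ - pd 0 c z * pd 0 L z * 2⁻¹ + b z * c z * pd 1 L z
      - c z * (p z + pd 1 b z) * L z) * v z
    - c z * (pd 1 b z * L z * 2⁻¹ - b z * pd 1 L z) * v z

/-- The `y`-component of the flux in the first variation of the projective area, where `L` solves
the dual canonical system. -/
def variationFluxY (b c q L v : ℝ × ℝ → ℝ) (z : ℝ × ℝ) : ℝ :=
  -(b z * (L z * (pd 1 (pd 1 v) z - c z * pd 0 v z - q z * v z)) * 2⁻¹)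
    + (pd 1 b z * L z * 2⁻¹ - b z * pd 1 L z) * pd 1 v z
    - (pd 1 (pd 1 b) z * L z * 2⁻¹ - pd 1 b z * pd 1 L z * 2⁻¹ + b z * c z * pd 0 L z
      - b z * (q z + pd 0 c z) * L z) * v z
    - b z * (pd 0 c z * L z * 2⁻¹ - c z * pd 0 L z) * v z

variable {D : Set (ℝ × ℝ)} {b c p q L v : ℝ × ℝ → ℝ} {z : ℝ × ℝ}

theorem contDiffOn_variationFluxX (hD : IsOpen D) (hb : ContDiffOn ℝ ∞ b D)
    (hc : ContDiffOn ℝ ∞ c D) (hp : ContDiffOn ℝ ∞ p D) (hL : ContDiffOn ℝ ∞ L D)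
    (hv : ContDiffOn ℝ ∞ v D) : ContDiffOn ℝ ∞ (variationFluxX b c p L v) D := by
  have h1 := hb.pd hD 1
  have h2 := hc.pd hD 0
  have h3 := (hc.pd hD 0).pd hD 0
  have h4 := hL.pd hD 0
  have h5 := hL.pd hD 1
  have h6 := hv.pd hD 0
  have h7 := hv.pd hD 1
  have h8 := (hv.pd hD 0).pd hD 0
  unfold variationFluxX
  fun_prop

theorem contDiffOn_variationFluxY (hD : IsOpen D) (hb : ContDiffOn ℝ ∞ b D)
    (hc : ContDiffOn ℝ ∞ c D) (hq : ContDiffOn ℝ ∞ q D) (hL : ContDiffOn ℝ ∞ L D)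
    (hv : ContDiffOn ℝ ∞ v D) : ContDiffOn ℝ ∞ (variationFluxY b c q L v) D := by
  have h1 := hb.pd hD 1
  have h2 := hc.pd hD 0
  have h3 := (hb.pd hD 1).pd hD 1
  have h4 := hL.pd hD 0
  have h5 := hL.pd hD 1
  have h6 := hv.pd hD 0
  have h7 := hv.pd hD 1
  have h8 := (hv.pd hD 1).pd hD 1
  unfold variationFluxY
  fun_prop

/-- Integration by parts for the first variation of the projective area, in pointwise form. -/
theorem firstVariation_eq_divergence (hD : IsOpen D) (hb : ContDiffOn ℝ ∞ b D)
    (hc : ContDiffOn ℝ ∞ c D) (hp : ContDiffOn ℝ ∞ p D) (hq : ContDiffOn ℝ ∞ q D)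
    (hL : ContDiffOn ℝ ∞ L D) (hv : ContDiffOn ℝ ∞ v D)
    (hxx : ∀ w ∈ D, pd 0 (pd 0 L) w = -(b w * pd 1 L w) + (p w + pd 1 b w) * L w)
    (hyy : ∀ w ∈ D, pd 1 (pd 1 L) w = -(c w * pd 0 L w) + (q w + pd 0 c w) * L w) (hz : z ∈ D) :
    c z * (L z * pd 0 (fun w => pd 0 (pd 0 v) w - b w * pd 1 v w - p w * v w) z
        - 3 / 2 * pd 0 (fun w => L w * (pd 0 (pd 0 v) w - b w * pd 1 v w - p w * v w)) z)
      + b z * (L z * pd 1 (fun w => pd 1 (pd 1 v) w - c w * pd 0 v w - q w * v w) z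
        - 3 / 2 * pd 1 (fun w => L w * (pd 1 (pd 1 v) w - c w * pd 0 v w - q w * v w)) z) =
    -((b z * pd 1 q z + 2 * pd 1 b z * q z + b z * pd 0 (pd 1 c) z / 2 + pd 1 b z * pd 0 c z
        - pd 1 (pd 1 (pd 1 b)) z / 2)
      + (c z * pd 0 p z + 2 * pd 0 c z * p z + c z * pd 0 (pd 1 b) z / 2 + pd 0 c z * pd 1 b z
        - pd 0 (pd 0 (pd 0 c)) z / 2)) * (L z * v z)
      + pd 0 (variationFluxX b c p L v) z + pd 1 (variationFluxY b c q L v) z := by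
  have d : ∀ {g : ℝ × ℝ → ℝ}, ContDiffOn ℝ ∞ g D → DifferentiableAt ℝ g z :=
    fun hg => hg.differentiableAt_of_isOpen hD hz
  have d1 := d hb
  have d2 := d hc
  have d3 := d hp
  have d4 := d hq
  have d5 := d hL
  have d6 := d hv
  have h1 := d (hb.pd hD 1)
  have h2 := d (hc.pd hD 0)
  have h3 := d ((hb.pd hD 1).pd hD 1)
  have h3' := d ((hc.pd hD 0).pd hD 0)
  have h4 := d (hL.pd hD 0)
  have h5 := d (hL.pd hD 1)
  have h6 := d (hv.pd hD 0)
  have h7 := d (hv.pd hD 1)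
  have h8 := d ((hv.pd hD 0).pd hD 0)
  have h9 := d ((hv.pd hD 1).pd hD 1)
  -- With M = v_xx - b v_y - p v and a = c_x L / 2 - c L_x, the x-half of the left side is -(c L
  -- M)_x / 2 + a M. Moving the derivatives in a M from v onto a, and the mirror computation in y,
  -- give the fluxes. The dual system removes L_xx and L_yy.
  unfold variationFluxX variationFluxY
  simp (disch := fun_prop) only [pd_add, pd_sub, pd_mul, pd_neg, pd_const]
  rw [hxx z hz, hyy z hz, pd_comm hD hL hz 1 0, pd_comm hD hv hz 1 0, pd_comm hD hc hz 1 0]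
  ring

end Divergence

/-! ### Tangent planes, the dual canonical system, and the first variation of the density. -/

/-- The coordinates of the covector `u ↦ det4 (f, f_x, f_y, u)` of tangent planes. -/
def tangentCovector (f : ℝ × ℝ → Fin 4 → ℝ) (j : Fin 4) (z : ℝ × ℝ) : ℝ :=
  det4 (f z) (pd 0 f z) (pd 1 f z) (Pi.single j 1)

theorem det4_eq_sum_tangentCovector (f : ℝ × ℝ → Fin 4 → ℝ) (z : ℝ × ℝ) (u : Fin 4 → ℝ) :
    det4 (f z) (pd 0 f z) (pd 1 f z) u = ∑ j, tangentCovector f j z * u j := by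
  simp [tangentCovector, Fin.sum_univ_four, det4_eq]
  ring

namespace IsCanonicalLift

variable {D : Set (ℝ × ℝ)} {f : ℝ × ℝ → Fin 4 → ℝ} {b c p q : ℝ × ℝ → ℝ} {z : ℝ × ℝ}

theorem contDiffOn_tangentCovector (hf : IsCanonicalLift D f b c p q) (j : Fin 4) :
    ContDiffOn ℝ ∞ (tangentCovector f j) D :=
  hf.contDiffOn_f.det4 (hf.contDiffOn_f.pd hf.isOpen 0) (hf.contDiffOn_f.pd hf.isOpen 1)
    contDiffOn_const

/-- Differentiating f repeats f_x, and f_xx lies in the span of f and f_y. Only the derivative of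
f_y survives. -/
theorem tangentCovector_x (hf : IsCanonicalLift D f b c p q) (hz : z ∈ D) (j : Fin 4) :
    pd 0 (tangentCovector f j) z =
      det4 (f z) (pd 0 f z) (pd 0 (pd 1 f) z) (Pi.single j 1) := by
  have hD := hf.isOpen
  unfold tangentCovector
  rw [pd_det4 (hf.contDiffOn_f.differentiableAt_of_isOpen hD hz)
    ((hf.contDiffOn_f.pd hD 0).differentiableAt_of_isOpen hD hz)
    ((hf.contDiffOn_f.pd hD 1).differentiableAt_of_isOpen hD hz) (by fun_prop), pd_const,
    hf.f_xx z hz]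
  simp only [det4_eq, Pi.add_apply, Pi.smul_apply, smul_eq_mul, Pi.zero_apply]
  ring

theorem tangentCovector_y (hf : IsCanonicalLift D f b c p q) (hz : z ∈ D) (j : Fin 4) :
    pd 1 (tangentCovector f j) z =
      det4 (f z) (pd 0 (pd 1 f) z) (pd 1 f z) (Pi.single j 1) := by
  have hD := hf.isOpen
  unfold tangentCovector
  rw [pd_det4 (hf.contDiffOn_f.differentiableAt_of_isOpen hD hz)
    ((hf.contDiffOn_f.pd hD 0).differentiableAt_of_isOpen hD hz)
    ((hf.contDiffOn_f.pd hD 1).differentiableAt_of_isOpen hD hz) (by fun_prop), pd_const,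
    hf.f_yy z hz, hf.f_yx hz]
  simp only [det4_eq, Pi.add_apply, Pi.smul_apply, smul_eq_mul, Pi.zero_apply]
  ring

theorem f_xyx (hf : IsCanonicalLift D f b c p q) (hz : z ∈ D) :
    pd 0 (pd 0 (pd 1 f)) z =
      (pd 1 b z + p z) • pd 1 f z + (b z * c z) • pd 0 f z + (b z * q z + pd 1 p z) • f z :=
  ((pd_congr hf.isOpen (fun _ hw => (hf.f_yx hw).symm) hz).trans
    (pd_comm hf.isOpen (hf.contDiffOn_f.pd hf.isOpen 0) hz 0 1)).trans (hf.f_xxy hz)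

theorem f_xyy (hf : IsCanonicalLift D f b c p q) (hz : z ∈ D) :
    pd 1 (pd 0 (pd 1 f)) z =
      (pd 0 c z + q z) • pd 0 f z + (b z * c z) • pd 1 f z + (c z * p z + pd 0 q z) • f z :=
  (pd_comm hf.isOpen (hf.contDiffOn_f.pd hf.isOpen 1) hz 1 0).trans (hf.f_yyx hz)

/-- The tangent planes satisfy the dual canonical system. -/
theorem tangentCovector_xx (hf : IsCanonicalLift D f b c p q) (hz : z ∈ D) (j : Fin 4) :
    pd 0 (pd 0 (tangentCovector f j)) z =
      -(b z * pd 1 (tangentCovector f j) z) + (p z + pd 1 b z) * tangentCovector f j z := by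
  have hD := hf.isOpen
  rw [pd_congr hD (fun w hw => hf.tangentCovector_x hw j) hz,
    pd_det4 (hf.contDiffOn_f.differentiableAt_of_isOpen hD hz)
    ((hf.contDiffOn_f.pd hD 0).differentiableAt_of_isOpen hD hz)
    (((hf.contDiffOn_f.pd hD 1).pd hD 0).differentiableAt_of_isOpen hD hz) (by fun_prop), pd_const,
    hf.f_xx z hz, hf.f_xyx hz, hf.tangentCovector_y hz, tangentCovector]
  simp only [det4_eq, Pi.add_apply, Pi.smul_apply, smul_eq_mul, Pi.zero_apply]
  ring

theorem tangentCovector_yy (hf : IsCanonicalLift D f b c p q) (hz : z ∈ D) (j : Fin 4) :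
    pd 1 (pd 1 (tangentCovector f j)) z =
      -(c z * pd 0 (tangentCovector f j) z) + (q z + pd 0 c z) * tangentCovector f j z := by
  have hD := hf.isOpen
  rw [pd_congr hD (fun w hw => hf.tangentCovector_y hw j) hz,
    pd_det4 (hf.contDiffOn_f.differentiableAt_of_isOpen hD hz)
    (((hf.contDiffOn_f.pd hD 1).pd hD 0).differentiableAt_of_isOpen hD hz)
    ((hf.contDiffOn_f.pd hD 1).differentiableAt_of_isOpen hD hz) (by fun_prop), pd_const,
    hf.f_yy z hz, hf.f_xyy hz, hf.tangentCovector_x hz, tangentCovector]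
  simp only [det4_eq, Pi.add_apply, Pi.smul_apply, smul_eq_mul, Pi.zero_apply]
  ring

theorem secondForm_eq (hf : IsCanonicalLift D f b c p q) (hz : z ∈ D) :
    secondForm f z = !![0, 1; 1, 0] := by
  have h1 := hf.det4_eq_one hz
  ext i j
  fin_cases i <;> fin_cases j
  · change det4 (f z) (pd 0 f z) (pd 1 f z) (pd 0 (pd 0 f) z) = 0
    rw [hf.f_xx z hz]
    simp only [det4_eq, Pi.add_apply, Pi.smul_apply, smul_eq_mul]
    ring
  · exact h1
  · change det4 (f z) (pd 0 f z) (pd 1 f z) (pd 1 (pd 0 f) z) = 1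
    rw [hf.f_yx hz, h1]
  · change det4 (f z) (pd 0 f z) (pd 1 f z) (pd 1 (pd 1 f) z) = 0
    rw [hf.f_yy z hz]
    simp only [det4_eq, Pi.add_apply, Pi.smul_apply, smul_eq_mul]
    ring

/-- The second form is constant, so its derivatives drop out. What is left is the f_xy-coefficient
of each third derivative: zero for the mixed ones, b and c for the pure ones. -/
theorem preCubicForm_eq (hf : IsCanonicalLift D f b c p q) (hz : z ∈ D) :
    preCubicForm f z = ![![![b z, 0], ![0, 0]], ![![0, 0], ![0, c z]]] := by
  have hD := hf.isOpen
  have h1 := hf.det4_eq_one hz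
  have hpd : ∀ i j k : Fin 2, pd i (fun w => secondForm f w j k) z = 0 := fun i j k => by
    rw [pd_congr hD (fun w hw => by rw [hf.secondForm_eq hw]) hz, pd_const]
  have span : ∀ r s t : ℝ, det4 (f z) (pd 0 f z) (pd 1 f z)
      (r • pd 1 f z + s • pd 0 f z + t • f z) = 0 := fun r s t => by
    simp only [det4_eq, Pi.add_apply, Pi.smul_apply, smul_eq_mul]
    ring
  have span' : ∀ r s t : ℝ, det4 (f z) (pd 0 f z) (pd 1 f z)
      (r • pd 0 f z + s • pd 1 f z + t • f z) = 0 := fun r s t => by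
    simp only [det4_eq, Pi.add_apply, Pi.smul_apply, smul_eq_mul]
    ring
  have e1 : pd 0 (pd 1 (pd 0 f)) z = pd 0 (pd 0 (pd 1 f)) z :=
    pd_congr hD (fun w hw => hf.f_yx hw) hz
  have e2 : pd 1 (pd 1 (pd 0 f)) z = pd 1 (pd 0 (pd 1 f)) z :=
    pd_congr hD (fun w hw => hf.f_yx hw) hz
  funext i j k
  unfold preCubicForm
  rw [hpd, hpd, hpd]
  fin_cases i <;> fin_cases j <;> fin_cases k
  · change det4 _ _ _ (pd 0 (pd 0 (pd 0 f)) z) - _ = b z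
    rw [hf.f_xxx hz]
    rw [det4_eq] at h1 ⊢
    simp only [Pi.add_apply, Pi.smul_apply, smul_eq_mul]
    linear_combination b z * h1
  · change det4 _ _ _ (pd 0 (pd 0 (pd 1 f)) z) - _ = 0
    rw [hf.f_xyx hz, span]
    norm_num
  · change det4 _ _ _ (pd 0 (pd 1 (pd 0 f)) z) - _ = 0
    rw [e1, hf.f_xyx hz, span]
    norm_num
  · change det4 _ _ _ (pd 0 (pd 1 (pd 1 f)) z) - _ = 0
    rw [hf.f_yyx hz, span']
    norm_num
  · change det4 _ _ _ (pd 1 (pd 0 (pd 0 f)) z) - _ = 0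
    rw [hf.f_xxy hz, span]
    norm_num
  · change det4 _ _ _ (pd 1 (pd 0 (pd 1 f)) z) - _ = 0
    rw [hf.f_xyy hz, span']
    norm_num
  · change det4 _ _ _ (pd 1 (pd 1 (pd 0 f)) z) - _ = 0
    rw [e2, hf.f_xyy hz, span']
    norm_num
  · change det4 _ _ _ (pd 1 (pd 1 (pd 1 f)) z) - _ = c z
    rw [hf.f_yyy hz]
    rw [det4_eq] at h1 ⊢
    simp only [Pi.add_apply, Pi.smul_apply, smul_eq_mul]
    linear_combination c z * h1

variable {v : ℝ × ℝ → Fin 4 → ℝ}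

/-- With f_xx = b f_y + p f, alternation turns the first three determinants into -b L(v_y) - p L(v).
The result is L applied to the linearized equation. -/
theorem secondFormVariation_xx (hf : IsCanonicalLift D f b c p q) (hz : z ∈ D) :
    secondFormVariation f v z 0 0 = ∑ j, tangentCovector f j z *
      (pd 0 (pd 0 v) z j - b z * pd 1 v z j - p z * v z j) := by
  have h := det4_eq_sum_tangentCovector f z (pd 0 (pd 0 v) z - b z • pd 1 v z - p z • v z)
  simp only [Pi.sub_apply, Pi.smul_apply, smul_eq_mul] at h
  rw [← h, secondFormVariation, hf.f_xx z hz]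
  simp only [det4_eq, Pi.add_apply, Pi.sub_apply, Pi.smul_apply, smul_eq_mul]
  ring

theorem secondFormVariation_yy (hf : IsCanonicalLift D f b c p q) (hz : z ∈ D) :
    secondFormVariation f v z 1 1 = ∑ j, tangentCovector f j z *
      (pd 1 (pd 1 v) z j - c z * pd 0 v z j - q z * v z j) := by
  have h := det4_eq_sum_tangentCovector f z (pd 1 (pd 1 v) z - c z • pd 0 v z - q z • v z)
  simp only [Pi.sub_apply, Pi.smul_apply, smul_eq_mul] at h
  rw [← h, secondFormVariation, hf.f_yy z hz]
  simp only [det4_eq, Pi.add_apply, Pi.sub_apply, Pi.smul_apply, smul_eq_mul]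
  ring

theorem secondFormVariation_yx (hf : IsCanonicalLift D f b c p q) (hv : ContDiffOn ℝ ∞ v D)
    (hz : z ∈ D) : secondFormVariation f v z 1 0 = secondFormVariation f v z 0 1 := by
  rw [secondFormVariation, secondFormVariation, hf.f_yx hz, pd_comm hf.isOpen hv hz 1 0]

theorem pd_pd_apply {i k : Fin 2} (hD : IsOpen D) (hv : ContDiffOn ℝ ∞ v D) (hz : z ∈ D)
    (j : Fin 4) : pd i (pd k (fun w => v w j)) z = pd i (pd k v) z j := by
  rw [pd_congr hD (fun w hw => pd_apply (hv.differentiableAt_of_isOpen hD hw) j) hz,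
    pd_apply ((hv.pd hD k).differentiableAt_of_isOpen hD hz)]

/-- The factor 3/2 is half of three equal derivatives of the xx-component of the second form. The
term b f_xy of f_xxx yields b times the variation of the xy-component, which later cancels against
the variation of the metric. -/
theorem preCubicFormVariation_xxx (hf : IsCanonicalLift D f b c p q) (hv : ContDiffOn ℝ ∞ v D)
    (hz : z ∈ D) :
    preCubicFormVariation f v z 0 0 0 =
      ∑ j, (tangentCovector f j z * pd 0 (fun w => pd 0 (pd 0 (fun w => v w j)) w
        - b w * pd 1 (fun w => v w j) w - p w * v w j) z
      - 3 / 2 * pd 0 (fun w => tangentCovector f j w * (pd 0 (pd 0 (fun w => v w j)) w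
        - b w * pd 1 (fun w => v w j) w - p w * v w j)) z)
      + b z * secondFormVariation f v z 0 1 := by
  have hD := hf.isOpen
  have hb := hf.contDiffOn_b.differentiableAt_of_isOpen hD hz
  have hp := hf.contDiffOn_p.differentiableAt_of_isOpen hD hz
  have hvj : ∀ j, ContDiffOn ℝ ∞ (fun w => v w j) D := contDiffOn_pi.1 hv
  have d0 := fun j => (hvj j).differentiableAt_of_isOpen hD hz
  have d1 := fun j => ((hvj j).pd hD 1).differentiableAt_of_isOpen hD hz
  have d2 := fun j => (((hvj j).pd hD 0).pd hD 0).differentiableAt_of_isOpen hD hz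
  have hM : ∀ j, pd 0 (fun w => pd 0 (pd 0 (fun w => v w j)) w
        - b w * pd 1 (fun w => v w j) w - p w * v w j) z =
      (pd 0 (pd 0 (pd 0 v)) z - (pd 0 b z • pd 1 v z + b z • pd 0 (pd 1 v) z)
        - (pd 0 p z • v z + p z • pd 0 v z)) j := by
    intro j
    have e3 : pd 0 (pd 0 (pd 0 (fun w => v w j))) z = pd 0 (pd 0 (pd 0 v)) z j := by
      rw [← pd_pd_apply hD (hv.pd hD 0) hz,
        pd_congr hD (fun w hw => pd_congr hD
          (fun w hw => pd_apply (hv.differentiableAt_of_isOpen hD hw) j) hw) hz]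
    have d0' := d0 j
    have d1' := d1 j
    have d2' := d2 j
    rw [pd_sub (by fun_prop) (by fun_prop), pd_sub (by fun_prop) (by fun_prop), pd_mul hb d1',
      pd_mul hp d0', e3, pd_pd_apply hD hv hz, pd_apply (hv.differentiableAt_of_isOpen hD hz),
      pd_apply (hv.differentiableAt_of_isOpen hD hz)]
    rfl
  have hh : pd 0 (fun w => secondFormVariation f v w 0 0) z =
      ∑ j, pd 0 (fun w => tangentCovector f j w * (pd 0 (pd 0 (fun w => v w j)) w
        - b w * pd 1 (fun w => v w j) w - p w * v w j)) z := by
    rw [← pd_sum]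
    · refine pd_congr hD (fun w hw => ?_) hz
      rw [hf.secondFormVariation_xx hw]
      refine Finset.sum_congr rfl fun j _ => ?_
      rw [pd_pd_apply hD hv hw, pd_apply (hv.differentiableAt_of_isOpen hD hw)]
    · intro j _
      have d0' := d0 j
      have d1' := d1 j
      have d2' := d2 j
      have dL := (hf.contDiffOn_tangentCovector j).differentiableAt_of_isOpen hD hz
      fun_prop
  rw [Finset.sum_sub_distrib, ← Finset.mul_sum, ← hh, preCubicFormVariation]
  simp only [hM]
  rw [← det4_eq_sum_tangentCovector, secondFormVariation, hf.f_xxx hz]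
  simp only [det4_eq, Pi.add_apply, Pi.sub_apply, Pi.smul_apply, smul_eq_mul]
  ring

theorem preCubicFormVariation_yyy (hf : IsCanonicalLift D f b c p q) (hv : ContDiffOn ℝ ∞ v D)
    (hz : z ∈ D) :
    preCubicFormVariation f v z 1 1 1 =
      ∑ j, (tangentCovector f j z * pd 1 (fun w => pd 1 (pd 1 (fun w => v w j)) w
        - c w * pd 0 (fun w => v w j) w - q w * v w j) z
      - 3 / 2 * pd 1 (fun w => tangentCovector f j w * (pd 1 (pd 1 (fun w => v w j)) w
        - c w * pd 0 (fun w => v w j) w - q w * v w j)) z)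
      + c z * secondFormVariation f v z 0 1 := by
  have hD := hf.isOpen
  have hc := hf.contDiffOn_c.differentiableAt_of_isOpen hD hz
  have hq := hf.contDiffOn_q.differentiableAt_of_isOpen hD hz
  have hvj : ∀ j, ContDiffOn ℝ ∞ (fun w => v w j) D := contDiffOn_pi.1 hv
  have d0 := fun j => (hvj j).differentiableAt_of_isOpen hD hz
  have d1 := fun j => ((hvj j).pd hD 0).differentiableAt_of_isOpen hD hz
  have d2 := fun j => (((hvj j).pd hD 1).pd hD 1).differentiableAt_of_isOpen hD hz
  have hM : ∀ j, pd 1 (fun w => pd 1 (pd 1 (fun w => v w j)) w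
        - c w * pd 0 (fun w => v w j) w - q w * v w j) z =
      (pd 1 (pd 1 (pd 1 v)) z - (pd 1 c z • pd 0 v z + c z • pd 0 (pd 1 v) z)
        - (pd 1 q z • v z + q z • pd 1 v z)) j := by
    intro j
    have e3 : pd 1 (pd 1 (pd 1 (fun w => v w j))) z = pd 1 (pd 1 (pd 1 v)) z j := by
      rw [← pd_pd_apply hD (hv.pd hD 1) hz,
        pd_congr hD (fun w hw => pd_congr hD
          (fun w hw => pd_apply (hv.differentiableAt_of_isOpen hD hw) j) hw) hz]
    have d0' := d0 j
    have d1' := d1 j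
    have d2' := d2 j
    rw [pd_sub (by fun_prop) (by fun_prop), pd_sub (by fun_prop) (by fun_prop), pd_mul hc d1',
      pd_mul hq d0', e3, pd_pd_apply hD hv hz, pd_apply (hv.differentiableAt_of_isOpen hD hz),
      pd_apply (hv.differentiableAt_of_isOpen hD hz), pd_comm hD hv hz 1 0]
    rfl
  have hh : pd 1 (fun w => secondFormVariation f v w 1 1) z =
      ∑ j, pd 1 (fun w => tangentCovector f j w * (pd 1 (pd 1 (fun w => v w j)) w
        - c w * pd 0 (fun w => v w j) w - q w * v w j)) z := by
    rw [← pd_sum]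
    · refine pd_congr hD (fun w hw => ?_) hz
      rw [hf.secondFormVariation_yy hw]
      refine Finset.sum_congr rfl fun j _ => ?_
      rw [pd_pd_apply hD hv hw, pd_apply (hv.differentiableAt_of_isOpen hD hw)]
    · intro j _
      have d0' := d0 j
      have d1' := d1 j
      have d2' := d2 j
      have dL := (hf.contDiffOn_tangentCovector j).differentiableAt_of_isOpen hD hz
      fun_prop
  rw [Finset.sum_sub_distrib, ← Finset.mul_sum, ← hh, preCubicFormVariation]
  simp only [hM]
  rw [← det4_eq_sum_tangentCovector, secondFormVariation, hf.f_yyy hz]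
  simp only [det4_eq, Pi.add_apply, Pi.sub_apply, Pi.smul_apply, smul_eq_mul]
  ring

/-- The first variation formula: the Euler-Lagrange expression is a multiple of the sum of the
two expressions of Thomsen. -/
theorem hasDerivAt_projectiveAreaDensity (hf : IsCanonicalLift D f b c p q)
    {Φ : ℝ → ℝ × ℝ → Fin 4 → ℝ}
    (hΦ : ContDiffOn ℝ ∞ (fun w : ℝ × (ℝ × ℝ) => Φ w.1 w.2) (univ ×ˢ D))
    (h0 : ∀ w ∈ D, Φ 0 w = f w) (hz : z ∈ D) :
    HasDerivAt (fun t => projectiveAreaDensity (Φ t) z)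
      (-2 * (c z * pd 0 (projP b c p) z + 2 * pd 0 c z * projP b c p z)
          * det4 (f z) (pd 0 f z) (pd 1 f z) (variationField Φ z)
        + pd 0 (fun w => ∑ j, variationFluxX b c p (tangentCovector f j)
            (fun y => variationField Φ y j) w) z
        + pd 1 (fun w => ∑ j, variationFluxY b c q (tangentCovector f j)
            (fun y => variationField Φ y j) w) z) 0 := by
  have hD := hf.isOpen
  have hv := contDiffOn_variationField hD hΦ
  have hvj : ∀ j, ContDiffOn ℝ ∞ (fun w => variationField Φ w j) D := contDiffOn_pi.1 hv
  have hH' := fun i j => hasDerivAt_secondForm hD hΦ hz i j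
  have hT' := fun i j k => hasDerivAt_preCubicForm hD hΦ hz i j k
  have p1 : ∀ i, ∀ w ∈ D, pd i (Φ 0) w = pd i f w := fun i w hw => pd_congr hD h0 hw
  have p2 : ∀ i j, ∀ w ∈ D, pd i (pd j (Φ 0)) w = pd i (pd j f) w :=
    fun i j w hw => pd_congr hD (p1 j) hw
  have p3 : ∀ i j k, ∀ w ∈ D, pd i (pd j (pd k (Φ 0))) w = pd i (pd j (pd k f)) w :=
    fun i j k w hw => pd_congr hD (p2 j k) hw
  have hS : ∀ i j, ∀ w ∈ D, secondForm (Φ 0) w i j = secondForm f w i j := fun i j w hw => by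
    simp only [secondForm, Matrix.of_apply, h0 w hw, p1 _ w hw, p2 _ _ w hw]
  have hSV : ∀ i j, ∀ w ∈ D, secondFormVariation (Φ 0) (variationField Φ) w i j =
      secondFormVariation f (variationField Φ) w i j := fun i j w hw => by
    simp only [secondFormVariation, h0 w hw, p1 _ w hw, p2 _ _ w hw]
  have hC : ∀ i j k, preCubicForm (Φ 0) z i j k = preCubicForm f z i j k := fun i j k => by
    simp only [preCubicForm, h0 z hz, p1 _ z hz, p3 _ _ _ z hz]
    rw [pd_congr hD (hS j k) hz, pd_congr hD (hS k i) hz, pd_congr hD (hS i j) hz]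
  have hCV : ∀ i j k, preCubicFormVariation (Φ 0) (variationField Φ) z i j k =
      preCubicFormVariation f (variationField Φ) z i j k := fun i j k => by
    simp only [preCubicFormVariation, h0 z hz, p1 _ z hz, p3 _ _ _ z hz]
    rw [pd_congr hD (hSV j k) hz, pd_congr hD (hSV k i) hz, pd_congr hD (hSV i j) hz]
  have key := _root_.hasDerivAt_projectiveAreaDensity hH' hT' (β := b z) (γ := c z)
    (by
      rw [← hf.secondForm_eq hz]
      ext i j
      exact hS i j z hz)
    (by
      rw [← hf.preCubicForm_eq hz]
      funext i j k
      exact hC i j k)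
  simp only [hCV, hSV _ _ z hz] at key
  rw [hf.secondFormVariation_yx hv hz, hf.preCubicFormVariation_xxx hv hz,
    hf.preCubicFormVariation_yyy hv hz] at key
  convert! key using 1
  have hX := fun j => (contDiffOn_variationFluxX hD hf.contDiffOn_b hf.contDiffOn_c hf.contDiffOn_p
    (hf.contDiffOn_tangentCovector j) (hvj j)).differentiableAt_of_isOpen hD hz
  have hY := fun j => (contDiffOn_variationFluxY hD hf.contDiffOn_b hf.contDiffOn_c hf.contDiffOn_q
    (hf.contDiffOn_tangentCovector j) (hvj j)).differentiableAt_of_isOpen hD hz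
  have hdiv := Finset.sum_congr (rfl : (Finset.univ : Finset (Fin 4)) = Finset.univ) fun j _ =>
    firstVariation_eq_divergence hD hf.contDiffOn_b hf.contDiffOn_c hf.contDiffOn_p
    hf.contDiffOn_q (hf.contDiffOn_tangentCovector j) (hvj j)
    (fun w hw => hf.tangentCovector_xx hw j) (fun w hw => hf.tangentCovector_yy hw j) hz
  -- The two Thomsen expressions coincide, whence the factor -2.
  rw [← hf.thomsenQ_eq hz, ← hf.thomsenP_eq hz, hf.thomsenQ_eq_thomsenP hz] at hdiv
  rw [Finset.sum_add_distrib, Finset.sum_add_distrib, Finset.sum_add_distrib, ← Finset.mul_sum,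
    ← Finset.mul_sum, ← Finset.mul_sum] at hdiv
  rw [pd_sum (fun j _ => hX j), pd_sum (fun j _ => hY j), det4_eq_sum_tangentCovector]
  -- The terms bc H'₀₁ from the two cubic variations cancel against -bc (H'₀₁ + H'₁₀), since H'₁₀ =
  -- H'₀₁.
  linear_combination -hdiv

end IsCanonicalLift

open MeasureTheory

/-! ### Differentiation under the integral and vanishing of divergences. -/

section Integrals

/-- Differentiation under the integral sign over a compact set. -/
theorem hasDerivAt_setIntegral_of_contDiffOn {G : ℝ → ℝ × ℝ → ℝ} {O : Set (ℝ × (ℝ × ℝ))}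
    {K : Set (ℝ × ℝ)} (hO : IsOpen O)
    (hG : ContDiffOn ℝ ∞ (fun w : ℝ × (ℝ × ℝ) => G w.1 w.2) O) (hK : IsCompact K)
    (hKO : ∀ z ∈ K, ((0 : ℝ), z) ∈ O) :
    HasDerivAt (fun t => ∫ z in K, G t z) (∫ z in K, deriv (fun t => G t z) 0) 0 := by
  -- Compactness of K gives one interval of parameters that works for all points of K; on its
  -- product with K the t-derivative is bounded.
  obtain ⟨u, v, hu, -, h0u, hKv, huv⟩ := generalized_tube_lemma (isCompact_singleton (x := (0 : ℝ)))
    hK hO (by rintro ⟨t, z⟩ ⟨rfl, hz⟩; exact hKO z hz)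
  obtain ⟨ε, hε, hεu⟩ := Metric.nhds_basis_closedBall.mem_iff.1 (hu.mem_nhds (h0u rfl))
  have hmem : ∀ t ∈ Metric.closedBall (0 : ℝ) ε, ∀ z ∈ K, (t, z) ∈ O := fun t ht z hz =>
    huv ⟨hεu ht, hKv hz⟩
  set G' : ℝ → ℝ × ℝ → ℝ := fun t z =>
    fderiv ℝ (fun w : ℝ × (ℝ × ℝ) => G w.1 w.2) (t, z) ((1 : ℝ), (0 : ℝ × ℝ)) with hG'
  have hG'c : ContinuousOn (fun w : ℝ × (ℝ × ℝ) => G' w.1 w.2) O :=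
    ((hG.fderiv_of_isOpen (m := ∞) hO (by simp)).clm_apply
      (contDiffOn_const (c := ((1 : ℝ), (0 : ℝ × ℝ))))).continuousOn
  have hderiv : ∀ t z, (t, z) ∈ O → HasDerivAt (fun s => G s z) (G' t z) t := fun t z h => by
    have hd := (hG.differentiableAt_of_isOpen hO h).hasFDerivAt
    exact hd.comp_hasDerivAt t ((hasDerivAt_id t).prodMk (hasDerivAt_const t z))
  have slice : ∀ {g : ℝ × (ℝ × ℝ) → ℝ}, ContinuousOn g O → ∀ t ∈ Metric.closedBall (0 : ℝ) ε,
      ContinuousOn (fun z => g (t, z)) K := fun hg t ht =>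
    hg.comp (by fun_prop) fun z hz => hmem t ht z hz
  have h0 : (0 : ℝ) ∈ Metric.closedBall (0 : ℝ) ε := Metric.mem_closedBall_self hε.le
  obtain ⟨C, hC⟩ := ((isCompact_closedBall (0 : ℝ) ε).prod hK).exists_bound_of_continuousOn
    (hG'c.mono fun w hw => hmem w.1 hw.1 w.2 hw.2)
  have key := hasDerivAt_integral_of_dominated_loc_of_deriv_le (μ := volume.restrict K)
    (F := G) (F' := G') (bound := fun _ => C) (Metric.ball_mem_nhds (0 : ℝ) hε)
    (Filter.eventually_of_mem (Metric.ball_mem_nhds (0 : ℝ) hε) fun t ht =>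
      (slice hG.continuousOn t (Metric.ball_subset_closedBall ht)).aestronglyMeasurable
        hK.measurableSet)
    ((slice hG.continuousOn 0 h0).integrableOn_compact hK)
    ((slice hG'c 0 h0).aestronglyMeasurable hK.measurableSet)
    ((ae_restrict_iff' hK.measurableSet).2 (Filter.Eventually.of_forall fun z hz t ht =>
      hC (t, z) ⟨Metric.ball_subset_closedBall ht, hz⟩))
    (integrableOn_const hK.measure_ne_top)
    ((ae_restrict_iff' hK.measurableSet).2 (Filter.Eventually.of_forall fun z hz t ht =>
      hderiv t z (hmem t (Metric.ball_subset_closedBall ht) z hz)))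
  have e : ∫ z in K, deriv (fun t => G t z) 0 = ∫ z in K, G' 0 z :=
    setIntegral_congr_fun hK.measurableSet fun z hz => (hderiv 0 z (hmem 0 h0 z hz)).deriv
  rw [e]
  exact key.2

/-- Extended by zero, H is smooth with compact support on the plane, and integration by parts
against the constant 1 applies. -/
theorem setIntegral_pd_eq_zero {D K : Set (ℝ × ℝ)} (hD : IsOpen D) (hK : IsCompact K) (hKD : K ⊆ D)
    {H : ℝ × ℝ → ℝ} (hH : ContDiffOn ℝ ∞ H D) (h0 : ∀ z ∈ D \ K, H z = 0) (i : Fin 2) :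
    ∫ z in K, pd i H z = 0 := by
  classical
  set H₁ : ℝ × ℝ → ℝ := fun z => if z ∈ K then H z else 0 with hH₁
  have eqD : ∀ z ∈ D, H₁ z = H z := fun z hz => by
    by_cases h : z ∈ K
    · simp [hH₁, h]
    · simp [hH₁, h, h0 z ⟨hz, h⟩]
  have eqK : ∀ z ∈ Kᶜ, H₁ z = (fun _ => (0 : ℝ)) z := fun z hz => if_neg hz
  have hs : ContDiff ℝ ∞ H₁ := by
    rw [contDiff_iff_contDiffAt]
    intro z
    by_cases h : z ∈ K
    · exact (hH.contDiffAt (hD.mem_nhds (hKD h))).congr_of_eventuallyEq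
        (Filter.eventually_of_mem (hD.mem_nhds (hKD h)) eqD)
    · exact contDiffAt_const.congr_of_eventuallyEq
        (Filter.eventually_of_mem (hK.isClosed.isOpen_compl.mem_nhds h) eqK)
  have hc : HasCompactSupport H₁ := HasCompactSupport.intro hK eqK
  have hpd0 : ∀ z ∉ K, pd i H₁ z = 0 := fun z hz => by
    rw [pd_congr hK.isClosed.isOpen_compl eqK hz, pd_const]
  have e : ∫ z in K, pd i H z = ∫ z, pd i H₁ z := by
    rw [← setIntegral_eq_integral_of_forall_compl_eq_zero hpd0]
    exact setIntegral_congr_fun hK.measurableSet fun z hz =>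
      (pd_congr hD eqD (hKD hz)).symm
  have hcont : Continuous (pd i H₁) := (hs.continuous_fderiv (by simp)).clm_apply continuous_const
  have hcs : HasCompactSupport (pd i H₁) := HasCompactSupport.intro hK hpd0
  have hd : Differentiable ℝ H₁ := hs.differentiable (by simp)
  have key := integral_mul_fderiv_eq_neg_fderiv_mul_of_integrable (μ := volume)
    (f := fun _ : ℝ × ℝ => (1 : ℝ)) (g := H₁) (v := coordVec i) (by simp)
    (by simp only [one_mul]; exact hcont.integrable_of_hasCompactSupport hcs)
    (by simpa using hs.continuous.integrable_of_hasCompactSupport hc)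
    (fun x _ => differentiableAt_const 1) (fun x _ => hd x)
  simp only [one_mul, fderiv_fun_const, Pi.zero_apply, zero_apply, zero_mul, integral_zero,
    neg_zero] at key
  exact e.trans key

end Integrals

/-! ### Smoothness of the area density along a family. -/

section AreaDensity

variable {D : Set (ℝ × ℝ)} {Φ : ℝ → ℝ × ℝ → Fin 4 → ℝ}

/-- A variation may degenerate for large t, and the density need not be smooth there.
Differentiation under the integral needs only an open set containing {0} × K. -/
theorem isOpen_nondegenerate_family (hD : IsOpen D)
    (hΦ : ContDiffOn ℝ ∞ (fun w : ℝ × (ℝ × ℝ) => Φ w.1 w.2) (univ ×ˢ D)) :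
    IsOpen ((univ ×ˢ D) ∩ {w : ℝ × (ℝ × ℝ) | (secondForm (Φ w.1) w.2).det ≠ 0}) := by
  have hS := fun i j => (contDiffOn_secondForm_family hD hΦ i j).continuousOn
  have h : ContinuousOn (fun w : ℝ × (ℝ × ℝ) => (secondForm (Φ w.1) w.2).det) (univ ×ˢ D) := by
    simp only [Matrix.det_fin_two]
    exact ((hS 0 0).mul (hS 1 1)).sub ((hS 0 1).mul (hS 1 0))
  exact h.isOpen_inter_preimage (isOpen_univ.prod hD) isOpen_ne

theorem contDiffOn_preCubicForm_family (hD : IsOpen D)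
    (hΦ : ContDiffOn ℝ ∞ (fun w : ℝ × (ℝ × ℝ) => Φ w.1 w.2) (univ ×ˢ D)) (i j k : Fin 2) :
    ContDiffOn ℝ ∞ (fun w : ℝ × (ℝ × ℝ) => preCubicForm (Φ w.1) w.2 i j k) (univ ×ˢ D) := by
  have hp : ∀ i j k, ContDiffOn ℝ ∞
      (fun w : ℝ × (ℝ × ℝ) => pd i (fun y => secondForm (Φ w.1) y j k) w.2) (univ ×ˢ D) :=
    fun i j k => contDiffOn_pd_family (Φ := fun t y => secondForm (Φ t) y j k) hD
      (contDiffOn_secondForm_family hD hΦ j k) i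
  have h2 := contDiffOn_pd_family (Φ := fun t => pd k (Φ t)) hD (contDiffOn_pd_family hD hΦ k) j
  have h3 := contDiffOn_pd_family (Φ := fun t => pd j (pd k (Φ t))) hD h2 i
  exact (ContDiffOn.det4 hΦ (contDiffOn_pd_family hD hΦ 0) (contDiffOn_pd_family hD hΦ 1) h3).sub
    ((((hp i j k).add (hp j k i)).add (hp k i j)).div_const 2)

theorem contDiffOn_projectiveAreaDensity_family (hD : IsOpen D)
    (hΦ : ContDiffOn ℝ ∞ (fun w : ℝ × (ℝ × ℝ) => Φ w.1 w.2) (univ ×ˢ D)) :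
    ContDiffOn ℝ ∞ (fun w : ℝ × (ℝ × ℝ) => projectiveAreaDensity (Φ w.1) w.2)
      ((univ ×ˢ D) ∩ {w : ℝ × (ℝ × ℝ) | (secondForm (Φ w.1) w.2).det ≠ 0}) := by
  set O := (univ ×ˢ D) ∩ {w : ℝ × (ℝ × ℝ) | (secondForm (Φ w.1) w.2).det ≠ 0}
  have hS : ∀ i j, ContDiffOn ℝ ∞ (fun w : ℝ × (ℝ × ℝ) => secondForm (Φ w.1) w.2 i j) O :=
    fun i j => (contDiffOn_secondForm_family hD hΦ i j).mono inter_subset_left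
  have hT : ∀ i j k, ContDiffOn ℝ ∞ (fun w : ℝ × (ℝ × ℝ) => preCubicForm (Φ w.1) w.2 i j k) O :=
    fun i j k => (contDiffOn_preCubicForm_family hD hΦ i j k).mono inter_subset_left
  have hdet : ContDiffOn ℝ ∞ (fun w : ℝ × (ℝ × ℝ) => (secondForm (Φ w.1) w.2).det) O := by
    simp only [Matrix.det_fin_two]
    exact ((hS 0 0).mul (hS 1 1)).sub ((hS 0 1).mul (hS 1 0))
  have hinv : ∀ i j, ContDiffOn ℝ ∞ (fun w : ℝ × (ℝ × ℝ) => (secondForm (Φ w.1) w.2)⁻¹ i j) O := by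
    have hd := hdet.inv fun w hw => hw.2
    have e : ∀ w : ℝ × (ℝ × ℝ), (secondForm (Φ w.1) w.2)⁻¹ = (secondForm (Φ w.1) w.2).det⁻¹ •
        !![secondForm (Φ w.1) w.2 1 1, -secondForm (Φ w.1) w.2 0 1;
          -secondForm (Φ w.1) w.2 1 0, secondForm (Φ w.1) w.2 0 0] := fun w => by
      rw [Matrix.inv_def, Matrix.adjugate_fin_two, Ring.inverse_eq_inv']
    simp only [e]
    intro i j
    fin_cases i <;> fin_cases j
    · exact hd.mul (hS 1 1)
    · exact hd.mul (hS 0 1).neg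
    · exact hd.mul (hS 1 0).neg
    · exact hd.mul (hS 0 0)
  have htr : ∀ k, ContDiffOn ℝ ∞ (fun w : ℝ × (ℝ × ℝ) => preCubicTrace (Φ w.1) w.2 k) O :=
    fun k => ContDiffOn.sum fun i _ => ContDiffOn.sum fun j _ => (hinv i j).mul (hT i j k)
  have hC : ∀ i j k, ContDiffOn ℝ ∞ (fun w : ℝ × (ℝ × ℝ) => cubicForm (Φ w.1) w.2 i j k) O :=
    fun i j k => (hT i j k).sub (((((hS i j).mul (htr k)).add ((hS j k).mul (htr i))).add
      ((hS k i).mul (htr j))).div_const 4)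
  have hsqrt : ContDiffOn ℝ ∞
      (fun w : ℝ × (ℝ × ℝ) => Real.sqrt |(secondForm (Φ w.1) w.2).det|) O := by
    refine ContDiffOn.sqrt (fun w hw => ?_) fun w hw => abs_ne_zero.2 hw.2
    exact (contDiffAt_abs hw.2).comp_contDiffWithinAt w (hdet w hw)
  exact (contDiffOn_const.mul hsqrt).mul <| ContDiffOn.sum fun i _ => ContDiffOn.sum fun j _ =>
    ContDiffOn.sum fun k _ => ContDiffOn.sum fun i' _ => ContDiffOn.sum fun j' _ =>
    ContDiffOn.sum fun k' _ =>
      ((((hinv i i').mul (hinv j j')).mul (hinv k k')).mul (hC i j k)).mul (hC i' j' k')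

end AreaDensity

/-! ### Support of the fluxes. -/

section FluxSupport

variable {U : Set (ℝ × ℝ)} {b c p q L v : ℝ × ℝ → ℝ} {z : ℝ × ℝ}

theorem pd_eq_zero_of_eqOn_zero (hU : IsOpen U) (hv : ∀ w ∈ U, v w = 0) (i : Fin 2) :
    ∀ w ∈ U, pd i v w = 0 := fun w hw => by
  rw [pd_congr hU (g' := fun _ => (0 : ℝ)) hv hw, pd_const]

theorem variationFluxX_eq_zero (hU : IsOpen U) (hv : ∀ w ∈ U, v w = 0) (hz : z ∈ U) :
    variationFluxX b c p L v z = 0 := by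
  have h := pd_eq_zero_of_eqOn_zero hU hv
  simp [variationFluxX, hv z hz, h _ z hz, pd_eq_zero_of_eqOn_zero hU (h 0) 0 z hz]

theorem variationFluxY_eq_zero (hU : IsOpen U) (hv : ∀ w ∈ U, v w = 0) (hz : z ∈ U) :
    variationFluxY b c q L v z = 0 := by
  have h := pd_eq_zero_of_eqOn_zero hU hv
  simp [variationFluxY, hv z hz, h _ z hz, pd_eq_zero_of_eqOn_zero hU (h 1) 1 z hz]

end FluxSupport

/-! ### The Euler-Lagrange equation. -/

namespace IsCanonicalLift

variable {D : Set (ℝ × ℝ)} {f : ℝ × ℝ → Fin 4 → ℝ} {b c p q : ℝ × ℝ → ℝ}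

theorem contDiffOn_projP (hf : IsCanonicalLift D f b c p q) : ContDiffOn ℝ ∞ (projP b c p) D := by
  have hD := hf.isOpen
  have hc := hf.contDiffOn_c
  have hcx := hc.pd hD 0
  have c1 : ∀ w ∈ D, 2 * c w ≠ 0 := fun w hw => by simpa using hf.c_ne_zero hw
  have c2 : ∀ w ∈ D, 4 * c w ^ 2 ≠ 0 := fun w hw => by simpa using hf.c_ne_zero hw
  exact ((hf.contDiffOn_p.add ((hf.contDiffOn_b.pd hD 1).div_const 2)).sub
    ((hcx.pd hD 0).div (contDiffOn_const.mul hc) c1)).add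
    ((hcx.pow 2).div (contDiffOn_const.mul (hc.pow 2)) c2)

theorem continuousOn_thomsenP (hf : IsCanonicalLift D f b c p q) :
    ContinuousOn (fun z => c z * pd 0 (projP b c p) z + 2 * pd 0 c z * projP b c p z) D := by
  have h1 := hf.contDiffOn_projP.continuousOn
  have h2 := (hf.contDiffOn_projP.pd hf.isOpen 0).continuousOn
  have h3 := (hf.contDiffOn_c.pd hf.isOpen 0).continuousOn
  have h4 := hf.contDiffOn_c.continuousOn
  fun_prop

/-- The first variation of the projective area. -/
theorem hasDerivAt_projectiveArea (hf : IsCanonicalLift D f b c p q)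
    {Φ : ℝ → ℝ × ℝ → Fin 4 → ℝ} {K : Set (ℝ × ℝ)} (hK : IsCompact K) (hKD : K ⊆ D)
    (hΦ : ContDiffOn ℝ ∞ (fun w : ℝ × (ℝ × ℝ) => Φ w.1 w.2) (univ ×ˢ D))
    (h0 : ∀ z ∈ D, Φ 0 z = f z) (hsupp : ∀ t, ∀ z ∈ D \ K, Φ t z = f z) :
    HasDerivAt (fun t => ∫ z in K, projectiveAreaDensity (Φ t) z)
      (∫ z in K, -2 * (c z * pd 0 (projP b c p) z + 2 * pd 0 c z * projP b c p z)
          * det4 (f z) (pd 0 f z) (pd 1 f z) (variationField Φ z)) 0 := by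
  have hD := hf.isOpen
  have hv := contDiffOn_variationField hD hΦ
  have hvj : ∀ j, ContDiffOn ℝ ∞ (fun w => variationField Φ w j) D := contDiffOn_pi.1 hv
  have hv0 : ∀ j, ∀ z ∈ D \ K, variationField Φ z j = 0 := fun j z hz => by
    simp [variationField, hsupp _ z hz]
  have hU : IsOpen (D \ K) := hD.sdiff hK.isClosed
  set X := fun w => ∑ j, variationFluxX b c p (tangentCovector f j)
            (fun y => variationField Φ y j) w
  set Y := fun w => ∑ j, variationFluxY b c q (tangentCovector f j)
            (fun y => variationField Φ y j) w
  have hX : ContDiffOn ℝ ∞ X D := ContDiffOn.sum fun j _ =>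
    contDiffOn_variationFluxX hD hf.contDiffOn_b hf.contDiffOn_c hf.contDiffOn_p
      (hf.contDiffOn_tangentCovector j) (hvj j)
  have hY : ContDiffOn ℝ ∞ Y D := ContDiffOn.sum fun j _ =>
    contDiffOn_variationFluxY hD hf.contDiffOn_b hf.contDiffOn_c hf.contDiffOn_q
      (hf.contDiffOn_tangentCovector j) (hvj j)
  have hX0 : ∀ z ∈ D \ K, X z = 0 := fun z hz =>
    Finset.sum_eq_zero fun j _ => variationFluxX_eq_zero hU (hv0 j) hz
  have hY0 : ∀ z ∈ D \ K, Y z = 0 := fun z hz =>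
    Finset.sum_eq_zero fun j _ => variationFluxY_eq_zero hU (hv0 j) hz
  have key := hasDerivAt_setIntegral_of_contDiffOn
    (G := fun t => projectiveAreaDensity (Φ t)) (isOpen_nondegenerate_family hD hΦ)
    (contDiffOn_projectiveAreaDensity_family hD hΦ) hK fun z hz => by
      refine ⟨⟨trivial, hKD hz⟩, ?_⟩
      have e : secondForm (Φ 0) z = !![0, 1; 1, 0] := by
        rw [← hf.secondForm_eq (hKD hz)]
        ext i j
        simp only [secondForm, Matrix.of_apply, h0 z (hKD hz), pd_congr hD h0 (hKD hz),
          pd_congr hD (fun w hw => pd_congr (i := j) hD h0 hw) (hKD hz)]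
      simp [e, Matrix.det_fin_two]
  convert! key using 1
  set M := fun z => -2 * (c z * pd 0 (projP b c p) z + 2 * pd 0 c z * projP b c p z)
          * det4 (f z) (pd 0 f z) (pd 1 f z) (variationField Φ z)
  have hM : ContinuousOn M D := (continuousOn_const.mul hf.continuousOn_thomsenP).mul
    (hf.contDiffOn_f.det4 (hf.contDiffOn_f.pd hD 0) (hf.contDiffOn_f.pd hD 1) hv).continuousOn
  have e : ∫ z in K, deriv (fun t => projectiveAreaDensity (Φ t) z) 0 =
      ∫ z in K, M z + pd 0 X z + pd 1 Y z :=
    setIntegral_congr_fun hK.measurableSet fun z hz =>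
      (hf.hasDerivAt_projectiveAreaDensity hΦ h0 (hKD hz)).deriv
  have iM : IntegrableOn M K := (hM.mono hKD).integrableOn_compact hK
  have iX : IntegrableOn (pd 0 X) K :=
    ((hX.pd hD 0).continuousOn.mono hKD).integrableOn_compact hK
  have iY : IntegrableOn (pd 1 Y) K :=
    ((hY.pd hD 1).continuousOn.mono hKD).integrableOn_compact hK
  -- Both fluxes vanish on D outside K, so their derivatives integrate to zero over K.
  rw [e, integral_add (f := fun z => M z + pd 0 X z) (iM.add iX) iY, integral_add iM iX, setIntegral_pd_eq_zero hD hK hKD hX hX0,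
    setIntegral_pd_eq_zero hD hK hKD hY hY0, add_zero, add_zero]

theorem satisfiesThomsen_iff_isProjectiveMinimal (hf : IsCanonicalLift D f b c p q) :
    SatisfiesThomsen D b c p q ↔ IsProjectiveMinimal D f := by
  have hD := hf.isOpen
  rw [hf.satisfiesThomsen_iff]
  constructor
  · intro h Φ K hK hKD hΦ h0 hsupp
    have key := hf.hasDerivAt_projectiveArea hK hKD hΦ h0 hsupp
    rwa [setIntegral_congr_fun (g := fun _ => (0 : ℝ)) hK.measurableSet
      (fun z hz => by simp only [h z (hKD hz), mul_zero, zero_mul]), integral_zero] at key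
  · intro h
    set θ : ℝ × ℝ → ℝ := fun z => c z * pd 0 (projP b c p) z + 2 * pd 0 c z * projP b c p z with hθ
    have hθc : ContinuousOn θ D := hf.continuousOn_thomsenP
    have hae : ∀ᵐ z, z ∈ D → θ z = 0 := by
      refine hD.ae_eq_zero_of_integral_contDiff_smul_eq_zero
        (hθc.locallyIntegrableOn hD.measurableSet) fun ψ hψ hψc hψD => ?_
      -- f_xy is transverse to the tangent plane and det(f, f_x, f_y, f_xy) = 1, so this variation
      -- tests θ against ψ itself.
      set Φ : ℝ → ℝ × ℝ → Fin 4 → ℝ := fun t z => f z + (t * ψ z) • pd 0 (pd 1 f) z with hΦdef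
      have hfxy := (hf.contDiffOn_f.pd hD 1).pd hD 0
      have hsnd : ∀ {g : ℝ × ℝ → Fin 4 → ℝ}, ContDiffOn ℝ ∞ g D →
          ContDiffOn ℝ ∞ (fun w : ℝ × (ℝ × ℝ) => g w.2) (univ ×ˢ D) := fun hg =>
        hg.comp contDiffOn_snd fun w hw => hw.2
      have hΦ : ContDiffOn ℝ ∞ (fun w : ℝ × (ℝ × ℝ) => Φ w.1 w.2) (univ ×ˢ D) :=
        (hsnd hf.contDiffOn_f).add
          ((contDiff_fst.mul (hψ.comp contDiff_snd)).contDiffOn.smul (hsnd hfxy))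
      have h0 : ∀ z ∈ D, Φ 0 z = f z := fun z _ => by simp [hΦdef]
      have hsupp : ∀ t, ∀ z ∈ D \ tsupport ψ, Φ t z = f z := fun t z hz => by
        simp [hΦdef, image_eq_zero_of_notMem_tsupport hz.2]
      have hv : ∀ z, variationField Φ z = ψ z • pd 0 (pd 1 f) z := fun z => by
        have := (((hasDerivAt_id (0 : ℝ)).mul_const (ψ z)).smul_const (pd 0 (pd 1 f) z)).const_add
          (f z)
        rw [one_mul] at this
        exact this.deriv
      have key := (hf.hasDerivAt_projectiveArea hψc hψD hΦ h0 hsupp).unique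
        (h Φ _ hψc hψD hΦ h0 hsupp)
      have e : ∫ z in tsupport ψ, -2 * θ z * det4 (f z) (pd 0 f z) (pd 1 f z)
          (variationField Φ z) = ∫ z in tsupport ψ, -2 * (ψ z • θ z) := by
        refine setIntegral_congr_fun hψc.isCompact.measurableSet fun z hz => ?_
        have h1 := hf.det4_eq_one (hψD hz)
        simp only [hv, det4_eq, Pi.smul_apply, smul_eq_mul] at h1 ⊢
        linear_combination -2 * θ z * ψ z * h1
      rw [e, integral_const_mul, setIntegral_eq_integral_of_forall_compl_eq_zero
        (fun z hz => by rw [image_eq_zero_of_notMem_tsupport hz, zero_smul])] at key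
      simpa using key
    -- Continuity of θ upgrades vanishing almost everywhere to vanishing on all of D.
    have := Measure.eqOn_open_of_ae_eq (f := θ) (g := fun _ => 0)
      ((ae_restrict_iff' hD.measurableSet).2 hae) hD hθc continuousOn_const
    exact fun z hz => this hz

end IsCanonicalLift

end

theorem mainTheorem5 (D : Set (ℝ × ℝ)) (f : ℝ × ℝ → Fin 4 → ℝ) (b c p q : ℝ × ℝ → ℝ)
    (hf : IsCanonicalLift D f b c p q) :
    List.TFAE [
      IsProjectiveMinimal D f,
      SatisfiesThomsen D b c p q,
      IsSmoothIntoQuadrics D (conformalGaussMap f b c) ∧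
        IsLorentzConformal D (conformalGaussMap f b c) ∧
        IsLorentzHarmonic D (conformalGaussMap f b c),
      ∀ l : ℝ, l ≠ 0 →
        IsFlatConnection D (familyU (wilczynskiFrame f b c) l)
          (familyV (wilczynskiFrame f b c) l)] := by
  tfae_have 1 ↔ 2 := hf.satisfiesThomsen_iff_isProjectiveMinimal.symm
  tfae_have 2 ↔ 3 := by
    rw [hf.satisfiesThomsen_iff_harmonic]
    -- Smoothness and conformality hold for every canonical lift; only harmonicity is a condition.
    exact ⟨fun h => ⟨hf.isSmoothIntoQuadrics, hf.isLorentzConformal, h⟩, fun h => h.2.2⟩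
  tfae_have 2 ↔ 4 := hf.satisfiesThomsen_iff_flat
  tfae_finish
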